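/- Let $n\ge 3$ and $r\ge 1$ be integers, and put $\ell'=\lfloor n/2\rfloor$, $\ell=\ell'+1$, $d=\tfrac n2-r$. **The algebra.** Let $I=\{\pm1,\dots,\pm\ell\}$ if $n$ is even and $I=\{0,\pm1,\dots,\pm\ell\}$ if $n$ is odd. Let $\mathfrak g=\mathfrak{so}(n+2,\mathbb C)$ be the Lie algebra of the quadratic form $\sum_{j=1}^{\ell}U_jU_{-j}+\tfrac12U_0^2$ (with the term in $U_0$ only for odd $n$), spanned by the matrices $E_{pq}=e_{pq}-e_{-q,-p}$ $(p,q\in I)$. Let $\mathfrak h=\bigoplus_{j=1}^{\ell}\mathbb C E_{jj}$ be its Cartan subalgebra, $\varepsilon_1,\dots,\varepsilon_\ell\in\mathfrak h^*$ the basis dual to the $E_{jj}$, and $\mathfrak n^+$ the span of the $E_{ij},E_{i,-j}$ $(1\le i<j\le\ell)$ and, for odd $n$, of the $E_{i,0}$ $(1\le i\le \ell)$. Let $\vartheta$ be the anti-involution $\vartheta(E_{pq})=E_{qp}$ of $\mathfrak g$. Category $\mathcal O$ consists of the finitely generated $\mathfrak g$-modules that are sums of their $\mathfrak h$-weight spaces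 and on which $\mathfrak n^+$ acts locally finitely. For $\nu\in\mathfrak h^*$, $L(\nu)$ is the simple $\mathfrak g$-module with highest weight $\nu$. The $\mathcal O$-dual $N^\vee$ of a module $N$ in $\mathcal O$ is the sum of the $\mathfrak h$-weight spaces of $N^*$, where $\mathfrak g$ acts on $N^*$ by $(Yf)(x)=f(\vartheta(Y)x)$. **The modules.** Let $A=\mathbb C[X_1,\dots,X_n]$, $F=\sum_iX_i^2$, $\Delta_1=\tfrac12\sum_i\partial_{X_i}^2$, $E_1=\sum_iX_i\partial_{X_i}$, and let $D(A)$ be the algebra of polynomial differential operators. In the variables $U_{a+1}=X_a-iX_{a+\ell'}$, $U_{-(a+1)}=X_a+iX_{a+\ell'}$ $(1\le a\le\ell')$ and, for odd $n$, $U_0=\sqrt2X_n$, there is a Lie algebra homomorphism $\tilde\psi_d:\mathfrak g\to D(A)$ with, for $p,q\in I\setminus\{\pm1\}$, $$E_{11}\mapsto-(E_1+d),\quad E_{p1}\mapsto U_p,\quad E_{1p}\mapsto \tfrac12U_{-p}\Delta_1-(E_1+d)\,\partial_{U_{p}},\quad E_{pq}\mapsto U_p\partial_{U_q}-U_{-q}\partial_{U_{-p}}.$$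 Let $\mathcal F$ be the anti-automorphism of $D(A)$ that interchanges $U_p$ and $\partial_{U_p}$ for all $p$. Then $\mathfrak g$ acts through $\tilde\psi_d$ on $R_r=A/F^rA$, and through $\tau=\mathcal F\circ\tilde\psi_d\circ\vartheta$ on the space of level-$r$ harmonics $M_r=\{f\in A:\Delta_1^rf=0\}$; the operators $\tau(Y)$ are symmetries of $\Delta_1^r$, that is, $\Delta_1^r\,\tau(Y)\in D(A)\,\Delta_1^r$. Put $$\lambda=-d\,\varepsilon_1=\bigl(r-\tfrac n2\bigr)\varepsilon_1,\qquad \mu=\lambda+(d-1)(\varepsilon_1-\varepsilon_2)=-\varepsilon_1+(1-d)\varepsilon_2 .$$ **Theorem.** Both $R_r=N(\lambda)$ and $M_r$ are objects of category $\mathcal O$, and there is an isomorphism of $\mathfrak g$-modules $M_r\cong R_r^\vee$. Furthermore: 1. If $n$ is odd, or $n$ is even and $r<\frac n2$, then $M_r$ is simple and $M_r\cong R_r\cong L(\lambda)$. 2. If $n$ is even and $r\ge\frac n2$, then the socle $\operatorname{Soc}M_r$ is simple and finite dimensional, with $\operatorname{Soc}M_r\cong(R_r/\operatorname{Soc}R_r)^\vee\cong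 L(\lambda)$, and the quotient $M_r/\operatorname{Soc}M_r$ is simple, with $M_r/\operatorname{Soc}M_r\cong(\operatorname{Soc}R_r)^\vee\cong L(\mu)$. -/

import Mathlib

set_option linter.unusedSimpArgs false

noncomputable section

namespace HigherHarmonics

open MvPolynomial

attribute [local instance 100] LieRing.ofAssociativeRing

/-! ### The orthogonal Lie algebra -/

/-- Signed indices `±1, …, ±m`, together with `0` when `e = 1`:
`inl j` is the index `j + 1`, `inr (inl j)` is `-(j + 1)`, and `inr (inr _)` is `0`. -/
abbrev Idx (m e : ℕ) : Type := Fin m ⊕ Fin m ⊕ Fin e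

/-- The involution `p ↦ -p` on signed indices. -/
def opp {m e : ℕ} : Idx m e → Idx m e
  | .inl j => .inr (.inl j)
  | .inr (.inl j) => .inl j
  | .inr (.inr k) => .inr (.inr k)

/-- The indices `0, ±1, …, ±ℓ` for `so(n+2)`, where `ℓ = ⌊n/2⌋ + 1`
(the index `0` occurs only for odd `n`). -/
abbrev Out (n : ℕ) : Type := Idx (n / 2 + 1) (n % 2)

/-- The indices `0, ±2, …, ±ℓ`; here `inl j` is the index `j + 2` and `inr (inl j)` is
`-(j + 2)`. -/
abbrev Inn (n : ℕ) : Type := Idx (n / 2) (n % 2)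

/-- The inclusion of the indices `0, ±2, …, ±ℓ` into `0, ±1, …, ±ℓ`. -/
def inc {m e : ℕ} : Idx m e → Idx (m + 1) e
  | .inl j => .inl j.succ
  | .inr (.inl j) => .inr (.inl j.succ)
  | .inr (.inr k) => .inr (.inr k)

/-- The index `1`. -/
def idx1 {m e : ℕ} : Idx (m + 1) e := .inl 0

@[simp] theorem opp_opp {m e : ℕ} (p : Idx m e) : opp (opp p) = p := by
  rcases p with j | j | k <;> rfl

theorem opp_eq_iff {m e : ℕ} (p q : Idx m e) : opp p = q ↔ p = opp q := by
  constructor <;> rintro rfl <;> simp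

@[simp] theorem opp_inj {m e : ℕ} (p q : Idx m e) : opp p = opp q ↔ p = q := by
  rw [opp_eq_iff, opp_opp]

@[simp] theorem opp_inc {m e : ℕ} (p : Idx m e) : opp (inc p) = inc (opp p) := by
  rcases p with j | j | k <;> rfl

theorem sum_Idx {m e : ℕ} {MMod : Type*} [AddCommMonoid MMod] (f : Idx (m + 1) e → MMod) :
    ∑ p, f p = f idx1 + f (opp idx1) + ∑ p, f (inc p) := by
  simp only [Fintype.sum_sum_type, Fin.sum_univ_succ, inc, idx1, opp]
  abel

theorem card_Out (n : ℕ) : Fintype.card (Out n) = n + 2 := by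
  simp only [Fintype.card_sum, Fintype.card_fin]; omega

/-- The Gram matrix of the quadratic form `∑ U_j U_{-j} + ½ U_0²`. -/
def gram (n : ℕ) : Matrix (Out n) (Out n) ℂ := fun p q => if p = opp q then 1 else 0

/-- The Lie algebra `so(n+2, ℂ)` of the quadratic form `∑ U_j U_{-j} + ½ U_0²`. -/
abbrev so (n : ℕ) : LieSubalgebra ℂ (Matrix (Out n) (Out n) ℂ) :=
  skewAdjointMatricesLieSubalgebra (gram n)

theorem mem_so {n : ℕ} (Y : Matrix (Out n) (Out n) ℂ) :
    Y ∈ so n ↔ ∀ p q, Y (opp q) (opp p) = -Y p q := by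
  rw [mem_skewAdjointMatricesLieSubalgebra, mem_skewAdjointMatricesSubmodule]
  unfold Matrix.IsSkewAdjoint Matrix.IsAdjointPair
  rw [← Matrix.ext_iff]
  have h1 : ∀ p q, (Y.transpose * gram n) p q = Y (opp q) p := by
    intro p q; simp [Matrix.mul_apply, gram]
  have h2 : ∀ p q, (gram n * -Y) p q = - Y (opp p) q := by
    intro p q
    rw [Matrix.mul_apply, Finset.sum_eq_single (opp p)]
    · simp [gram]
    · intro b _ hb
      have : p ≠ opp b := fun h => hb (by rw [h, opp_opp])
      simp [gram, this]
    · simp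
  simp only [h1, h2]
  constructor
  · intro h p q
    rw [h (opp p) q, opp_opp]
  · intro h p q
    have := h (opp p) q
    rwa [opp_opp] at this

theorem skew {n : ℕ} (Y : so n) (p q : Out n) : Y.1 (opp q) (opp p) = -Y.1 p q :=
  (mem_so Y.1).1 Y.2 p q

/-- The elements `E_{pq} = e_{pq} - e_{-q,-p}` of `so(n+2, ℂ)`. -/
def E {n : ℕ} (p q : Out n) : so n :=
  ⟨Matrix.single p q 1 - Matrix.single (opp q) (opp p) 1, by
    rw [mem_so]; intro a b
    simp only [Matrix.sub_apply, Matrix.single_apply, neg_sub, opp_eq_iff, opp_opp]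
    simp only [and_comm]⟩

/-- The transposition on `so(n+2, ℂ)`: this is the Chevalley anti-involution `ϑ`, which
interchanges `E_{pq}` and `E_{qp}` and fixes the Cartan subalgebra. -/
def theta {n : ℕ} : so n →ₗ[ℂ] so n where
  toFun Y := ⟨Y.1.transpose, by
    rw [mem_so]; intro p q; simpa using skew Y q p⟩
  map_add' Y Z := by ext; simp
  map_smul' c Y := by ext; simp

theorem theta_E {n : ℕ} (p q : Out n) : theta (E p q) = E q p := by
  ext a b; simp [theta, E, Matrix.single_apply, and_comm]

theorem theta_lie {n : ℕ} (Y Z : so n) : theta ⁅Y, Z⁆ = ⁅theta Z, theta Y⁆ := by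
  ext a b
  simp [theta, Ring.lie_def, ← Matrix.transpose_mul]

/-- The Cartan subalgebra of diagonal matrices. -/
def cartan (n : ℕ) : Submodule ℂ (so n) where
  carrier := {H | ∀ p q, p ≠ q → H.1 p q = 0}
  zero_mem' := by intro p q _; simp
  add_mem' := by intro a b ha hb p q h; simp [ha p q h, hb p q h]
  smul_mem' := by intro c a ha p q h; simp [ha p q h]

theorem theta_cartan {n : ℕ} (H : cartan n) : theta (H : so n) = H := by
  ext a b
  by_cases h : a = b
  · simp [theta, h]
  · simp [theta, H.2 a b h, H.2 b a (Ne.symm h)]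

/-- Weights: linear forms on the Cartan subalgebra. -/
abbrev Weight (n : ℕ) : Type := Module.Dual ℂ (cartan n)

/-- The weight `ε_p`, `H ↦ H_{pp}`. -/
def eps {n : ℕ} (p : Out n) : Weight n where
  toFun H := H.1.1 p p
  map_add' _ _ := by simp
  map_smul' _ _ := by simp

/-- The index `2`. -/
def idx2 {n : ℕ} (hn : 3 ≤ n) : Out n := .inl ⟨1, by omega⟩

/-- The root vectors spanning `𝔫⁺`: the `E_{ij}` and `E_{i,-j}` with `1 ≤ i < j ≤ ℓ`, and the
`E_{0,-j}` with `1 ≤ j ≤ ℓ` when `n` is odd. -/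
inductive IsPos {n : ℕ} : so n → Prop
  | sub (i j : Fin (n / 2 + 1)) (h : i < j) : IsPos (E (.inl i) (.inl j))
  | add (i j : Fin (n / 2 + 1)) (h : i < j) : IsPos (E (.inl i) (.inr (.inl j)))
  | short (k : Fin (n % 2)) (j : Fin (n / 2 + 1)) : IsPos (E (.inr (.inr k)) (.inr (.inl j)))

/-! ### The Weyl algebra -/

/-- The defining relations of the Weyl algebra; `inl j` stands for `X_j`, `inr j` for
`∂_{X_j}`. -/
inductive WeylRel (n : ℕ) :
    FreeAlgebra ℂ (Fin n ⊕ Fin n) → FreeAlgebra ℂ (Fin n ⊕ Fin n) → Prop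
  | xx (i j : Fin n) : WeylRel n (FreeAlgebra.ι ℂ (.inl i) * FreeAlgebra.ι ℂ (.inl j))
      (FreeAlgebra.ι ℂ (.inl j) * FreeAlgebra.ι ℂ (.inl i))
  | dd (i j : Fin n) : WeylRel n (FreeAlgebra.ι ℂ (.inr i) * FreeAlgebra.ι ℂ (.inr j))
      (FreeAlgebra.ι ℂ (.inr j) * FreeAlgebra.ι ℂ (.inr i))
  | dx (i j : Fin n) : WeylRel n (FreeAlgebra.ι ℂ (.inr i) * FreeAlgebra.ι ℂ (.inl j))
      (FreeAlgebra.ι ℂ (.inl j) * FreeAlgebra.ι ℂ (.inr i) + if i = j then 1 else 0)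

/-- The `n`-th Weyl algebra `ℂ[X_1, …, X_n, ∂_1, …, ∂_n]`. -/
def Weyl (n : ℕ) : Type := RingQuot (WeylRel n)

instance (n : ℕ) : Ring (Weyl n) := inferInstanceAs (Ring (RingQuot (WeylRel n)))

instance (n : ℕ) : Algebra ℂ (Weyl n) := inferInstanceAs (Algebra ℂ (RingQuot (WeylRel n)))

/-- The quotient map from the free algebra to the Weyl algebra. -/
def weylMk (n : ℕ) : FreeAlgebra ℂ (Fin n ⊕ Fin n) →ₐ[ℂ] Weyl n :=
  RingQuot.mkAlgHom ℂ (WeylRel n)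

section weyl
variable {n : ℕ}

/-- The generator `X_j` of the Weyl algebra. -/
def x (j : Fin n) : Weyl n := weylMk n (FreeAlgebra.ι ℂ (.inl j))

/-- The generator `∂_{X_j}` of the Weyl algebra. -/
def dx (j : Fin n) : Weyl n := weylMk n (FreeAlgebra.ι ℂ (.inr j))

theorem weylMk_rel {a b : FreeAlgebra ℂ (Fin n ⊕ Fin n)} (h : WeylRel n a b) :
    weylMk n a = weylMk n b := RingQuot.mkAlgHom_rel ℂ h

theorem x_mul_x (i j : Fin n) : x i * x j = x j * x i := by
  simpa [x] using weylMk_rel (WeylRel.xx i j)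

theorem dx_mul_dx (i j : Fin n) : dx i * dx j = dx j * dx i := by
  simpa [dx] using weylMk_rel (WeylRel.dd i j)

theorem dx_mul_x (i j : Fin n) : dx i * x j = x j * dx i + if i = j then 1 else 0 := by
  have := weylMk_rel (WeylRel.dx i j)
  rw [map_mul, map_add, map_mul] at this
  rw [dx, x, this]; split_ifs <;> simp

/-- The universal property of the Weyl algebra. -/
def weylLift {B : Type} [Ring B] [Algebra ℂ B] (a b : Fin n → B)
    (hx : ∀ i j, a i * a j = a j * a i) (hd : ∀ i j, b i * b j = b j * b i)
    (hdx : ∀ i j, b i * a j = a j * b i + if i = j then 1 else 0) : Weyl n →ₐ[ℂ] B :=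
  RingQuot.liftAlgHom ℂ ⟨FreeAlgebra.lift ℂ (Sum.elim a b), by
    rintro _ _ (⟨i, j⟩ | ⟨i, j⟩ | ⟨i, j⟩)
    · simp [hx i j]
    · simp [hd i j]
    · simp only [map_mul, map_add, FreeAlgebra.lift_ι_apply, Sum.elim_inl, Sum.elim_inr, hdx i j]
      split_ifs <;> simp⟩

@[simp] theorem weylLift_x {B : Type} [Ring B] [Algebra ℂ B] (a b : Fin n → B) (hx hd hdx)
    (j : Fin n) : weylLift a b hx hd hdx (x j) = a j := by
  exact (RingQuot.liftAlgHom_mkAlgHom_apply ℂ _ _ _).trans (by simp)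

@[simp] theorem weylLift_dx {B : Type} [Ring B] [Algebra ℂ B] (a b : Fin n → B) (hx hd hdx)
    (j : Fin n) : weylLift a b hx hd hdx (dx j) = b j := by
  exact (RingQuot.liftAlgHom_mkAlgHom_apply ℂ _ _ _).trans (by simp)

/-- The action of the Weyl algebra on `ℂ[X_1, …, X_n]` by differential operators. -/
def ev : Weyl n →ₐ[ℂ] Module.End ℂ (MvPolynomial (Fin n) ℂ) :=
  weylLift (fun j => LinearMap.mulLeft ℂ (X j)) (fun j => (pderiv j).toLinearMap)
    (by intro i j; apply LinearMap.ext; intro p; simp [mul_left_comm])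
    (by
      intro i j
      apply LinearMap.ext
      intro p
      have h : ⁅(pderiv i : Derivation ℂ (MvPolynomial (Fin n) ℂ) (MvPolynomial (Fin n) ℂ)),
          (pderiv j : Derivation ℂ (MvPolynomial (Fin n) ℂ) (MvPolynomial (Fin n) ℂ))⁆ = 0 := by
        apply MvPolynomial.derivation_ext
        intro k
        simp [Derivation.commutator_apply, Pi.single_apply, apply_ite]
      have h2 := congrArg (fun D : Derivation ℂ (MvPolynomial (Fin n) ℂ) (MvPolynomial (Fin n) ℂ) => D p) h
      simpa [Derivation.commutator_apply, sub_eq_zero] using h2)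
    (by
      intro i j
      apply LinearMap.ext
      intro p
      by_cases h : i = j
      · subst h; simp [add_comm]
      · simp [h, Ne.symm h])

/-- The sign in the Fourier transform: `-1` for `X_j` with `ℓ' + 1 ≤ j ≤ 2ℓ'`, `ℓ' = ⌊n/2⌋`, and
`1` otherwise (the variables are numbered from `0` here). -/
def sgn (j : Fin n) : ℂ := if n / 2 ≤ (j : ℕ) ∧ (j : ℕ) < 2 * (n / 2) then -1 else 1

theorem sgn_mul_sgn (j : Fin n) : sgn j * sgn j = 1 := by
  unfold sgn; split_ifs <;> norm_num

/-- The Fourier transform, an anti-automorphism of the Weyl algebra: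
`X_j ↦ ±½ ∂_{X_j}` and `∂_{X_j} ↦ ±2 X_j`. In the variables `U_p` below it is
`U_p ↦ ∂_{U_p}`, `∂_{U_p} ↦ U_p`. -/
def fourierHom : Weyl n →ₐ[ℂ] (Weyl n)ᵐᵒᵖ :=
  weylLift (fun j => MulOpposite.op ((sgn j / 2) • dx j)) (fun j => MulOpposite.op ((2 * sgn j) • x j))
    (by intro i j; simp only [← MulOpposite.op_mul, smul_mul_smul_comm, dx_mul_dx i j, mul_comm])
    (by intro i j; simp only [← MulOpposite.op_mul, smul_mul_smul_comm, x_mul_x i j, mul_comm])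
    (by
      intro i j
      apply MulOpposite.unop_injective
      simp only [← MulOpposite.op_mul, MulOpposite.unop_op, MulOpposite.unop_add, smul_mul_smul_comm,
        dx_mul_x]
      by_cases h : i = j
      · subst h
        have : sgn i / 2 * (2 * sgn i) = 1 := by linear_combination sgn_mul_sgn i
        have h' : 2 * sgn i * (sgn i / 2) = 1 := by linear_combination sgn_mul_sgn i
        simp [this, h']
      · simp [h, Ne.symm h]; ring_nf)

/-- The Fourier transform as a linear map of the Weyl algebra to itself. -/
def fourier : Weyl n →ₗ[ℂ] Weyl n :=
  (MulOpposite.opLinearEquiv ℂ).symm.toLinearMap ∘ₗ (fourierHom (n := n)).toLinearMap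

theorem fourier_mul (a b : Weyl n) : fourier (a * b) = fourier b * fourier a := by
  simp [fourier]

theorem fourier_x (j : Fin n) : fourier (x j) = (sgn j / 2) • dx j := by
  simp [fourier, fourierHom]

theorem fourier_dx (j : Fin n) : fourier (dx j) = (2 * sgn j) • x j := by
  simp [fourier, fourierHom]

end weyl

section operators
variable {n : ℕ}

theorem lie_mul' {B : Type} [Ring B] (a b c : B) : ⁅a, b * c⁆ = ⁅a, b⁆ * c + b * ⁅a, c⁆ := by
  simp only [Ring.lie_def]; noncomm_ring

theorem mul_lie' {B : Type} [Ring B] (a b c : B) : ⁅a * b, c⁆ = a * ⁅b, c⁆ + ⁅a, c⁆ * b := by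
  simp only [Ring.lie_def]; noncomm_ring

theorem x_lie_x (i j : Fin n) : ⁅x i, x j⁆ = 0 := by rw [Ring.lie_def, x_mul_x, sub_self]

theorem dx_lie_dx (i j : Fin n) : ⁅dx i, dx j⁆ = 0 := by rw [Ring.lie_def, dx_mul_dx, sub_self]

theorem dx_lie_x (i j : Fin n) : ⁅dx i, x j⁆ = if i = j then 1 else 0 := by
  rw [Ring.lie_def, dx_mul_x]; abel

/-- The Laplacian `Δ_1 = ½ ∑ ∂_{X_i}²`. -/
def lap (n : ℕ) : Weyl n := (1 / 2 : ℂ) • ∑ i, dx i * dx i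

/-- The Euler operator `∑ X_i ∂_{X_i}`. -/
def eul (n : ℕ) : Weyl n := ∑ i, x i * dx i

/-- The quadratic form `F = ∑ X_i²`, as an element of the Weyl algebra. -/
def quad (n : ℕ) : Weyl n := ∑ i, x i * x i

theorem lap_lie_x (j : Fin n) : ⁅lap n, x j⁆ = dx j := by
  simp only [lap, smul_lie, sum_lie, mul_lie', dx_lie_x, mul_ite, mul_one, mul_zero, ite_mul,
    one_mul, zero_mul, Finset.sum_add_distrib, Finset.sum_ite_eq', Finset.mem_univ, if_true]
  rw [← two_smul ℂ, smul_smul]; norm_num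

theorem lap_lie_dx (j : Fin n) : ⁅lap n, dx j⁆ = 0 := by
  simp [lap, smul_lie, sum_lie, mul_lie', dx_lie_dx]

theorem eul_lie_x (j : Fin n) : ⁅eul n, x j⁆ = x j := by
  simp [eul, sum_lie, mul_lie', dx_lie_x, x_lie_x]

theorem eul_lie_dx (j : Fin n) : ⁅eul n, dx j⁆ = -dx j := by
  have : ∀ i : Fin n, ⁅x i, dx j⁆ = - if j = i then 1 else 0 := by
    intro i; rw [← lie_skew, dx_lie_x]
  simp [eul, sum_lie, mul_lie', dx_lie_dx, this]

theorem eul_lie_lap : ⁅eul n, lap n⁆ = -(2 : ℂ) • lap n := by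
  simp only [lap, lie_smul, lie_sum, lie_mul', eul_lie_dx, neg_mul, mul_neg, smul_smul]
  rw [Finset.smul_sum, Finset.smul_sum]
  apply Finset.sum_congr rfl; intro i _
  module

/-- The position of `X_a`, `1 ≤ a ≤ ℓ' = ⌊n/2⌋`. -/
def posA (j : Fin (n / 2)) : Fin n := ⟨j, by omega⟩

/-- The position of `X_{a+ℓ'}`, `1 ≤ a ≤ ℓ' = ⌊n/2⌋`. -/
def posB (j : Fin (n / 2)) : Fin n := ⟨j + n / 2, by omega⟩

/-- The position of `X_n`, for odd `n`. -/
def posC (k : Fin (n % 2)) : Fin n := ⟨n - 1, by have := k.2; omega⟩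

/-- The variables `U_{a+1} = X_a - i X_{a+ℓ'}`, `U_{-(a+1)} = X_a + i X_{a+ℓ'}` and, for odd `n`,
`U_0 = √2 X_n`. -/
def U : Inn n → Weyl n
  | .inl j => x (posA j) - Complex.I • x (posB j)
  | .inr (.inl j) => x (posA j) + Complex.I • x (posB j)
  | .inr (.inr k) => ((√2 : ℝ) : ℂ) • x (posC k)

/-- The derivations `∂_{U_p}` dual to the variables `U_p`. -/
def DU : Inn n → Weyl n
  | .inl j => (1 / 2 : ℂ) • (dx (posA j) + Complex.I • dx (posB j))
  | .inr (.inl j) => (1 / 2 : ℂ) • (dx (posA j) - Complex.I • dx (posB j))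
  | .inr (.inr k) => ((√2 : ℝ) : ℂ)⁻¹ • dx (posC k)

theorem sqrt2_ne : ((√2 : ℝ) : ℂ) ≠ 0 := by simp

theorem sqrt2_mul : ((√2 : ℝ) : ℂ) * ((√2 : ℝ) : ℂ) = 2 := by
  rw [← Complex.ofReal_mul, Real.mul_self_sqrt (by norm_num)]; norm_num

theorem U_lie_U (p q : Inn n) : ⁅U p, U q⁆ = 0 := by
  rcases p with j | j | j <;> rcases q with k | k | k <;> simp [U, x_lie_x]

theorem DU_lie_DU (p q : Inn n) : ⁅DU p, DU q⁆ = 0 := by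
  rcases p with j | j | j <;> rcases q with k | k | k <;> simp [DU, dx_lie_dx]

theorem DU_lie_U (p q : Inn n) : ⁅DU p, U q⁆ = if p = q then 1 else 0 := by
  have ab : ∀ j k : Fin (n / 2), posA j ≠ posB k := by
    intro j k; simp only [posA, posB, ne_eq, Fin.mk.injEq]; omega
  have ac : ∀ (j : Fin (n / 2)) (k : Fin (n % 2)), posA j ≠ posC k := by
    intro j k; have := k.2; simp only [posA, posC, ne_eq, Fin.mk.injEq]; omega
  have bc : ∀ (j : Fin (n / 2)) (k : Fin (n % 2)), posB j ≠ posC k := by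
    intro j k; have := k.2; simp only [posB, posC, ne_eq, Fin.mk.injEq]; omega
  have aa : ∀ j k : Fin (n / 2), posA j = posA k ↔ j = k := by
    intro j k; simp only [posA, Fin.mk.injEq, Fin.ext_iff]
  have bb : ∀ j k : Fin (n / 2), posB j = posB k ↔ j = k := by
    intro j k; simp only [posB, Fin.mk.injEq, Fin.ext_iff]; omega
  have cc : ∀ j k : Fin (n % 2), j = k := by
    intro j k; apply Fin.ext; omega
  have h1 : ∀ i : Fin n, ⁅dx i, x i⁆ = (1 : Weyl n) := by intro i; simp [dx_lie_x]
  have h0 : ∀ i j : Fin n, i ≠ j → ⁅dx i, x j⁆ = (0 : Weyl n) := by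
    intro i j h; simp [dx_lie_x, h]
  have hI : Complex.I * (1 / 2 * Complex.I) = -(1 / 2) := by
    linear_combination (1 / 2 : ℂ) * Complex.I_mul_I
  rcases p with j | j | j <;> rcases q with k | k | k <;>
    simp only [U, DU, smul_lie, lie_smul, lie_add, lie_sub, add_lie, sub_lie, h0 _ _ (ab _ _),
      h0 _ _ (ab _ _).symm, h0 _ _ (ac _ _), h0 _ _ (ac _ _).symm, h0 _ _ (bc _ _),
      h0 _ _ (bc _ _).symm, smul_zero, add_zero, zero_add, sub_zero, zero_sub, smul_neg,
      smul_sub, smul_smul, dx_lie_x, aa, bb, reduceCtorEq, if_false, Sum.inl.injEq, Sum.inr.injEq]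
  · split_ifs
    · rw [hI]; module
    · simp
  · split_ifs
    · rw [hI]; module
    · simp
  · split_ifs
    · rw [hI]; module
    · simp
  · split_ifs
    · rw [hI]; module
    · simp
  · rw [cc j k]; simp only [if_true, mul_inv_cancel₀ sqrt2_ne, one_smul]

theorem lap_lie_U (p : Inn n) : ⁅lap n, U p⁆ = (2 : ℂ) • DU (opp p) := by
  rcases p with j | j | j <;> simp only [U, DU, opp, lie_sub, lie_add, lie_smul, lap_lie_x, smul_smul]
  · norm_num
  · norm_num
  · congr 1; field_simp [sqrt2_ne]; rw [pow_two, sqrt2_mul]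

theorem lap_lie_DU (p : Inn n) : ⁅lap n, DU p⁆ = 0 := by
  rcases p with j | j | j <;> simp [DU, lap_lie_dx]

theorem eul_lie_U (p : Inn n) : ⁅eul n, U p⁆ = U p := by
  rcases p with j | j | j <;> simp [U, eul_lie_x]

theorem eul_lie_DU (p : Inn n) : ⁅eul n, DU p⁆ = -DU p := by
  rcases p with j | j | j <;> simp [DU, eul_lie_dx] <;> module

/-- The operator `I(d) = E_1 + d`. -/
def Iop (n : ℕ) (d : ℂ) : Weyl n := eul n + algebraMap ℂ _ d

/-- The second order operators `V_p = ½ U_p Δ_1 - I(d) ∂_{U_{-p}}`. With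
`P_j = X_j Δ_1 - I(d) ∂_{X_j}` they are `V_{±(a+1)} = ½ (P_a ∓ i P_{a+ℓ'})` and
`V_0 = P_n / √2`. -/
def V (d : ℂ) (p : Inn n) : Weyl n := (1 / 2 : ℂ) • (U p * lap n) - Iop n d * DU (opp p)

theorem algebraMap_lie (d : ℂ) (a : Weyl n) : ⁅algebraMap ℂ (Weyl n) d, a⁆ = 0 := by
  rw [Ring.lie_def, Algebra.commutes, sub_self]

theorem Iop_lie_U (d : ℂ) (p : Inn n) : ⁅Iop n d, U p⁆ = U p := by
  rw [Iop, add_lie, algebraMap_lie, eul_lie_U, add_zero]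

theorem Iop_lie_DU (d : ℂ) (p : Inn n) : ⁅Iop n d, DU p⁆ = -DU p := by
  rw [Iop, add_lie, algebraMap_lie, eul_lie_DU, add_zero]

theorem Iop_lie_lap (d : ℂ) : ⁅Iop n d, lap n⁆ = -(2 : ℂ) • lap n := by
  rw [Iop, add_lie, algebraMap_lie, eul_lie_lap, add_zero]

theorem Iop_lie_V (d : ℂ) (p : Inn n) : ⁅Iop n d, V d p⁆ = -V d p := by
  simp only [V, lie_sub, lie_smul, lie_mul', Iop_lie_U, Iop_lie_DU, Iop_lie_lap, lie_self, zero_mul,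
    mul_neg, mul_smul_comm]
  module

theorem U_lie_DU (p q : Inn n) : ⁅U p, DU q⁆ = -if q = p then 1 else 0 := by
  rw [← lie_skew, DU_lie_U]

theorem V_lie_U (d : ℂ) (p q : Inn n) :
    ⁅V d p, U q⁆ = U p * DU (opp q) - U q * DU (opp p) - if opp p = q then Iop n d else 0 := by
  simp only [V, sub_lie, smul_lie, mul_lie', lap_lie_U, DU_lie_U, Iop_lie_U, U_lie_U, zero_mul,
    mul_smul_comm, mul_ite, mul_one, mul_zero]
  module

theorem V_lie_V (d : ℂ) (p q : Inn n) : ⁅V d p, V d q⁆ = 0 := by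
  have e1 : lap n * DU (opp q) = DU (opp q) * lap n := by
    have := lap_lie_DU (opp q); rwa [Ring.lie_def, sub_eq_zero] at this
  have e2 : lap n * DU (opp p) = DU (opp p) * lap n := by
    have := lap_lie_DU (opp p); rwa [Ring.lie_def, sub_eq_zero] at this
  have e3 : DU (opp q) * DU (opp p) = DU (opp p) * DU (opp q) := by
    have := DU_lie_DU (opp q) (opp p); rwa [Ring.lie_def, sub_eq_zero] at this
  have f1 : ∀ p : Inn n, ⁅U p, lap n⁆ = -((2 : ℂ) • DU (opp p)) := by
    intro p; rw [← lie_skew, lap_lie_U]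
  have f2 : ∀ p : Inn n, ⁅DU p, lap n⁆ = 0 := by
    intro p; rw [← lie_skew, lap_lie_DU, neg_zero]
  have f3 : ∀ p : Inn n, ⁅U p, Iop n d⁆ = -U p := by
    intro p; rw [← lie_skew, Iop_lie_U]
  have f4 : ∀ p : Inn n, ⁅DU p, Iop n d⁆ = DU p := by
    intro p; rw [← lie_skew, Iop_lie_DU, neg_neg]
  have f5 : ⁅lap n, Iop n d⁆ = (2 : ℂ) • lap n := by
    rw [← lie_skew, Iop_lie_lap, neg_smul, neg_neg]
  simp only [V, sub_lie, lie_sub, smul_lie, lie_smul, mul_lie', lie_mul', f1, f2, f3, f4, f5,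
    lap_lie_U, U_lie_U, lap_lie_DU, DU_lie_DU, U_lie_DU, DU_lie_U, Iop_lie_U, Iop_lie_DU, Iop_lie_lap,
    lie_self, zero_mul, mul_zero, add_zero, zero_add, mul_neg, neg_mul, mul_smul_comm,
    smul_mul_assoc, mul_assoc, e1, e2, e3, opp_eq_iff, opp_opp, mul_ite, ite_mul, mul_one, one_mul]
  by_cases h : p = opp q
  · simp only [h, if_true, opp_opp, add_mul, sub_mul, mul_add, mul_sub, smul_mul_assoc, mul_smul_comm, mul_neg, neg_mul, mul_assoc, e1, e3]; module
  · have h2 : ¬ q = opp p := fun e => h (by rw [e, opp_opp])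
    simp only [h, h2, if_false, neg_zero, add_zero, add_mul, sub_mul, mul_add, mul_sub, smul_mul_assoc, mul_smul_comm, mul_neg, neg_mul, mul_assoc, e1, e2, e3, zero_mul, mul_zero, smul_zero]; module

end operators

section representation
variable {n : ℕ}

/-- The linear combination `∑ a_p U_p`. -/
def uPart (a : Inn n → ℂ) : Weyl n := ∑ p, a p • U p

/-- The linear combination `∑ b_p V_{-p}`. -/
def vPart (d : ℂ) (b : Inn n → ℂ) : Weyl n := ∑ p, b p • V d (opp p)

/-- The vector field `∑ C_{pq} U_p ∂_{U_q}`. -/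
def kPart (C : Inn n → Inn n → ℂ) : Weyl n := ∑ p, ∑ q, C p q • (U p * DU q)

theorem Iop_lie_uPart (d : ℂ) (a : Inn n → ℂ) : ⁅Iop n d, uPart a⁆ = uPart a := by
  simp only [uPart, lie_sum, lie_smul, Iop_lie_U]

theorem Iop_lie_vPart (d : ℂ) (b : Inn n → ℂ) : ⁅Iop n d, vPart d b⁆ = -vPart d b := by
  simp only [vPart, lie_sum, lie_smul, Iop_lie_V, smul_neg, Finset.sum_neg_distrib]

theorem Iop_lie_kPart (d : ℂ) (C : Inn n → Inn n → ℂ) : ⁅Iop n d, kPart C⁆ = 0 := by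
  simp only [kPart, lie_sum, lie_smul, lie_mul', Iop_lie_U, Iop_lie_DU, mul_neg, add_neg_cancel,
    smul_zero, Finset.sum_const_zero]

theorem uPart_lie_uPart (a b : Inn n → ℂ) : ⁅uPart a, uPart b⁆ = 0 := by
  simp only [uPart, lie_sum, sum_lie, lie_smul, smul_lie, U_lie_U, smul_zero,
    Finset.sum_const_zero]

theorem vPart_lie_vPart (d : ℂ) (a b : Inn n → ℂ) : ⁅vPart d a, vPart d b⁆ = 0 := by
  simp only [vPart, lie_sum, sum_lie, lie_smul, smul_lie, V_lie_V, smul_zero,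
    Finset.sum_const_zero]

theorem kPart_lie_U (C : Inn n → Inn n → ℂ) (q : Inn n) :
    ⁅kPart C, U q⁆ = ∑ p, C p q • U p := by
  simp only [kPart, sum_lie, smul_lie, mul_lie', DU_lie_U, U_lie_U, zero_mul, add_zero, mul_ite,
    mul_one, mul_zero, smul_ite, smul_zero, Finset.sum_ite_eq', Finset.mem_univ, if_true]

theorem kPart_lie_DU (C : Inn n → Inn n → ℂ) (p : Inn n) :
    ⁅kPart C, DU p⁆ = -∑ q, C p q • DU q := by
  simp only [kPart, sum_lie, smul_lie, mul_lie', DU_lie_DU, U_lie_DU, mul_zero, zero_add, neg_mul,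
    ite_mul, one_mul, zero_mul, smul_neg, smul_ite, smul_zero, Finset.sum_neg_distrib]
  rw [Finset.sum_comm]
  simp only [Finset.sum_ite_eq, Finset.mem_univ, if_true]

theorem kPart_lie_uPart (C : Inn n → Inn n → ℂ) (a : Inn n → ℂ) :
    ⁅kPart C, uPart a⁆ = uPart (fun p => ∑ q, C p q * a q) := by
  simp only [uPart, lie_sum, lie_smul, kPart_lie_U, Finset.smul_sum, smul_smul, Finset.sum_smul]
  rw [Finset.sum_comm]
  simp only [mul_comm]

theorem sum_opp_index {MMod : Type*} [AddCommMonoid MMod] (f : Inn n → MMod) :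
    ∑ p, f (opp p) = ∑ p, f p :=
  Equiv.sum_comp ⟨opp, opp, opp_opp, opp_opp⟩ f

theorem kPart_lie_lap (C : Inn n → Inn n → ℂ) (hC : ∀ p q, C (opp q) (opp p) = -C p q) :
    ⁅kPart C, lap n⁆ = 0 := by
  have f1 : ∀ p : Inn n, ⁅U p, lap n⁆ = -((2 : ℂ) • DU (opp p)) := by
    intro p; rw [← lie_skew, lap_lie_U]
  have f2 : ∀ p : Inn n, ⁅DU p, lap n⁆ = 0 := by
    intro p; rw [← lie_skew, lap_lie_DU, neg_zero]
  have key : ⁅kPart C, lap n⁆ = (-2 : ℂ) • ∑ p, ∑ q, C p q • (DU (opp p) * DU q) := by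
    simp only [kPart, sum_lie, smul_lie, mul_lie', f1, f2, mul_zero, zero_add, neg_mul,
      smul_mul_assoc, Finset.smul_sum]
    refine Finset.sum_congr rfl fun p _ => Finset.sum_congr rfl fun q _ => ?_
    module
  have h : ∑ p, ∑ q, C p q • (DU (opp p) * DU q) = -∑ p, ∑ q, C p q • (DU (opp p) * DU q) := by
    conv_lhs => rw [← sum_opp_index]; enter [2, p]; rw [← sum_opp_index]
    rw [Finset.sum_comm, ← Finset.sum_neg_distrib]
    refine Finset.sum_congr rfl fun p _ => ?_
    rw [← Finset.sum_neg_distrib]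
    refine Finset.sum_congr rfl fun q _ => ?_
    have e3 : DU q * DU (opp p) = DU (opp p) * DU q := by
      have := DU_lie_DU q (opp p); rwa [Ring.lie_def, sub_eq_zero] at this
    rw [hC, opp_opp, e3, neg_smul]
  have h' : ∑ p, ∑ q, C p q • (DU (opp p) * DU q) = 0 := by
    have h2 := add_eq_zero_iff_eq_neg.2 h
    rw [← two_smul ℂ] at h2
    exact (smul_eq_zero.1 h2).resolve_left two_ne_zero
  rw [key, h', smul_zero]

theorem kPart_lie_Iop (C : Inn n → Inn n → ℂ) (d : ℂ) : ⁅kPart C, Iop n d⁆ = 0 := by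
  rw [← lie_skew, Iop_lie_kPart, neg_zero]

theorem kPart_lie_vPart (d : ℂ) (C : Inn n → Inn n → ℂ)
    (hC : ∀ p q, C (opp q) (opp p) = -C p q) (b : Inn n → ℂ) :
    ⁅kPart C, vPart d b⁆ = -vPart d (fun q => ∑ p, b p * C p q) := by
  have h : ∀ p, ⁅kPart C, V d (opp p)⁆ = -∑ q, C p q • V d (opp q) := by
    intro p
    simp only [V, lie_sub, lie_smul, lie_mul', kPart_lie_U, kPart_lie_DU, kPart_lie_lap C hC,
      kPart_lie_Iop, mul_zero, zero_mul, add_zero, zero_add, opp_opp]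
    rw [← sum_opp_index]
    simp only [hC, smul_sub, Finset.sum_sub_distrib, neg_smul, Finset.sum_neg_distrib,
      Finset.mul_sum, Finset.sum_mul, Finset.smul_sum, smul_mul_assoc, mul_smul_comm, mul_neg,
      neg_mul, smul_neg, smul_comm (1 / 2 : ℂ)]
    abel
  simp only [vPart, lie_sum, lie_smul, h, smul_neg, Finset.sum_neg_distrib, Finset.smul_sum,
    smul_smul, Finset.sum_smul]
  rw [Finset.sum_comm]

theorem kPart_lie_kPart (C D : Inn n → Inn n → ℂ) :
    ⁅kPart C, kPart D⁆ = kPart (fun p q => ∑ s, (C p s * D s q - D p s * C s q)) := by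
  have h : ⁅kPart C, kPart D⁆ = ∑ p, ∑ q, D p q • (∑ s, C s p • (U s * DU q)) -
      ∑ p, ∑ q, D p q • (∑ s, C q s • (U p * DU s)) := by
    conv_lhs => rw [kPart.eq_1 D]
    simp only [lie_sum, lie_smul, lie_mul', kPart_lie_U, kPart_lie_DU, Finset.sum_mul,
      Finset.mul_sum, smul_mul_assoc, mul_smul_comm, mul_neg, smul_add, smul_neg,
      Finset.sum_add_distrib, Finset.sum_neg_distrib]
    abel
  rw [h]
  simp only [kPart, Finset.sum_sub_distrib, sub_smul, Finset.sum_smul, Finset.smul_sum, smul_smul]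
  congr 1
  · rw [Finset.sum_comm' (t' := Finset.univ) (s' := fun _ => Finset.univ) (by simp)]
    conv_lhs => enter [2, q]; rw [Finset.sum_comm]
    rw [Finset.sum_comm]
    refine Finset.sum_congr rfl fun p _ => Finset.sum_congr rfl fun q _ =>
      Finset.sum_congr rfl fun s _ => ?_
    rw [mul_comm]
  · refine Finset.sum_congr rfl fun p _ => ?_
    rw [Finset.sum_comm]

theorem vPart_lie_uPart (d : ℂ) (a b : Inn n → ℂ) :
    ⁅vPart d b, uPart a⁆ = kPart (fun p q => b (opp p) * a (opp q) - a p * b q) -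
      (∑ p, b p * a p) • Iop n d := by
  simp only [vPart, uPart, lie_sum, sum_lie, lie_smul, smul_lie, V_lie_U, opp_opp, smul_sub,
    Finset.sum_sub_distrib, smul_ite, smul_zero, Finset.sum_ite_eq', Finset.sum_ite_eq,
    Finset.mem_univ, if_true, kPart, sub_smul, Finset.sum_smul, smul_smul]
  congr 1
  · congr 1
    · rw [Finset.sum_comm]
      conv_lhs => rw [← sum_opp_index]; enter [2, p]; rw [← sum_opp_index]
      simp only [opp_opp, mul_comm, Finset.smul_sum, smul_smul]
      try rw [Finset.sum_comm]
    · simp only [Finset.smul_sum, smul_smul]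
  · simp only [mul_comm]

theorem so_add (Y Z : so n) (p q : Out n) : (Y + Z).1 p q = Y.1 p q + Z.1 p q := rfl

theorem so_smul (c : ℂ) (Y : so n) (p q : Out n) : (c • Y).1 p q = c * Y.1 p q := rfl

/-- The realisation `ψ̃_d` of `so(n+2, ℂ)` by differential operators in `n` variables:
`E_{11} ↦ -(E_1 + d)`, `E_{p1} ↦ U_p`, `E_{1p} ↦ V_{-p}` and
`E_{pq} ↦ U_p ∂_{U_q} - U_{-q} ∂_{U_{-p}}` for `p, q ∈ {0, ±2, …, ±ℓ}`. -/
def psiLin (d : ℂ) : so n →ₗ[ℂ] Weyl n where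
  toFun Y := -(Y.1 idx1 idx1 • Iop n d) + uPart (fun p => Y.1 (inc p) idx1) +
    vPart d (fun p => Y.1 idx1 (inc p)) + kPart (fun p q => Y.1 (inc p) (inc q))
  map_add' Y Z := by
    simp only [uPart, vPart, kPart, so_add, add_smul,
      Finset.sum_add_distrib]
    abel
  map_smul' c Y := by
    simp only [uPart, vPart, kPart, so_smul,
      RingHom.id_apply, smul_add, Finset.smul_sum, smul_smul, smul_neg]

theorem psiLin_apply (d : ℂ) (Y : so n) :
    psiLin d Y = -(Y.1 idx1 idx1 • Iop n d) + uPart (fun p => Y.1 (inc p) idx1) +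
    vPart d (fun p => Y.1 idx1 (inc p)) + kPart (fun p q => Y.1 (inc p) (inc q)) := rfl

theorem kPart_sub (C D : Inn n → Inn n → ℂ) :
    kPart C - kPart D = kPart (fun p q => C p q - D p q) := by
  simp only [kPart, sub_smul, Finset.sum_sub_distrib]

theorem kPart_add (C D : Inn n → Inn n → ℂ) :
    kPart C + kPart D = kPart (fun p q => C p q + D p q) := by
  simp only [kPart, add_smul, Finset.sum_add_distrib]

theorem uPart_add (C D : Inn n → ℂ) : uPart C + uPart D = uPart (fun p => C p + D p) := by
  simp only [uPart, add_smul, Finset.sum_add_distrib]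

theorem uPart_sub (C D : Inn n → ℂ) : uPart C - uPart D = uPart (fun p => C p - D p) := by
  simp only [uPart, sub_smul, Finset.sum_sub_distrib]

theorem uPart_smul (c : ℂ) (C : Inn n → ℂ) : c • uPart C = uPart (fun p => c * C p) := by
  simp only [uPart, Finset.smul_sum, smul_smul]

theorem vPart_add (d : ℂ) (C D : Inn n → ℂ) :
    vPart d C + vPart d D = vPart d (fun p => C p + D p) := by
  simp only [vPart, add_smul, Finset.sum_add_distrib]

theorem vPart_sub (d : ℂ) (C D : Inn n → ℂ) :
    vPart d C - vPart d D = vPart d (fun p => C p - D p) := by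
  simp only [vPart, sub_smul, Finset.sum_sub_distrib]

theorem vPart_smul (d : ℂ) (c : ℂ) (C : Inn n → ℂ) :
    c • vPart d C = vPart d (fun p => c * C p) := by
  simp only [vPart, Finset.smul_sum, smul_smul]

theorem psiLin_lie (d : ℂ) (Y Z : so n) : psiLin d ⁅Y, Z⁆ = ⁅psiLin d Y, psiLin d Z⁆ := by
  have sY : ∀ p q : Inn n, Y.1 (inc (opp q)) (inc (opp p)) = -Y.1 (inc p) (inc q) := by
    intro p q; rw [← opp_inc, ← opp_inc]; exact skew Y _ _
  have sZ : ∀ p q : Inn n, Z.1 (inc (opp q)) (inc (opp p)) = -Z.1 (inc p) (inc q) := by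
    intro p q; rw [← opp_inc, ← opp_inc]; exact skew Z _ _
  have z1 : ∀ X : so n, X.1 (opp idx1) idx1 = 0 := by
    intro X
    have := skew X (opp idx1) idx1
    rw [opp_opp] at this
    linear_combination this / 2
  have z2 : ∀ X : so n, X.1 idx1 (opp idx1) = 0 := by
    intro X
    have := skew X idx1 (opp idx1)
    rw [opp_opp] at this
    linear_combination this / 2
  have r1 : ∀ (X : so n) (p : Inn n), X.1 (inc p) (opp idx1) = -X.1 idx1 (inc (opp p)) := by
    intro X p
    have := skew X idx1 (inc (opp p))
    rw [opp_inc, opp_opp] at this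
    exact this
  have r2 : ∀ (X : so n) (p : Inn n), X.1 (opp idx1) (inc p) = -X.1 (inc (opp p)) idx1 := by
    intro X p
    have := skew X (inc (opp p)) idx1
    rw [opp_inc, opp_opp] at this
    exact this
  have hW : ∀ p q, (⁅Y, Z⁆ : so n).1 p q = ∑ s, (Y.1 p s * Z.1 s q - Z.1 p s * Y.1 s q) := by
    intro p q
    rw [LieSubalgebra.coe_bracket, Ring.lie_def, Matrix.sub_apply, Matrix.mul_apply,
      Matrix.mul_apply, Finset.sum_sub_distrib]
  have k0 : ∀ (u : Inn n → ℂ) (D : Inn n → Inn n → ℂ), ⁅uPart u, kPart D⁆ =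
      -⁅kPart D, uPart u⁆ := fun u D => (lie_skew _ _).symm
  have k1 : ∀ (u : Inn n → ℂ) (D : Inn n → Inn n → ℂ), ⁅vPart d u, kPart D⁆ =
      -⁅kPart D, vPart d u⁆ := fun u D => (lie_skew _ _).symm
  have k2 : ∀ (u v : Inn n → ℂ), ⁅uPart u, vPart d v⁆ =
      -⁅vPart d v, uPart u⁆ := fun u D => (lie_skew _ _).symm
  have k3 : ∀ (u : Inn n → ℂ), ⁅uPart u, Iop n d⁆ = -⁅Iop n d, uPart u⁆ :=
    fun u => (lie_skew _ _).symm
  have k4 : ∀ (u : Inn n → ℂ), ⁅vPart d u, Iop n d⁆ = -⁅Iop n d, vPart d u⁆ :=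
    fun u => (lie_skew _ _).symm
  simp only [psiLin_apply, add_lie, lie_add, neg_lie, lie_neg, smul_lie, lie_smul, k0, k1, k2, k3,
    k4, kPart_lie_Iop, lie_self, Iop_lie_uPart, Iop_lie_vPart, Iop_lie_kPart, uPart_lie_uPart,
    vPart_lie_vPart, kPart_lie_kPart, kPart_lie_uPart, vPart_lie_uPart, kPart_lie_vPart d (fun p q => Y.1 (inc p) (inc q)) sY,
    kPart_lie_vPart d (fun p q => Z.1 (inc p) (inc q)) sZ, hW, sum_Idx, z1, z2, r1, r2]
  have eu : uPart (fun p => Y.1 (inc p) idx1 * Z.1 idx1 idx1 - Z.1 (inc p) idx1 * Y.1 idx1 idx1 +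
      (-Y.1 idx1 (inc (opp p)) * 0 - -Z.1 idx1 (inc (opp p)) * 0) +
      ∑ q, (Y.1 (inc p) (inc q) * Z.1 (inc q) idx1 - Z.1 (inc p) (inc q) * Y.1 (inc q) idx1)) =
      Z.1 idx1 idx1 • uPart (fun p => Y.1 (inc p) idx1) -
      Y.1 idx1 idx1 • uPart (fun p => Z.1 (inc p) idx1) +
      (uPart (fun p => ∑ q, Y.1 (inc p) (inc q) * Z.1 (inc q) idx1) -
       uPart (fun p => ∑ q, Z.1 (inc p) (inc q) * Y.1 (inc q) idx1)) := by
    simp only [uPart_add, uPart_sub, uPart_smul, Finset.sum_sub_distrib]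
    congr 1; funext p; ring
  have ev : vPart d (fun p => Y.1 idx1 idx1 * Z.1 idx1 (inc p) - Z.1 idx1 idx1 * Y.1 idx1 (inc p) +
      (0 * -Z.1 (inc (opp p)) idx1 - 0 * -Y.1 (inc (opp p)) idx1) +
      ∑ q, (Y.1 idx1 (inc q) * Z.1 (inc q) (inc p) - Z.1 idx1 (inc q) * Y.1 (inc q) (inc p))) =
      Y.1 idx1 idx1 • vPart d (fun p => Z.1 idx1 (inc p)) -
      Z.1 idx1 idx1 • vPart d (fun p => Y.1 idx1 (inc p)) +
      (vPart d (fun p => ∑ q, Y.1 idx1 (inc q) * Z.1 (inc q) (inc p)) -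
       vPart d (fun p => ∑ q, Z.1 idx1 (inc q) * Y.1 (inc q) (inc p))) := by
    simp only [vPart_add, vPart_sub, vPart_smul, Finset.sum_sub_distrib]
    congr 1; funext p; ring
  have ek : kPart (fun p q => Y.1 (inc p) idx1 * Z.1 idx1 (inc q) - Z.1 (inc p) idx1 * Y.1 idx1 (inc q) +
      (-Y.1 idx1 (inc (opp p)) * -Z.1 (inc (opp q)) idx1 -
        -Z.1 idx1 (inc (opp p)) * -Y.1 (inc (opp q)) idx1) +
      ∑ s, (Y.1 (inc p) (inc s) * Z.1 (inc s) (inc q) -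
        Z.1 (inc p) (inc s) * Y.1 (inc s) (inc q))) =
      kPart (fun p q => Y.1 idx1 (inc (opp p)) * Z.1 (inc (opp q)) idx1 -
        Z.1 (inc p) idx1 * Y.1 idx1 (inc q)) -
      kPart (fun p q => Z.1 idx1 (inc (opp p)) * Y.1 (inc (opp q)) idx1 -
        Y.1 (inc p) idx1 * Z.1 idx1 (inc q)) +
      kPart (fun p q => ∑ s, (Y.1 (inc p) (inc s) * Z.1 (inc s) (inc q) -
        Z.1 (inc p) (inc s) * Y.1 (inc s) (inc q))) := by
    simp only [kPart_add, kPart_sub]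
    congr 1; funext p q; ring
  rw [eu, ev, ek]
  simp only [Finset.sum_sub_distrib]
  module

/-- The Lie algebra homomorphism `ψ̃_d : so(n+2, ℂ) → A_n(ℂ)`. -/
def psi (d : ℂ) : so n →ₗ⁅ℂ⁆ Weyl n :=
  { psiLin d with map_lie' := fun {Y Z} => psiLin_lie d Y Z }

end representation

section stability
variable {n : ℕ}

theorem dx_lie_quad (i : Fin n) : ⁅dx i, quad n⁆ = (2 : ℂ) • x i := by
  simp only [quad, lie_sum, lie_mul', dx_lie_x, mul_ite, ite_mul, mul_one, mul_zero, one_mul,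
    zero_mul, Finset.sum_add_distrib, Finset.sum_ite_eq, Finset.mem_univ, if_true]
  module

theorem eul_lie_quad : ⁅eul n, quad n⁆ = (2 : ℂ) • quad n := by
  simp only [quad, lie_sum, lie_mul', eul_lie_x, Finset.smul_sum]
  exact Finset.sum_congr rfl fun i _ => by module

theorem lap_lie_quad : ⁅lap n, quad n⁆ = (2 : ℂ) • eul n + algebraMap ℂ (Weyl n) n := by
  simp only [quad, lie_sum, lie_mul', lap_lie_x, dx_mul_x, if_true, eul, Finset.smul_sum]
  have h : algebraMap ℂ (Weyl n) n = ∑ _i : Fin n, 1 := by simp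
  rw [h, ← Finset.sum_add_distrib]
  exact Finset.sum_congr rfl fun i _ => by module

theorem U_lie_quad (p : Inn n) : ⁅U p, quad n⁆ = 0 := by
  have h : ∀ i : Fin n, ⁅x i, quad n⁆ = 0 := by
    intro i; simp [quad, lie_sum, lie_mul', x_lie_x]
  rcases p with j | j | j <;> simp [U, h]

theorem DU_lie_quad (p : Inn n) : ⁅DU p, quad n⁆ = U (opp p) := by
  rcases p with j | j | j <;>
    simp only [DU, U, opp, smul_lie, add_lie, sub_lie, dx_lie_quad, smul_smul]
  · module
  · module
  · congr 1; field_simp [sqrt2_ne]; rw [pow_two, sqrt2_mul]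

theorem Iop_lie_quad (d : ℂ) : ⁅Iop n d, quad n⁆ = (2 : ℂ) • quad n := by
  rw [Iop, add_lie, algebraMap_lie, eul_lie_quad, add_zero]

theorem V_lie_quad (d : ℂ) (p : Inn n) :
    ⁅V d p, quad n⁆ = (n / 2 - d - 1) • U p - (2 : ℂ) • (quad n * DU (opp p)) := by
  have e : Iop n d * U p = U p * eul n + d • U p + U p := by
    have h := Iop_lie_U d p
    rw [Ring.lie_def, sub_eq_iff_eq_add] at h
    rw [h, Iop, mul_add, ← Algebra.commutes, ← Algebra.smul_def]; abel
  simp only [V, sub_lie, smul_lie, mul_lie', lap_lie_quad, U_lie_quad, DU_lie_quad, Iop_lie_quad,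
    opp_opp, zero_mul, add_zero, e, mul_add, mul_smul_comm, smul_mul_assoc]
  rw [← Algebra.commutes, ← Algebra.smul_def]
  module

theorem kPart_lie_quad (C : Inn n → Inn n → ℂ) (hC : ∀ p q, C (opp q) (opp p) = -C p q) :
    ⁅kPart C, quad n⁆ = 0 := by
  have key : ⁅kPart C, quad n⁆ = ∑ p, ∑ q, C p q • (U p * U (opp q)) := by
    simp only [kPart, sum_lie, smul_lie, mul_lie', U_lie_quad, DU_lie_quad, zero_mul, add_zero]
  have h : ∑ p, ∑ q, C p q • (U p * U (opp q)) = -∑ p, ∑ q, C p q • (U p * U (opp q)) := by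
    conv_lhs => rw [← sum_opp_index]; enter [2, p]; rw [← sum_opp_index]
    rw [Finset.sum_comm, ← Finset.sum_neg_distrib]
    refine Finset.sum_congr rfl fun p _ => ?_
    rw [← Finset.sum_neg_distrib]
    refine Finset.sum_congr rfl fun q _ => ?_
    have e3 : U (opp q) * U p = U p * U (opp q) := by
      have := U_lie_U (opp q) p; rwa [Ring.lie_def, sub_eq_zero] at this
    rw [hC, opp_opp, e3, neg_smul]
  have h2 := add_eq_zero_iff_eq_neg.2 h
  rw [← two_smul ℂ] at h2
  rw [key, (smul_eq_zero.1 h2).resolve_left two_ne_zero]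

/-- `d(r) = n/2 - r`. -/
def dr (n r : ℕ) : ℂ := (n : ℂ) / 2 - r

theorem V_mul_quad_pow (d : ℂ) (p : Inn n) (k : ℕ) :
    V d p * quad n ^ (k + 1) =
      quad n ^ (k + 1) * (V d p - (2 * (k + 1) : ℂ) • DU (opp p)) +
        (((k + 1 : ℕ) : ℂ) * (n / 2 - d - ((k + 1 : ℕ) : ℂ))) • (quad n ^ k * U p) := by
  have hV : V d p * quad n = quad n * V d p + ((n / 2 - d - 1) • U p -
      (2 : ℂ) • (quad n * DU (opp p))) := by
    have h := V_lie_quad d p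
    rw [Ring.lie_def, sub_eq_iff_eq_add] at h
    rw [h]; abel
  have hD : DU (opp p) * quad n = quad n * DU (opp p) + U p := by
    have h := DU_lie_quad (opp p)
    rw [Ring.lie_def, sub_eq_iff_eq_add, opp_opp] at h
    rw [h]; abel
  have hU : U p * quad n = quad n * U p := by
    have h := U_lie_quad p
    rwa [Ring.lie_def, sub_eq_zero] at h
  induction k with
  | zero =>
    simp only [zero_add, pow_one, pow_zero, one_mul, hV, mul_sub, mul_smul_comm]
    push_cast
    module
  | succ k ih =>
    rw [pow_succ, ← mul_assoc, ih, add_mul, mul_assoc, sub_mul, hV, smul_mul_assoc, hD,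
      smul_mul_assoc, mul_assoc, hU, ← mul_assoc, ← pow_succ]
    simp only [mul_sub, mul_add, smul_add, smul_sub, mul_smul_comm, ← mul_assoc, ← pow_succ]
    push_cast
    module

/-- The operators of `ψ̃_d(so(n+2, ℂ))`, `d = n/2 - r`, lie in the idealiser of `F^r A_n`. -/
theorem psi_mul_quad_pow (r : ℕ) (Y : so n) :
    ∃ Q : Weyl n, psi (dr n r) Y * quad n ^ r = quad n ^ r * Q := by
  let S : Submodule ℂ (Weyl n) :=
    { carrier := {P | ∃ Q : Weyl n, P * quad n ^ r = quad n ^ r * Q}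
      zero_mem' := ⟨0, by simp⟩
      add_mem' := by
        rintro a b ⟨Q, h⟩ ⟨Q', h'⟩; exact ⟨Q + Q', by rw [add_mul, h, h', mul_add]⟩
      smul_mem' := by
        rintro c a ⟨Q, h⟩; exact ⟨c • Q, by rw [smul_mul_assoc, h, mul_smul_comm]⟩ }
  have hcomm : ∀ P : Weyl n, ⁅P, quad n⁆ = 0 → P ∈ S := by
    intro P h
    rw [Ring.lie_def, sub_eq_zero] at h
    exact ⟨P, ((show Commute P (quad n) from h).pow_right r).eq⟩
  have hI : Iop n (dr n r) ∈ S := by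
    have h := Iop_lie_quad (n := n) (dr n r)
    rw [Ring.lie_def, sub_eq_iff_eq_add] at h
    have : ∀ k : ℕ, Iop n (dr n r) * quad n ^ k =
        quad n ^ k * (Iop n (dr n r) + (2 * k : ℂ) • 1) := by
      intro k
      induction k with
      | zero => simp
      | succ k ih =>
        rw [pow_succ, ← mul_assoc, ih, mul_assoc, add_mul, h]
        simp only [mul_add, smul_mul_assoc, one_mul, mul_smul_comm, mul_one, ← mul_assoc, ← pow_succ]
        push_cast
        module
    exact ⟨_, this r⟩
  have hV : ∀ p : Inn n, V (dr n r) p ∈ S := by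
    intro p
    cases r with
    | zero => exact ⟨V (dr n 0) p, by simp⟩
    | succ k =>
      refine ⟨V (dr n (k + 1)) p - (2 * (k + 1) : ℂ) • DU (opp p),
        (V_mul_quad_pow (dr n (k + 1)) p k).trans ?_⟩
      have : (n : ℂ) / 2 - dr n (k + 1) - ((k + 1 : ℕ) : ℂ) = 0 := by simp [dr]
      rw [this, mul_zero, zero_smul, add_zero]
  have hk : kPart (fun p q => Y.1 (inc p) (inc q)) ∈ S := by
    apply hcomm
    apply kPart_lie_quad
    intro p q; rw [← opp_inc, ← opp_inc]; exact skew Y _ _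
  change psiLin (dr n r) Y ∈ S
  rw [psiLin_apply]
  refine S.add_mem (S.add_mem (S.add_mem (S.neg_mem (S.smul_mem _ hI)) ?_) ?_) hk
  · exact S.sum_mem fun p _ => S.smul_mem _ (hcomm _ (U_lie_quad p))
  · exact S.sum_mem fun p _ => S.smul_mem _ (hV _)

theorem fourier_quad : fourier (quad n) = (1 / 2 : ℂ) • lap n := by
  simp only [quad, lap, map_sum, fourier_mul, fourier_x, Finset.smul_sum, smul_mul_smul_comm,
    smul_smul]
  refine Finset.sum_congr rfl fun i _ => ?_
  congr 1
  linear_combination (1 / 4 : ℂ) * sgn_mul_sgn i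

theorem fourier_one : fourier (1 : Weyl n) = 1 := by simp [fourier]

theorem fourier_pow (a : Weyl n) (k : ℕ) : fourier (a ^ k) = fourier a ^ k := by
  induction k with
  | zero => simp [fourier_one]
  | succ k ih => rw [pow_succ, fourier_mul, ih, pow_succ']

theorem sgn_posA (j : Fin (n / 2)) : sgn (posA j) = 1 := by
  unfold sgn; exact if_neg (by simp only [posA]; omega)

theorem sgn_posB (j : Fin (n / 2)) : sgn (posB j) = -1 := by
  unfold sgn; exact if_pos (by simp only [posB]; omega)

theorem sgn_posC (j : Fin (n % 2)) : sgn (posC j) = 1 := by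
  have := j.2
  unfold sgn; exact if_neg (by simp only [posC]; omega)

theorem fourier_U (p : Inn n) : fourier (U p) = DU p := by
  rcases p with j | j | j <;>
    simp only [U, DU, map_sub, map_add, map_smul, fourier_x, sgn_posA, sgn_posB, sgn_posC]
  · module
  · module
  · rw [smul_smul]; congr 1; field_simp [sqrt2_ne]; rw [pow_two, sqrt2_mul]

theorem fourier_DU (p : Inn n) : fourier (DU p) = U p := by
  have hI : Complex.I * Complex.I = -1 := Complex.I_mul_I
  rcases p with j | j | j <;>
    simp only [U, DU, map_sub, map_add, map_smul, fourier_dx, sgn_posA, sgn_posB, sgn_posC]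
  · module
  · module
  · rw [smul_smul]; congr 1; field_simp [sqrt2_ne]; rw [pow_two, sqrt2_mul]

/-- The homomorphism `τ = F ∘ ψ̃_d ∘ ϑ : so(n+2, ℂ) → A_n(ℂ)`, `d = n/2 - r`, where `F` is the
Fourier transform and `ϑ` the Chevalley anti-involution. -/
def tau (n r : ℕ) : so n →ₗ⁅ℂ⁆ Weyl n :=
  { fourier ∘ₗ psiLin (dr n r) ∘ₗ theta with
    map_lie' := by
      intro Y Z
      change fourier (psiLin (dr n r) (theta ⁅Y, Z⁆)) =
        ⁅fourier (psiLin (dr n r) (theta Y)), fourier (psiLin (dr n r) (theta Z))⁆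
      rw [theta_lie, psiLin_lie, Ring.lie_def, Ring.lie_def, map_sub, fourier_mul, fourier_mul] }

/-- `τ` takes values in the symmetries of `Δ_1^r`. -/
theorem lap_pow_mul_tau (r : ℕ) (Y : so n) :
    ∃ Q : Weyl n, lap n ^ r * tau n r Y = Q * lap n ^ r := by
  obtain ⟨Q, h⟩ := psi_mul_quad_pow r (theta Y)
  refine ⟨fourier Q, ?_⟩
  have h' := congrArg fourier h
  rw [fourier_mul, fourier_mul, fourier_pow, fourier_quad, smul_pow, smul_mul_assoc,
    mul_smul_comm] at h'
  have h0 : (1 / 2 : ℂ) ^ r ≠ 0 := pow_ne_zero r (one_div_ne_zero two_ne_zero)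
  exact smul_right_injective (Weyl n) h0 h'

end stability

/-! ### The modules `R_r` and `M_r` -/

/-- The Laplacian `Δ_1 = ½ ∑ ∂²/∂X_i²` on polynomials. -/
def laplacian (n : ℕ) : Module.End ℂ (MvPolynomial (Fin n) ℂ) :=
  (1 / 2 : ℂ) • ∑ i, (pderiv i).toLinearMap ∘ₗ (pderiv i).toLinearMap

/-- The polynomial `F = ∑ X_i²`. -/
def quadPoly (n : ℕ) : MvPolynomial (Fin n) ℂ := ∑ i, X i ^ 2

theorem ev_lap (n : ℕ) : ev (lap n) = laplacian n := by
  rw [lap, laplacian, map_smul, map_sum]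
  congr 1
  exact Finset.sum_congr rfl fun i _ => by rw [map_mul, ev, weylLift_dx]; rfl

theorem ev_quad (n : ℕ) (p : MvPolynomial (Fin n) ℂ) : ev (quad n) p = quadPoly n * p := by
  simp [quad, quadPoly, ev, map_sum, Finset.sum_mul, pow_two, mul_assoc]

theorem ev_quad_pow (n k : ℕ) (p : MvPolynomial (Fin n) ℂ) :
    ev (quad n ^ k) p = quadPoly n ^ k * p := by
  induction k generalizing p with
  | zero => simp
  | succ k ih => rw [pow_succ, map_mul, Module.End.mul_apply, ih, ev_quad, pow_succ, mul_assoc]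

/-- The polynomial ring `A = ℂ[X_1, …, X_n]` with the action of `so(n+2, ℂ)` through `ψ̃_d`,
`d = n/2 - r`. -/
def PolyR (n _r : ℕ) : Type := MvPolynomial (Fin n) ℂ

instance (n r : ℕ) : AddCommGroup (PolyR n r) := inferInstanceAs (AddCommGroup (MvPolynomial (Fin n) ℂ))
instance (n r : ℕ) : Module ℂ (PolyR n r) := inferInstanceAs (Module ℂ (MvPolynomial (Fin n) ℂ))
instance (n r : ℕ) : LieRingModule (so n) (PolyR n r) :=
  LieRingModule.compLieHom (MvPolynomial (Fin n) ℂ)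
    ((ev (n := n)).toLieHom.comp (psi (n := n) (dr n r)))
instance (n r : ℕ) : LieModule ℂ (so n) (PolyR n r) :=
  LieModule.compLieHom (MvPolynomial (Fin n) ℂ)
    ((ev (n := n)).toLieHom.comp (psi (n := n) (dr n r)))

theorem PolyR_lie (n r : ℕ) (Y : so n) (f : PolyR n r) : ⁅Y, f⁆ = ev (psi (dr n r) Y) f := rfl

/-- The polynomial ring `A = ℂ[X_1, …, X_n]` with the action of `so(n+2, ℂ)` through `τ`. -/
def PolyM (n _r : ℕ) : Type := MvPolynomial (Fin n) ℂ

instance (n r : ℕ) : AddCommGroup (PolyM n r) := inferInstanceAs (AddCommGroup (MvPolynomial (Fin n) ℂ))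
instance (n r : ℕ) : Module ℂ (PolyM n r) := inferInstanceAs (Module ℂ (MvPolynomial (Fin n) ℂ))
instance (n r : ℕ) : LieRingModule (so n) (PolyM n r) :=
  LieRingModule.compLieHom (MvPolynomial (Fin n) ℂ) ((ev (n := n)).toLieHom.comp (tau n r))
instance (n r : ℕ) : LieModule ℂ (so n) (PolyM n r) :=
  LieModule.compLieHom (MvPolynomial (Fin n) ℂ) ((ev (n := n)).toLieHom.comp (tau n r))

theorem PolyM_lie (n r : ℕ) (Y : so n) (f : PolyM n r) : ⁅Y, f⁆ = ev (tau n r Y) f := rfl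

theorem ev_psi_mem (n r : ℕ) (Y : so n) (f : MvPolynomial (Fin n) ℂ)
    (hf : f ∈ Ideal.span {quadPoly n ^ r}) :
    ev (psi (dr n r) Y) f ∈ Ideal.span {quadPoly n ^ r} := by
  obtain ⟨g, rfl⟩ := Ideal.mem_span_singleton'.1 hf
  obtain ⟨Q, hQ⟩ := psi_mul_quad_pow r Y
  refine Ideal.mem_span_singleton'.2 ⟨ev Q g, ?_⟩
  rw [mul_comm g, ← ev_quad_pow, ← Module.End.mul_apply, ← map_mul, hQ, map_mul,
    Module.End.mul_apply, ev_quad_pow, mul_comm]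

theorem ev_tau_mem (n r : ℕ) (Y : so n) (f : MvPolynomial (Fin n) ℂ)
    (hf : (laplacian n ^ r) f = 0) : (laplacian n ^ r) (ev (tau n r Y) f) = 0 := by
  obtain ⟨Q, hQ⟩ := lap_pow_mul_tau r Y
  rw [← ev_lap, ← map_pow] at hf ⊢
  rw [← Module.End.mul_apply, ← map_mul, hQ, map_mul, Module.End.mul_apply, hf, map_zero]

/-- The ideal `F^r A`, as a submodule for the action through `ψ̃_d`. -/
def idealF (n r : ℕ) : LieSubmodule ℂ (so n) (PolyR n r) where
  toSubmodule := ((Ideal.span {quadPoly n ^ r}).restrictScalars ℂ :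
    Submodule ℂ (MvPolynomial (Fin n) ℂ))
  lie_mem {Y f} hf := ev_psi_mem n r Y f hf

/-- The `so(n+2, ℂ)`-module `N(λ) = R_r = A / F^r A`. -/
abbrev RMod (n r : ℕ) : Type := PolyR n r ⧸ idealF n r

/-- The `so(n+2, ℂ)`-module `M_r = {f ∈ A : Δ_1^r f = 0}` of harmonics of level `r`. -/
def MMod (n r : ℕ) : LieSubmodule ℂ (so n) (PolyM n r) where
  toSubmodule := LinearMap.ker (laplacian n ^ r)
  lie_mem {Y f} hf := ev_tau_mem n r Y f hf

/-! ### Weights, duals and simple highest weight modules -/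

section roots
variable {n : ℕ}

theorem eps_apply (p : Out n) (H : cartan n) : eps p H = H.1.1 p p := rfl

theorem cartan_lie_E (H : cartan n) (p q : Out n) :
    ⁅(H : so n), E p q⁆ = (eps p - eps q) H • E p q := by
  have hl : ∀ (Z : so n) (a b : Out n), (H.1.1 * Z.1) a b = H.1.1 a a * Z.1 a b := by
    intro Z a b
    rw [Matrix.mul_apply, Finset.sum_eq_single a (fun c _ hc => by rw [H.2 a c (Ne.symm hc), zero_mul])
      (by simp)]
  have hr : ∀ (Z : so n) (a b : Out n), (Z.1 * H.1.1) a b = Z.1 a b * H.1.1 b b := by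
    intro Z a b
    rw [Matrix.mul_apply, Finset.sum_eq_single b (fun c _ hc => by rw [H.2 c b hc, mul_zero])
      (by simp)]
  have hn : ∀ p : Out n, H.1.1 (opp p) (opp p) = -H.1.1 p p := fun p => skew H.1 p p
  ext a b
  rw [so_smul, LieSubalgebra.coe_bracket, Ring.lie_def, Matrix.sub_apply, hl, hr]
  simp only [E, eps_apply, Matrix.sub_apply, Matrix.single_apply, LinearMap.sub_apply]
  by_cases h1 : p = a ∧ q = b
  · obtain ⟨rfl, rfl⟩ := h1
    by_cases h2 : opp q = p ∧ opp p = q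
    · obtain ⟨h3, h4⟩ := h2; simp [h3, h4]
    · simp [h2]
  · by_cases h2 : opp q = a ∧ opp p = b
    · obtain ⟨rfl, rfl⟩ := h2; simp [h1, hn]
    · simp [h1, h2]

theorem eq_sum_E (Y : so n) : Y = (1 / 2 : ℂ) • ∑ p, ∑ q, Y.1 p q • E p q := by
  have hc : ∀ s : Finset (Out n), ∀ f : Out n → so n, ∀ a b, (∑ p ∈ s, f p).1 a b =
      ∑ p ∈ s, (f p).1 a b := by
    intro s f a b
    induction s using Finset.cons_induction with
    | empty => rfl
    | cons p s hp ih => rw [Finset.sum_cons, Finset.sum_cons, so_add, ih]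
  ext a b
  rw [so_smul, hc]
  simp only [hc, so_smul, E, Matrix.sub_apply, Matrix.single_apply, mul_sub, mul_ite, mul_one,
    mul_zero, Finset.sum_sub_distrib, ite_and, opp_eq_iff, Finset.sum_ite_eq, Finset.sum_ite_eq',
    Finset.mem_univ, if_true, Finset.sum_const_zero, Finset.sum_ite_irrel]
  rw [skew]; ring

end roots

section category
variable (n : ℕ) (W : Type*) [AddCommGroup W] [Module ℂ W] [LieRingModule (so n) W]
  [LieModule ℂ (so n) W]

/-- The weight space `W^ν`. -/
def wt (ν : Weight n) : Submodule ℂ W where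
  carrier := {w | ∀ H : cartan n, ⁅(H : so n), w⁆ = ν H • w}
  zero_mem' := by intro H; simp
  add_mem' := by intro a b ha hb H; rw [lie_add, ha, hb, smul_add]
  smul_mem' := by intro c a ha H; rw [lie_smul, ha, smul_comm]

theorem E_lie_mem_wt (p q : Out n) (ν : Weight n) {w : W} (hw : w ∈ wt n W ν) :
    ⁅E p q, w⁆ ∈ wt n W (ν + (eps p - eps q)) := by
  intro H
  rw [leibniz_lie, cartan_lie_E, hw H, smul_lie, lie_smul, ← add_smul, LinearMap.add_apply,
    add_comm]

/-- The sum of the weight spaces of `W`. -/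
def weightPart : LieSubmodule ℂ (so n) W where
  toSubmodule := ⨆ ν : Weight n, wt n W ν
  lie_mem := by
    intro Y w hw
    change ⁅Y, w⁆ ∈ ⨆ ν : Weight n, wt n W ν
    have hw' : w ∈ ⨆ ν : Weight n, wt n W ν := hw
    induction hw' using Submodule.iSup_induction' with
    | mem ν w h =>
      rw [eq_sum_E Y]
      simp only [smul_lie, sum_lie]
      exact Submodule.smul_mem _ _ (Submodule.sum_mem _ fun p _ => Submodule.sum_mem _ fun q _ =>
        Submodule.smul_mem _ _ (Submodule.mem_iSup_of_mem _ (E_lie_mem_wt n W p q ν h)))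
    | zero => rw [lie_zero]; exact Submodule.zero_mem _
    | add a b ha hb iha ihb => rw [lie_add]; exact Submodule.add_mem _ (iha ha) (ihb hb)

/-- The full dual `W^*` with the action `(Y f)(w) = f(ϑ(Y) w)`. -/
def TwDual (_n : ℕ) (W : Type*) [AddCommGroup W] [Module ℂ W] : Type _ := Module.Dual ℂ W

instance : AddCommGroup (TwDual n W) := inferInstanceAs (AddCommGroup (Module.Dual ℂ W))
instance : Module ℂ (TwDual n W) := inferInstanceAs (Module ℂ (Module.Dual ℂ W))
instance : LieRingModule (so n) (TwDual n W) where
  bracket Y f := (show Module.Dual ℂ W from f) ∘ₗ LieModule.toEnd ℂ (so n) W (theta Y)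
  add_lie Y Z f := by
    apply LinearMap.ext; intro w
    change f.toFun ⁅theta (Y + Z), w⁆ = f.toFun ⁅theta Y, w⁆ + f.toFun ⁅theta Z, w⁆
    rw [map_add, add_lie]; exact LinearMap.map_add f _ _
  lie_add Y f g := rfl
  leibniz_lie Y Z f := by
    apply LinearMap.ext; intro w
    change f.toFun ⁅theta Z, ⁅theta Y, w⁆⁆ =
      f.toFun ⁅theta ⁅Y, Z⁆, w⁆ + f.toFun ⁅theta Y, ⁅theta Z, w⁆⁆
    rw [theta_lie, leibniz_lie (theta Z) (theta Y) w]; exact LinearMap.map_add f _ _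
instance : LieModule ℂ (so n) (TwDual n W) where
  smul_lie c Y f := by
    apply LinearMap.ext; intro w
    change f.toFun ⁅theta (c • Y), w⁆ = c • f.toFun ⁅theta Y, w⁆
    rw [map_smul, smul_lie]; exact LinearMap.map_smul f _ _
  lie_smul c Y f := rfl

/-- The `𝒪`-dual `W^∨`: the sum of the weight spaces of `W^*`, for the action
`(Y f)(w) = f(ϑ(Y) w)`. -/
def ODual : LieSubmodule ℂ (so n) (TwDual n W) := weightPart n (TwDual n W)

/-- The socle: the sum of the simple submodules. -/
def socle : LieSubmodule ℂ (so n) W :=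
  sSup {S : LieSubmodule ℂ (so n) W | LieModule.IsIrreducible ℂ (so n) S}

/-- The objects of category `𝒪`. -/
structure IsCategoryO : Prop where
  /-- `W` is the sum of its weight spaces. -/
  weight : ⨆ ν : Weight n, wt n W ν = ⊤
  /-- `𝔫⁺` acts locally finitely. -/
  finite : ∀ w : W, ∃ S : Submodule ℂ W, w ∈ S ∧ FiniteDimensional ℂ S ∧
    ∀ Y : so n, IsPos Y → ∀ v ∈ S, ⁅Y, v⁆ ∈ S
  /-- `W` is a finitely generated module. -/
  fg : ∃ s : Finset W, LieSubmodule.lieSpan ℂ (so n) (s : Set W) = ⊤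

end category

section highest
variable {n : ℕ}

/-- The universal enveloping algebra of `so(n+2, ℂ)`. -/
abbrev UEA (n : ℕ) : Type := UniversalEnvelopingAlgebra ℂ (so n)

/-- The left ideal of `U(so(n+2, ℂ))` generated by `𝔫⁺` and the `H - ν(H)`. -/
def vermaIdeal (ν : Weight n) : Submodule (UEA n) (UEA n) :=
  Submodule.span (UEA n) ({z | ∃ Y : so n, IsPos Y ∧ z = UniversalEnvelopingAlgebra.ι ℂ Y} ∪
    {z | ∃ H : cartan n, z = UniversalEnvelopingAlgebra.ι ℂ (H : so n) - algebraMap ℂ (UEA n) (ν H)})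

/-- The Verma module with highest weight `ν`. -/
abbrev Verma (ν : Weight n) : Type := UEA n ⧸ vermaIdeal ν

/-- The simple quotient `L(ν)` of the Verma module: its quotient by the sum of all proper
submodules. -/
def LMod (ν : Weight n) : Type :=
  Verma ν ⧸ sSup {N : Submodule (UEA n) (Verma ν) | N ≠ ⊤}

instance (ν : Weight n) : AddCommGroup (LMod ν) :=
  inferInstanceAs (AddCommGroup (Verma ν ⧸ sSup {N : Submodule (UEA n) (Verma ν) | N ≠ ⊤}))
instance (ν : Weight n) : Module (UEA n) (LMod ν) :=
  inferInstanceAs (Module (UEA n) (Verma ν ⧸ sSup {N : Submodule (UEA n) (Verma ν) | N ≠ ⊤}))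
instance (ν : Weight n) : Module ℂ (LMod ν) :=
  inferInstanceAs (Module ℂ (Verma ν ⧸ sSup {N : Submodule (UEA n) (Verma ν) | N ≠ ⊤}))
instance (ν : Weight n) : IsScalarTower ℂ (UEA n) (LMod ν) :=
  inferInstanceAs
    (IsScalarTower ℂ (UEA n) (Verma ν ⧸ sSup {N : Submodule (UEA n) (Verma ν) | N ≠ ⊤}))
instance (ν : Weight n) : LieRingModule (so n) (LMod ν) where
  bracket Y v := UniversalEnvelopingAlgebra.ι ℂ Y • v
  add_lie Y Z v := by rw [map_add, add_smul]
  lie_add Y v w := smul_add _ _ _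
  leibniz_lie Y Z v := by
    rw [LieHom.map_lie, Ring.lie_def, sub_smul, mul_smul, mul_smul, sub_add_cancel]
instance (ν : Weight n) : LieModule ℂ (so n) (LMod ν) where
  smul_lie c Y v := by
    change UniversalEnvelopingAlgebra.ι ℂ (c • Y) • v = c • UniversalEnvelopingAlgebra.ι ℂ Y • v
    rw [map_smul, smul_assoc]
  lie_smul c Y v := by
    change UniversalEnvelopingAlgebra.ι ℂ Y • c • v = c • UniversalEnvelopingAlgebra.ι ℂ Y • v
    rw [← algebraMap_smul (UEA n) c v, ← algebraMap_smul (UEA n) c, ← mul_smul, ← mul_smul,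
      Algebra.commutes]

/-- The weight `λ = -d ϖ_1 = -d ε_1`, where `d = n/2 - r`. -/
def lam (n r : ℕ) : Weight n := -dr n r • eps idx1

/-- The weight `μ = λ + (d - 1) α_1`, where `α_1 = ε_1 - ε_2` and `d = n/2 - r`. -/
def mu {n : ℕ} (hn : 3 ≤ n) (r : ℕ) : Weight n := lam n r + (dr n r - 1) • (eps idx1 - eps (idx2 hn))

end highest

end HigherHarmonics

end

open HigherHarmonics

set_option linter.unusedSectionVars false

noncomputable section

namespace HigherHarmonics

open MvPolynomial

attribute [local instance 100] LieRing.ofAssociativeRing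

/-! ### Sums of weight vectors -/

/-! The proof transports everything to submodules of the polynomial ring by duality. The form ⟨f, g⟩
= (𝓕(f) g)(0) on A makes every differential operator adjoint to its Fourier transform
(`polyForm_ev`). Since τ = 𝓕 ∘ ψ̃_d ∘ ϑ, it is a contravariant pairing between A with the action
ψ̃_d and A with the action τ. Multiplication by F^r is adjoint to a multiple of Δ_1^r, so the
annihilator of F^r A is M_r (`perp_idealF`). The pairing therefore descends to R_r × M_r, gives M_r
≅ R_r^∨, and matches submodules of M_r with submodules of R_r in reversed order (`IsDualPair`).

It remains to find the submodules N of A that contain F^r A. They are graded. If N is larger than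
F^r A, take f in N outside F^r A of minimal degree m; every V_p lowers the degree by one, so V_p f
lies in F^r A. The two contractions Σ U_{-p} V_p f = F Δ_1 f - m (m - 1 + d) f and Σ ∂_{U_p} V_p f =
(r - m/2) Δ_1 f then force m (m - 1 + d) = 0 and F Δ_1 f ∈ F^r A (`quad_lap_mem_of_singular`). If m
= 0, then N = A. The other value m = 1 - d = r + 1 - n/2 is a positive integer only for even n with
r ≥ n/2, so in all other cases R_r is simple.

In the exceptional case 1 ≤ m ≤ r, and degree reasons make f harmonic. Harmonics of degree m are a
simple module for the rotations (`Harm_le_of_stable`), so N contains all of them, and with them the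
submodule `genHarm` that they generate. The contractions, applied once more modulo `genHarm`, show
that only A lies above it (`eq_zero_of_singular`). Thus R_r has exactly one proper nonzero
submodule, and dually so has M_r. The quotient of R_r by it is finite dimensional because `genHarm`
contains all polynomials of high degree.

The simple factors of M_r are identified by highest weight vectors: 1 lies in every nonzero
submodule and has weight λ, and U_2^m has weight μ and becomes singular in the quotient by the
socle. A simple module with a highest weight vector of weight ν is L(ν), because the kernel of the
map from the Verma module is its largest proper submodule (`le_ker_of_ne_top`). -/

/-- A subspace that is stable under a family of operators contains the components of its elements
in joint eigenspaces of these operators. -/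
theorem mem_of_sum_eigenvectors_mem {ι α V : Type*} [AddCommGroup V] [Module ℂ V]
    (T : α → V → V) (χ : ι → α → ℂ) (hχ : Function.Injective χ) (P : Submodule ℂ V)
    (hT : ∀ a, ∃ t : Module.End ℂ V, ∀ v, T a v = t v)
    (hP : ∀ a, ∀ v ∈ P, T a v ∈ P) (s : Finset ι) (v : ι → V)
    (hv : ∀ i ∈ s, ∀ a, T a (v i) = χ i a • v i) (h : ∑ i ∈ s, v i ∈ P) : ∀ i ∈ s, v i ∈ P := by
  classical
  induction s using Finset.induction_on generalizing v with
  | empty => simp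
  | insert j s hj ih =>
    have key : ∀ i ∈ s, v i ∈ P := by
      intro i hi
      have hij : χ i ≠ χ j := fun e => hj (hχ e ▸ hi)
      obtain ⟨a, ha⟩ := Function.ne_iff.1 hij
      -- `T a - χ j a` kills the component `v j` and rescales the others, `v i` by a nonzero factor;
      -- the induction hypothesis applies to the rescaled family.
      have h1 : T a (∑ i ∈ insert j s, v i) - χ j a • ∑ i ∈ insert j s, v i ∈ P :=
        P.sub_mem (hP a _ h) (P.smul_mem _ h)
      have h2 : T a (∑ i ∈ insert j s, v i) - χ j a • ∑ i ∈ insert j s, v i =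
          ∑ i ∈ s, (χ i a - χ j a) • v i := by
        obtain ⟨t, ht⟩ := hT a
        rw [ht, map_sum, Finset.smul_sum, ← Finset.sum_sub_distrib, Finset.sum_insert hj, ← ht,
          hv j (Finset.mem_insert_self _ _), sub_self, zero_add]
        refine Finset.sum_congr rfl fun k hk => ?_
        rw [← ht, hv k (Finset.mem_insert_of_mem hk), sub_smul]
      rw [h2] at h1
      have h3 := ih (fun i => (χ i a - χ j a) • v i) (by
        intro k hk b
        obtain ⟨t, ht⟩ := hT b
        rw [ht, map_smul, ← ht, hv k (Finset.mem_insert_of_mem hk), smul_comm]) h1 i hi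
      exact (P.smul_mem_iff (sub_ne_zero.2 ha)).1 h3
    intro i hi
    rcases Finset.mem_insert.1 hi with rfl | hi
    · rw [Finset.sum_insert hj] at h
      exact (P.add_mem_iff_left (P.sum_mem key)).1 h
    · exact key i hi

theorem exists_finset_sum_of_mem_iSup {ι V : Type*} [AddCommGroup V] [Module ℂ V]
    (p : ι → Submodule ℂ V) {v : V} (hv : v ∈ ⨆ i, p i) :
    ∃ (s : Finset ι) (f : ι → V), (∀ i, f i ∈ p i) ∧ ∑ i ∈ s, f i = v := by
  classical
  obtain ⟨f, rfl⟩ := (Submodule.mem_iSup_iff_exists_dfinsupp' p v).1 hv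
  exact ⟨f.support, fun i => f i, fun i => (f i).2, rfl⟩

section weights
variable {n : ℕ} {W : Type*} [AddCommGroup W] [Module ℂ W] [LieRingModule (so n) W]
  [LieModule ℂ (so n) W]

theorem mem_of_sum_weightVectors_mem (P : Submodule ℂ W)
    (hP : ∀ (H : cartan n), ∀ w ∈ P, ⁅(H : so n), w⁆ ∈ P) (s : Finset (Weight n))
    (w : Weight n → W) (hw : ∀ ν ∈ s, w ν ∈ wt n W ν) (h : ∑ ν ∈ s, w ν ∈ P) :
    ∀ ν ∈ s, w ν ∈ P :=
  mem_of_sum_eigenvectors_mem (fun (H : cartan n) (w : W) => ⁅(H : so n), w⁆)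
    (fun (ν : Weight n) H => ν H) DFunLike.coe_injective P
    (fun H => ⟨LieModule.toEnd ℂ (so n) W H, fun _ => rfl⟩) hP s w (fun ν hν H => hw ν hν H) h

theorem iSupIndep_wt : iSupIndep (wt n W) := by
  classical
  intro ν
  rw [disjoint_iff, Submodule.eq_bot_iff]
  rintro w ⟨hw, hw'⟩
  obtain ⟨s, f, hf, rfl⟩ := exists_finset_sum_of_mem_iSup _ hw'
  -- The inner supremum over `ν' ≠ ν` is the weight space if `ν' ≠ ν` and `⊥` otherwise; hence also
  -- `f ν = 0`.
  have hf' : ∀ ν', f ν' ∈ wt n W ν' := fun ν' =>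
    (iSup_le (fun _ => le_rfl) : (⨆ (_ : ν' ≠ ν), wt n W ν') ≤ wt n W ν') (hf ν')
  have h0 : f ν = 0 := by simpa using hf ν
  -- The common vector, negated and placed at the index `ν`, completes the `f ν'` to a family of
  -- weight vectors with sum zero.
  have h := mem_of_sum_weightVectors_mem (⊥ : Submodule ℂ W)
    (fun H w hw => by rw [(Submodule.mem_bot ℂ).1 hw, lie_zero]; exact Submodule.zero_mem _)
    (insert ν s) (fun ν' => if ν' = ν then -∑ ν' ∈ s, f ν' else f ν')
    (fun ν' _ => by
      by_cases e : ν' = ν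
      · simp only [e, if_true]; exact Submodule.neg_mem _ hw
      · simp only [e, if_false]; exact hf' ν')
    (by
      rw [← Finset.insert_erase (Finset.mem_insert_self ν s),
        Finset.sum_insert (Finset.notMem_erase _ _), if_pos rfl,
        Finset.sum_congr rfl (g := f) fun x hx => if_neg (Finset.ne_of_mem_erase hx),
        Submodule.mem_bot, neg_add_eq_zero]
      by_cases hs : ν ∈ s
      · rw [Finset.insert_eq_of_mem hs, ← Finset.add_sum_erase _ _ hs, h0, zero_add]
      · rw [Finset.erase_insert hs]) ν (Finset.mem_insert_self _ _)
  simpa using h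

/-- The projection to a weight space. -/
theorem exists_weightProj (hW : ⨆ ν : Weight n, wt n W ν = ⊤) (ν : Weight n) :
    ∃ π : W →ₗ[ℂ] W, (∀ w ∈ wt n W ν, π w = w) ∧ ∀ ν', ν' ≠ ν → ∀ w ∈ wt n W ν', π w = 0 := by
  have hc : IsCompl (wt n W ν) (⨆ (ν' : Weight n) (_ : ν' ≠ ν), wt n W ν') := by
    refine ⟨iSupIndep_wt ν, codisjoint_iff.2 (top_le_iff.1 (hW ▸ iSup_le fun ν' => ?_))⟩
    by_cases e : ν' = ν
    · exact e ▸ le_sup_left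
    · exact le_sup_of_le_right (le_iSup₂_of_le ν' e le_rfl)
  refine ⟨Submodule.projection _ _ hc, fun w hw => Submodule.projection_apply_left hc ⟨w, hw⟩, fun ν' e w hw => ?_⟩
  exact Submodule.projection_apply_of_mem_right hc
    ((le_iSup₂_of_le (f := fun (ν' : Weight n) (_ : ν' ≠ ν) => wt n W ν') ν' e le_rfl) hw)

theorem weight_induction (hW : ⨆ ν : Weight n, wt n W ν = ⊤) {p : W → Prop}
    (h0 : p 0) (hadd : ∀ a b, p a → p b → p (a + b)) (h : ∀ ν, ∀ w ∈ wt n W ν, p w) (w : W) :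
    p w :=
  Submodule.iSup_induction (wt n W) (motive := p) (hW ▸ Submodule.mem_top : w ∈ _) h h0 hadd

theorem mem_iSup_inf_wt (hW : ⨆ ν : Weight n, wt n W ν = ⊤) (N : LieSubmodule ℂ (so n) W) {w : W}
    (hw : w ∈ N) : w ∈ ⨆ ν : Weight n, N.toSubmodule ⊓ wt n W ν := by
  obtain ⟨s, f, hf, rfl⟩ := exists_finset_sum_of_mem_iSup (wt n W) (hW ▸ Submodule.mem_top : w ∈ _)
  exact Submodule.sum_mem _ fun ν hν => Submodule.mem_iSup_of_mem ν
    ⟨mem_of_sum_weightVectors_mem N.toSubmodule (fun H w hw => N.lie_mem hw) s f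
      (fun ν _ => hf ν) hw ν hν, hf ν⟩

theorem iSup_wt_coe_eq_top (hW : ⨆ ν : Weight n, wt n W ν = ⊤) (N : LieSubmodule ℂ (so n) W) :
    ⨆ ν : Weight n, wt n N ν = ⊤ := by
  rw [eq_top_iff]
  rintro ⟨w, hw⟩ -
  obtain ⟨s, f, hf, e⟩ := exists_finset_sum_of_mem_iSup _ (mem_iSup_inf_wt hW N hw)
  have : (⟨w, hw⟩ : N) = ∑ ν ∈ s, ⟨f ν, (hf ν).1⟩ := by
    apply Subtype.ext
    refine e.symm.trans ?_
    exact (map_sum N.toSubmodule.subtype (fun ν => (⟨f ν, (hf ν).1⟩ : N)) s).symm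
  rw [this]
  exact Submodule.sum_mem _ fun ν _ => Submodule.mem_iSup_of_mem ν
    fun H => Subtype.ext ((hf ν).2 H)

theorem iSup_wt_quotient_eq_top (hW : ⨆ ν : Weight n, wt n W ν = ⊤)
    (N : LieSubmodule ℂ (so n) W) : ⨆ ν : Weight n, wt n (W ⧸ N) ν = ⊤ := by
  rw [eq_top_iff]
  intro w _
  obtain ⟨w, rfl⟩ := LieSubmodule.Quotient.surjective_mk' N w
  refine weight_induction hW (p := fun w => LieSubmodule.Quotient.mk' N w ∈ _) ?_ ?_ ?_ w
  · simp
  · intro a b ha hb; rw [map_add]; exact Submodule.add_mem _ ha hb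
  · intro ν w hw
    refine Submodule.mem_iSup_of_mem ν fun H => ?_
    rw [← LieModuleHom.map_lie, hw H, map_smul]

/-- A linear form on `W` that is an eigenvector of weight `ν` for the twisted action of the Cartan
subalgebra. -/
def IsWeightForm (ν : Weight n) (φ : W →ₗ[ℂ] ℂ) : Prop :=
  ∀ (H : cartan n) (w : W), φ ⁅(H : so n), w⁆ = ν H * φ w

theorem IsWeightForm.eq_zero {ν ν' : Weight n} {φ : W →ₗ[ℂ] ℂ} (hφ : IsWeightForm ν φ)
    (h : ν' ≠ ν) {w : W} (hw : w ∈ wt n W ν') : φ w = 0 := by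
  obtain ⟨H, hH⟩ := DFunLike.ne_iff.1 h
  have h1 := hφ H w
  rw [hw H, map_smul, smul_eq_mul] at h1
  have h2 : (ν' H - ν H) * φ w = 0 := by linear_combination h1
  exact (mul_eq_zero.1 h2).resolve_left (sub_ne_zero.2 hH)

theorem isWeightForm_comp (hW : ⨆ ν : Weight n, wt n W ν = ⊤) {ν : Weight n}
    {π : W →ₗ[ℂ] W} (h2 : ∀ ν', ν' ≠ ν → ∀ w ∈ wt n W ν', π w = 0) (φ : W →ₗ[ℂ] ℂ) :
    IsWeightForm ν (φ ∘ₗ π) := by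
  intro H w
  refine weight_induction hW (p := fun w => (φ ∘ₗ π) ⁅(H : so n), w⁆ = ν H * (φ ∘ₗ π) w) ?_ ?_ ?_ w
  · simp
  · intro a b ha hb; rw [lie_add, map_add, map_add, ha, hb, mul_add]
  · intro ν' w hw
    rw [hw H, map_smul, smul_eq_mul]
    by_cases e : ν' = ν
    · rw [e]
    · rw [LinearMap.comp_apply, h2 ν' e w hw, map_zero, mul_zero, mul_zero]

theorem proj_mem (hW : ⨆ ν : Weight n, wt n W ν = ⊤) {ν : Weight n}
    {π : W →ₗ[ℂ] W} (h1 : ∀ w ∈ wt n W ν, π w = w)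
    (h2 : ∀ ν', ν' ≠ ν → ∀ w ∈ wt n W ν', π w = 0) (N : LieSubmodule ℂ (so n) W) {w : W}
    (hw : w ∈ N) : π w ∈ N := by
  refine Submodule.iSup_induction _ (motive := fun w => π w ∈ N) (mem_iSup_inf_wt hW N hw) ?_ ?_ ?_
  · rintro ν' w ⟨hw, hw'⟩
    by_cases e : ν' = ν
    · subst e; rw [h1 w hw']; exact hw
    · rw [h2 ν' e w hw']; exact N.zero_mem
  · rw [map_zero]; exact N.zero_mem
  · intro a b ha hb; rw [map_add]; exact N.add_mem ha hb

/-- Since `N` is graded by weights, some weight component of `w` lies outside `N`. A linear form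
that separates it from `N` keeps this property after composition with the weight projection, which
preserves `N`, and so becomes a weight form. -/
theorem exists_weightForm_ne_zero (hW : ⨆ ν : Weight n, wt n W ν = ⊤)
    (N : LieSubmodule ℂ (so n) W) {w : W} (hw : w ∉ N) :
    ∃ (ν : Weight n) (φ : W →ₗ[ℂ] ℂ), IsWeightForm ν φ ∧ (∀ v ∈ N, φ v = 0) ∧ φ w ≠ 0 := by
  obtain ⟨s, f, hf, e⟩ := exists_finset_sum_of_mem_iSup (wt n W) (hW ▸ Submodule.mem_top : w ∈ _)
  have : ∃ ν ∈ s, f ν ∉ N := by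
    by_contra! h
    exact hw (e ▸ N.toSubmodule.sum_mem h)
  classical
  obtain ⟨ν, hν, hfν⟩ := this
  obtain ⟨π, h1, h2⟩ := exists_weightProj hW ν
  obtain ⟨φ, hφ, hφ'⟩ := Submodule.exists_le_ker_of_notMem (p := N.toSubmodule) hfν
  refine ⟨ν, φ ∘ₗ π, isWeightForm_comp hW h2 φ, fun v hv => hφ' (proj_mem hW h1 h2 N hv), ?_⟩
  rw [← e, LinearMap.comp_apply, map_sum, Finset.sum_eq_single_of_mem ν hν
    fun ν' _ hne => h2 ν' hne _ (hf ν'), h1 _ (hf ν)]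
  exact hφ

/-- Any linear extension, composed with the weight projection, still restricts to `φ`, because `φ`
vanishes on all other weight spaces. -/
theorem IsWeightForm.exists_extend (hW : ⨆ ν : Weight n, wt n W ν = ⊤)
    (N : LieSubmodule ℂ (so n) W) {ν : Weight n} {φ : N →ₗ[ℂ] ℂ} (hφ : IsWeightForm ν φ) :
    ∃ ψ : W →ₗ[ℂ] ℂ, IsWeightForm ν ψ ∧ ∀ w : N, ψ w = φ w := by
  obtain ⟨π, h1, h2⟩ := exists_weightProj hW ν
  obtain ⟨ψ, hψ⟩ := LinearMap.exists_extend (p := N.toSubmodule) φ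
  have hψ' : ∀ w : N, ψ w = φ w := fun w => LinearMap.congr_fun hψ w
  refine ⟨ψ ∘ₗ π, isWeightForm_comp hW h2 ψ, fun w => ?_⟩
  refine weight_induction (iSup_wt_coe_eq_top hW N) (p := fun w => (ψ ∘ₗ π) w = φ w) ?_ ?_ ?_ w
  · simp
  · intro a b ha hb; rw [LieSubmodule.coe_add, map_add, map_add, ha, hb]
  · intro ν' w hw
    have hw' : (w : W) ∈ wt n W ν' := fun H => congrArg Subtype.val (hw H)
    by_cases e : ν' = ν
    · subst e; rw [LinearMap.comp_apply, h1 _ hw', hψ']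
    · rw [LinearMap.comp_apply, h2 ν' e _ hw', map_zero, hφ.eq_zero e hw]

end weights

/-! ### Dual pairs of weight modules -/

theorem theta_theta {n : ℕ} (Y : so n) : theta (theta Y) = Y := by
  ext a b; simp [theta]

section dualPair
variable {n : ℕ} {W W' : Type*} [AddCommGroup W'] [Module ℂ W'] [LieRingModule (so n) W']
  [LieModule ℂ (so n) W'] [AddCommGroup W] [Module ℂ W] [LieRingModule (so n) W]
  [LieModule ℂ (so n) W]

/-- A contravariant pairing of two weight modules that identifies each of them with the
`𝒪`-dual of the other. -/
structure IsDualPair (B : W →ₗ[ℂ] W' →ₗ[ℂ] ℂ) : Prop where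
  contra : ∀ (Y : so n) (f : W) (g : W'), B ⁅theta Y, f⁆ g = B f ⁅Y, g⁆
  weightL : ⨆ ν : Weight n, wt n W ν = ⊤
  weightR : ⨆ ν : Weight n, wt n W' ν = ⊤
  reprL : ∀ (ν : Weight n) (φ : W →ₗ[ℂ] ℂ), IsWeightForm ν φ → ∃ g, ∀ f, B f g = φ f
  reprR : ∀ (ν : Weight n) (φ : W' →ₗ[ℂ] ℂ), IsWeightForm ν φ → ∃ f, ∀ g, B f g = φ g

namespace IsDualPair
variable {B : W →ₗ[ℂ] W' →ₗ[ℂ] ℂ} (h : IsDualPair (n := n) B)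

theorem flip (h : IsDualPair (n := n) B) : IsDualPair (n := n) B.flip where
  contra Y f g := by
    rw [LinearMap.flip_apply, LinearMap.flip_apply, ← h.contra, theta_theta]
  weightL := h.weightR
  weightR := h.weightL
  reprL ν φ hφ := h.reprR ν φ hφ
  reprR ν φ hφ := h.reprL ν φ hφ

/-- Nondegeneracy is no axiom of a dual pair: weight forms separate vectors, and each of them is
represented by the other side. -/
theorem eq_zero_of_forall_right (h : IsDualPair (n := n) B) {g : W'} (hg : ∀ f, B f g = 0) : g = 0 := by
  by_contra h0
  obtain ⟨ν, φ, hφ, -, hne⟩ := exists_weightForm_ne_zero h.weightR ⊥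
    (w := g) (by rwa [LieSubmodule.mem_bot])
  obtain ⟨f, hf⟩ := h.reprR ν φ hφ
  exact hne (hf g ▸ hg f)

/-- The annihilator of a submodule. -/
def perp (S : LieSubmodule ℂ (so n) W) : LieSubmodule ℂ (so n) W' where
  carrier := {g | ∀ f ∈ S, B f g = 0}
  zero_mem' := by intro f _; simp
  add_mem' := by intro a b ha hb f hf; rw [map_add, ha f hf, hb f hf, add_zero]
  smul_mem' := by intro c a ha f hf; rw [map_smul, ha f hf, smul_zero]
  lie_mem := by intro Y g hg f hf; rw [← h.contra]; exact hg _ (S.lie_mem hf)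

/-- A weight form that vanishes on `S` but not at `f` is represented by an element of the
annihilator of `S`. -/
theorem mem_of_forall_perp {S : LieSubmodule ℂ (so n) W} {f : W}
    (hf : ∀ g ∈ h.perp S, B f g = 0) : f ∈ S := by
  by_contra h0
  obtain ⟨ν, φ, hφ, hS, hne⟩ := exists_weightForm_ne_zero h.weightL S h0
  obtain ⟨g, hg⟩ := h.reprL ν φ hφ
  exact hne (hg f ▸ hf g fun s hs => by rw [hg, hS s hs])

/-- Together with its mirror image this makes `perp` an order-reversing bijection of submodule
lattices, by which simplicity and uniqueness of submodules pass to the dual. -/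
theorem perp_flip_perp (S : LieSubmodule ℂ (so n) W) : h.flip.perp (h.perp S) = S :=
  le_antisymm (fun _ hf => h.mem_of_forall_perp hf) fun f hf _ hg => hg f hf

theorem perp_perp_flip (S : LieSubmodule ℂ (so n) W') : h.perp (h.flip.perp S) = S :=
  h.flip.perp_flip_perp S

theorem perp_bot : h.perp ⊥ = ⊤ := by
  rw [eq_top_iff]; intro g _ f hf
  rw [(LieSubmodule.mem_bot f).1 hf, map_zero, LinearMap.zero_apply]

theorem perp_top : h.perp ⊤ = ⊥ := by
  rw [eq_bot_iff]; intro g hg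
  exact h.eq_zero_of_forall_right fun f => hg f trivial

theorem perp_injective : Function.Injective h.perp :=
  fun S T e => by rw [← h.perp_flip_perp S, e, h.perp_flip_perp]

/-- The isomorphism comes from `g ↦ B(·, g)`. Weight vectors go to weight forms because `ϑ` fixes
the Cartan subalgebra, and weight forms span the `𝒪`-dual, so `reprL` gives surjectivity. -/
theorem nonempty_oDual_equiv (h : IsDualPair (n := n) B) : Nonempty (ODual n W ≃ₗ⁅ℂ, so n⁆ W') := by
  have hmem : ∀ g : W', (B.flip g : TwDual n W) ∈ ODual n W := by
    intro g
    refine weight_induction h.weightR (p := fun g => (B.flip g : TwDual n W) ∈ ODual n W) ?_ ?_ ?_ g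
    · rw [map_zero]; exact (ODual n W).zero_mem
    · intro a b ha hb; rw [map_add]; exact (ODual n W).add_mem ha hb
    · intro ν g hg
      refine Submodule.mem_iSup_of_mem (p := fun ν => wt n (TwDual n W) ν) ν fun H => ?_
      apply LinearMap.ext
      intro f
      change B ⁅theta (H : so n), f⁆ g = ν H • B f g
      rw [h.contra, hg H, map_smul]
  let Φ : W' →ₗ⁅ℂ, so n⁆ ODual n W :=
    { toFun := fun g => ⟨B.flip g, hmem g⟩
      map_add' := fun a b => Subtype.ext (map_add B.flip a b)
      map_smul' := fun c a => Subtype.ext (map_smul B.flip c a)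
      map_lie' := fun {Y g} => by
        apply Subtype.ext
        apply LinearMap.ext
        intro f
        exact (h.contra Y f g).symm }
  have hinj : Function.Injective Φ := by
    rw [injective_iff_map_eq_zero]
    intro g hg
    exact h.eq_zero_of_forall_right fun f => LinearMap.congr_fun (congrArg Subtype.val hg) f
  have hsurj : Function.Surjective Φ := by
    rintro ⟨φ, hφ⟩
    have hφ' : φ ∈ ⨆ ν : Weight n, wt n (TwDual n W) ν := hφ
    have key : ∃ g : W', B.flip g = φ := by
      refine Submodule.iSup_induction _ (motive := fun φ => ∃ g : W', B.flip g = φ) hφ' ?_ ?_ ?_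
      · intro ν φ hφ
        obtain ⟨g, hg⟩ := h.reprL ν φ fun H w => by
          have := LinearMap.congr_fun (hφ H) w
          change φ.toFun ⁅theta (H : so n), w⁆ = _ at this
          rw [theta_cartan] at this
          exact this
        exact ⟨g, LinearMap.ext hg⟩
      · exact ⟨0, map_zero _⟩
      · rintro a b ⟨g, rfl⟩ ⟨g', rfl⟩; exact ⟨g + g', map_add _ _ _⟩
    obtain ⟨g, hg⟩ := key
    exact ⟨g, Subtype.ext hg⟩
  let e := Equiv.ofBijective Φ ⟨hinj, hsurj⟩
  exact ⟨LieModuleEquiv.symm { Φ with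
    invFun := e.symm
    left_inv := e.symm_apply_apply
    right_inv := e.apply_symm_apply }⟩

/-- A weight form on `W ⧸ S`, pulled back to `W`, has its representative in the annihilator of `S`;
a weight form on the annihilator is first extended to `W'`. The explicit value of the new pairing is
kept so that annihilators can be computed with polynomials. -/
theorem exists_quotient_perp (S : LieSubmodule ℂ (so n) W) :
    ∃ B' : (W ⧸ S) →ₗ[ℂ] h.perp S →ₗ[ℂ] ℂ, IsDualPair (n := n) B' ∧
      ∀ (f : W) (g : h.perp S), B' (LieSubmodule.Quotient.mk' S f) g = B f g := by
  let B' : (W ⧸ S) →ₗ[ℂ] h.perp S →ₗ[ℂ] ℂ :=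
    Submodule.liftQ S.toSubmodule ((LinearMap.lcomp ℂ ℂ (h.perp S).toSubmodule.subtype) ∘ₗ B)
      (fun f hf => LinearMap.ext fun g => g.2 f hf)
  have hB' : ∀ (f : W) (g : h.perp S), B' (LieSubmodule.Quotient.mk' S f) g = B f g :=
    fun f g => rfl
  refine ⟨B', ⟨?_, ?_, ?_, ?_, ?_⟩, hB'⟩
  · intro Y f g
    obtain ⟨f, rfl⟩ := LieSubmodule.Quotient.surjective_mk' S f
    rw [← LieModuleHom.map_lie, hB', hB', h.contra]; rfl
  · exact iSup_wt_quotient_eq_top h.weightL S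
  · exact iSup_wt_coe_eq_top h.weightR _
  · intro ν φ hφ
    obtain ⟨g, hg⟩ := h.reprL ν (φ ∘ₗ (LieSubmodule.Quotient.mk' S : W →ₗ[ℂ] W ⧸ S)) (by
      intro H w
      change φ (LieSubmodule.Quotient.mk' S ⁅(H : so n), w⁆) = _
      rw [LieModuleHom.map_lie]; exact hφ H _)
    refine ⟨⟨g, fun f hf => ?_⟩, fun f => ?_⟩
    · rw [hg]
      change φ (LieSubmodule.Quotient.mk' S f) = 0
      rw [(LieSubmodule.Quotient.mk_eq_zero S).2 hf, map_zero]
    · obtain ⟨f, rfl⟩ := LieSubmodule.Quotient.surjective_mk' S f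
      exact hg f
  · intro ν φ hφ
    obtain ⟨ψ, hψ, hψ'⟩ := hφ.exists_extend h.weightR
    obtain ⟨f, hf⟩ := h.reprR ν ψ hψ
    exact ⟨LieSubmodule.Quotient.mk' S f, fun g => by rw [hB', hf, hψ']⟩

theorem exists_coe_quotient_perp (S : LieSubmodule ℂ (so n) W) :
    ∃ B' : S →ₗ[ℂ] (W' ⧸ h.perp S) →ₗ[ℂ] ℂ, IsDualPair (n := n) B' := by
  -- Only existence is recorded, so that the rewriting of the double annihilator as `S` can change
  -- the type of the pairing.
  have hB : ∃ B' : (W' ⧸ h.perp S) →ₗ[ℂ] h.flip.perp (h.perp S) →ₗ[ℂ] ℂ,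
      IsDualPair (n := n) B' :=
    let ⟨B', hB', _⟩ := h.flip.exists_quotient_perp (h.perp S)
    ⟨B', hB'⟩
  rw [h.perp_flip_perp] at hB
  obtain ⟨B', hB'⟩ := hB
  exact ⟨B'.flip, hB'.flip⟩

theorem isIrreducible (h : IsDualPair (n := n) B) [LieModule.IsIrreducible ℂ (so n) W] :
    LieModule.IsIrreducible ℂ (so n) W' := by
  have : Nontrivial (LieSubmodule ℂ (so n) W') := by
    refine ⟨⊥, ⊤, fun e => bot_ne_top (α := LieSubmodule ℂ (so n) W) ?_⟩
    apply h.perp_injective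
    rw [h.perp_bot, h.perp_top, e]
  refine ⟨fun N => ?_⟩
  rw [← h.perp_perp_flip N]
  rcases eq_bot_or_eq_top (h.flip.perp N) with e | e <;> rw [e]
  · exact Or.inr h.perp_bot
  · exact Or.inl h.perp_top

end IsDualPair
end dualPair

/-! ### Modules with exactly one proper nonzero submodule -/

section chain
variable {n : ℕ} {W : Type*} [AddCommGroup W] [Module ℂ W] [LieRingModule (so n) W]
  [LieModule ℂ (so n) W]

/-- `S` is the only submodule of `W` besides `⊥` and `⊤`, which differ from `S`. -/
structure IsUniqueProper (S : LieSubmodule ℂ (so n) W) : Prop where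
  ne_bot : S ≠ ⊥
  ne_top : S ≠ ⊤
  eq : ∀ N : LieSubmodule ℂ (so n) W, N = ⊥ ∨ N = S ∨ N = ⊤

namespace IsUniqueProper
variable {S : LieSubmodule ℂ (so n) W}

theorem isIrreducible_coe (h : IsUniqueProper S) : LieModule.IsIrreducible ℂ (so n) S := by
  have : Nontrivial S := (LieSubmodule.nontrivial_iff_ne_bot ℂ (so n) W).2 h.ne_bot
  refine LieModule.IsIrreducible.mk fun N hN => ?_
  have hle : N.map S.incl ≤ S := by
    intro w hw
    obtain ⟨v, -, rfl⟩ := (LieSubmodule.mem_map w).1 hw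
    exact v.2
  have hS : N.map S.incl = S := by
    rcases h.eq (N.map S.incl) with e | e | e
    · refine absurd ((LieSubmodule.eq_bot_iff N).2 fun v hv => Subtype.ext ?_) hN
      exact (LieSubmodule.mem_bot _).1 (e ▸ LieSubmodule.mem_map_of_mem (f := S.incl) hv)
    · exact e
    · exact absurd (top_le_iff.1 (e ▸ hle)) h.ne_top
  rw [eq_top_iff]
  intro v _
  obtain ⟨u, hu, e⟩ := (LieSubmodule.mem_map (v : W)).1 (hS.symm ▸ v.2 : (v : W) ∈ N.map S.incl)
  exact (Subtype.ext e : u = v) ▸ hu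

theorem isIrreducible_quotient (h : IsUniqueProper S) : LieModule.IsIrreducible ℂ (so n) (W ⧸ S) := by
  have hnt : ∃ w : W, w ∉ S := by
    by_contra! hc
    exact h.ne_top (eq_top_iff.2 fun w _ => hc w)
  obtain ⟨w, hw⟩ := hnt
  have : Nontrivial (W ⧸ S) := ⟨LieSubmodule.Quotient.mk' S w, 0,
    fun e => hw ((LieSubmodule.Quotient.mk_eq_zero S).1 e)⟩
  refine LieModule.IsIrreducible.mk fun N hN => ?_
  have hle : S ≤ N.comap (LieSubmodule.Quotient.mk' S) := by
    intro v hv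
    rw [LieSubmodule.mem_comap, (LieSubmodule.Quotient.mk_eq_zero S).2 hv]
    exact N.zero_mem
  rcases h.eq (N.comap (LieSubmodule.Quotient.mk' S)) with e | e | e
  · exact absurd (le_bot_iff.1 (e ▸ hle)) h.ne_bot
  · refine absurd ((LieSubmodule.eq_bot_iff N).2 fun v hv => ?_) hN
    obtain ⟨v, rfl⟩ := LieSubmodule.Quotient.surjective_mk' S v
    exact (LieSubmodule.Quotient.mk_eq_zero S).2 (e ▸ LieSubmodule.mem_comap.2 hv)
  · rw [eq_top_iff]
    intro v _
    obtain ⟨v, rfl⟩ := LieSubmodule.Quotient.surjective_mk' S v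
    exact LieSubmodule.mem_comap.1 (e.symm ▸ LieSubmodule.mem_top v)

theorem socle_eq (h : IsUniqueProper S) : socle n W = S := by
  apply le_antisymm
  · refine sSup_le fun T hT => ?_
    have hT' : LieModule.IsIrreducible ℂ (so n) T := hT
    rcases h.eq T with rfl | rfl | rfl
    · exact bot_le
    · exact le_rfl
    -- Here the whole module is assumed simple, so `S`, viewed inside it, is `⊥` or `⊤`; the first
    -- is excluded and the second gives the inclusion.
    · rcases eq_bot_or_eq_top (S.comap (⊤ : LieSubmodule ℂ (so n) W).incl) with e | e
      · refine absurd ((LieSubmodule.eq_bot_iff S).2 fun v hv => ?_) h.ne_bot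
        have h1 : (⟨v, LieSubmodule.mem_top v⟩ : (⊤ : LieSubmodule ℂ (so n) W)) ∈
          S.comap (⊤ : LieSubmodule ℂ (so n) W).incl := LieSubmodule.mem_comap.2 hv
        rw [e, LieSubmodule.mem_bot] at h1
        exact congrArg Subtype.val h1
      · exact LieSubmodule.comap_incl_eq_top.1 e
  · exact le_sSup h.isIrreducible_coe

end IsUniqueProper

theorem IsDualPair.isUniqueProper_perp {W' : Type*} [AddCommGroup W'] [Module ℂ W']
    [LieRingModule (so n) W'] [LieModule ℂ (so n) W'] {B : W →ₗ[ℂ] W' →ₗ[ℂ] ℂ}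
    (hB : IsDualPair (n := n) B) {S : LieSubmodule ℂ (so n) W} (h : IsUniqueProper S) :
    IsUniqueProper (hB.perp S) where
  ne_bot e := h.ne_top (hB.perp_injective (e.trans hB.perp_top.symm))
  ne_top e := h.ne_bot (hB.perp_injective (e.trans hB.perp_bot.symm))
  eq N := by
    rw [← hB.perp_perp_flip N]
    rcases h.eq (hB.flip.perp N) with e | e | e <;> rw [e]
    · exact Or.inr (Or.inr hB.perp_bot)
    · exact Or.inr (Or.inl rfl)
    · exact Or.inl hB.perp_top

end chain

/-! ### Highest weight modules -/

section height
variable {n : ℕ}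

/-- The height of the weight `ε_p`. -/
def ht : Out n → ℤ
  | .inl j => ((n / 2 : ℕ) : ℤ) + 1 - (j : ℕ)
  | .inr (.inl j) => -(((n / 2 : ℕ) : ℤ) + 1 - (j : ℕ))
  | .inr (.inr _) => 0

theorem ht_opp (p : Out n) : ht (opp p) = -ht p := by
  rcases p with j | j | k <;> simp [ht, opp]

theorem ht_injective : Function.Injective (ht (n := n)) := by
  rintro (i | i | i) (j | j | j) h <;> have hi := i.2 <;> have hj := j.2 <;>
    simp only [ht] at h <;> simp only [Sum.inl.injEq, Sum.inr.injEq, Fin.ext_iff, reduceCtorEq] <;>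
    omega

/-- An element of the Cartan subalgebra whose eigenvalue on a root vector is the height of the
root. -/
def heightElt (n : ℕ) : cartan n :=
  ⟨⟨Matrix.diagonal fun p => (ht p : ℂ), by
    rw [mem_so]
    intro p q
    by_cases h : p = q
    · subst h; simp [ht_opp]
    · simp [Matrix.diagonal_apply, h, Ne.symm h]⟩,
  fun p q h => Matrix.diagonal_apply_ne _ h⟩

theorem heightElt_lie_E (p q : Out n) :
    ⁅(heightElt n : so n), E p q⁆ = ((ht p : ℂ) - ht q) • E p q := by
  rw [cartan_lie_E]
  simp [eps_apply, heightElt]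

theorem E_opp_opp (p q : Out n) : E (opp q) (opp p) = -E p q := by
  ext a b; simp [E]

theorem E_opp_self (p : Out n) : E p (opp p) = 0 := by
  ext a b; simp [E]

theorem E_self_mem_cartan (p : Out n) : E p p ∈ cartan n := by
  intro a b h
  simp only [E, Matrix.sub_apply, Matrix.single_apply]
  rw [if_neg, if_neg, sub_zero]
  · rintro ⟨rfl, rfl⟩; exact h rfl
  · rintro ⟨rfl, rfl⟩; exact h rfl

/-- Every root vector of positive height is in `𝔫⁺`. The sign comes from `E_{-q,-p} = -E_{pq}`,
since `IsPos` lists only one of the two names of a root vector; zero occurs for `E_{p,-p}`. -/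
theorem isPos_or_of_ht_lt {p q : Out n} (h : ht q < ht p) :
    E p q = 0 ∨ IsPos (E p q) ∨ IsPos (-E p q) := by
  rcases p with i | i | i <;> rcases q with j | j | j <;> have hi := i.2 <;> have hj := j.2 <;>
    simp only [ht] at h
  · exact Or.inr (Or.inl (IsPos.sub i j (Fin.lt_def.2 (by omega))))
  · rcases lt_trichotomy i j with hij | rfl | hij
    · exact Or.inr (Or.inl (IsPos.add i j hij))
    · exact Or.inl (E_opp_self _)
    · rw [← E_opp_opp]; exact Or.inr (Or.inr (IsPos.add j i hij))
  · rw [← E_opp_opp]; exact Or.inr (Or.inr (IsPos.short j i))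
  · omega
  · rw [← E_opp_opp]; exact Or.inr (Or.inr (IsPos.sub j i (Fin.lt_def.2 (by omega))))
  · omega
  · omega
  · exact Or.inr (Or.inl (IsPos.short i j))
  · omega

end height

/-! ### Modules generated by a highest weight vector -/

section highestWeight
variable {n : ℕ} {V : Type*} [AddCommGroup V] [Module ℂ V] [LieRingModule (so n) V]
  [LieModule ℂ (so n) V]

/-- `v` is a highest weight vector of weight `ν` (possibly zero). -/
structure IsHighestWeight (ν : Weight n) (v : V) : Prop where
  mem_wt : v ∈ wt n V ν
  pos_lie : ∀ Y : so n, IsPos Y → ⁅Y, v⁆ = 0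

theorem IsHighestWeight.lie_eq_zero {ν : Weight n} {v : V} (h : IsHighestWeight ν v) {p q : Out n}
    (hpq : ht q < ht p) : ⁅E p q, v⁆ = 0 := by
  rcases isPos_or_of_ht_lt hpq with e | e | e
  · rw [e, zero_lie]
  · exact h.pos_lie _ e
  · have := h.pos_lie _ e
    rwa [neg_lie, neg_eq_zero] at this

/-- The components of a module generated by a highest weight vector `v`: the line spanned by `v`,
and eigenspaces of `heightElt`. -/
def heightSpace (ν : Weight n) (v : V) (k : ℕ) : Submodule ℂ V :=
  if k = 0 then ℂ ∙ v
  else Module.End.eigenspace (LieModule.toEnd ℂ (so n) V (heightElt n)) (ν (heightElt n) - k)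

theorem lie_of_mem_heightSpace {ν : Weight n} {v : V} (h : IsHighestWeight ν v) {k : ℕ} {w : V}
    (hw : w ∈ heightSpace ν v k) : ⁅(heightElt n : so n), w⁆ = (ν (heightElt n) - k) • w := by
  unfold heightSpace at hw
  split_ifs at hw with hk
  · obtain ⟨c, rfl⟩ := Submodule.mem_span_singleton.1 hw
    rw [lie_smul, h.mem_wt (heightElt n), hk, Nat.cast_zero, sub_zero, smul_comm]
  · exact Module.End.mem_eigenspace_iff.1 hw

/-- The module is spanned by what lowering root vectors make out of `v`. They strictly lower the
height, so nothing but the line `ℂ v` is needed in height zero. No PBW basis enters: the smallest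
subspace containing `v` and stable under lowering turns out to be a submodule. -/
theorem iSup_heightSpace {ν : Weight n} {v : V} (h : IsHighestWeight ν v)
    (hgen : ∀ N : LieSubmodule ℂ (so n) V, v ∈ N → N = ⊤) : ⨆ k, heightSpace ν v k = ⊤ := by
  let 𝒮 : Set (Submodule ℂ V) := {P | v ∈ P ∧ ∀ p q : Out n, ht p < ht q → ∀ w ∈ P, ⁅E p q, w⁆ ∈ P}
  have hQv : v ∈ sInf 𝒮 := by
    rw [Submodule.mem_sInf]; exact fun P hP => hP.1
  have hQE : ∀ p q : Out n, ht p < ht q → ∀ w ∈ sInf 𝒮, ⁅E p q, w⁆ ∈ sInf 𝒮 := by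
    intro p q hpq w hw
    rw [Submodule.mem_sInf] at hw ⊢
    exact fun P hP => hP.2 p q hpq w (hw P hP)
  -- `R` is the part of the minimal subspace that all of `𝔤` maps back into it. By `Z E w = [Z, E] w
  -- + E Z w` it is stable under lowering operators and contains `v`, so by minimality it is
  -- everything.
  let R : Submodule ℂ V :=
    { carrier := {w | w ∈ sInf 𝒮 ∧ ∀ Z : so n, ⁅Z, w⁆ ∈ sInf 𝒮}
      zero_mem' := ⟨zero_mem _, fun Z => by rw [lie_zero]; exact zero_mem _⟩
      add_mem' := fun ha hb => ⟨add_mem ha.1 hb.1, fun Z => by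
        rw [lie_add]; exact add_mem (ha.2 Z) (hb.2 Z)⟩
      smul_mem' := fun c a ha => ⟨Submodule.smul_mem _ c ha.1, fun Z => by
        rw [lie_smul]; exact Submodule.smul_mem _ c (ha.2 Z)⟩ }
  have hR : sInf 𝒮 ≤ R := by
    refine sInf_le ⟨⟨hQv, fun Z => ?_⟩, fun p q hpq w hw => ⟨hQE p q hpq w hw.1, fun Z => ?_⟩⟩
    · rw [eq_sum_E Z]
      simp only [smul_lie, sum_lie]
      refine Submodule.smul_mem _ _ (Submodule.sum_mem _ fun p _ => Submodule.sum_mem _ fun q _ =>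
        Submodule.smul_mem _ _ ?_)
      rcases lt_trichotomy (ht p) (ht q) with hpq | hpq | hpq
      · exact hQE p q hpq v hQv
      · obtain rfl := ht_injective hpq
        rw [h.mem_wt ⟨E p p, E_self_mem_cartan p⟩]
        exact Submodule.smul_mem _ _ hQv
      · rw [h.lie_eq_zero hpq]; exact zero_mem _
    · rw [leibniz_lie]
      exact add_mem (hw.2 _) (hQE p q hpq _ (hw.2 Z))
  have htop : sInf 𝒮 = ⊤ := by
    have := hgen ⟨sInf 𝒮, fun {Z w} hw => (hR hw).2 Z⟩ hQv
    rwa [LieSubmodule.mk_eq_top_iff] at this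
  rw [eq_top_iff, ← htop]
  refine sInf_le ⟨Submodule.mem_iSup_of_mem 0 (by
    rw [heightSpace, if_pos rfl]; exact Submodule.mem_span_singleton_self v), fun p q hpq w hw => ?_⟩
  refine Submodule.iSup_induction _ (motive := fun w => ⁅E p q, w⁆ ∈ _) hw ?_ ?_ ?_
  · intro k w hw
    obtain ⟨j, hj⟩ := Int.le.dest hpq.le
    refine Submodule.mem_iSup_of_mem (k + j) ?_
    -- The height drops strictly, so the target is an eigenspace and never the line in index zero.
    have hj0 : k + j ≠ 0 := by omega
    rw [heightSpace, if_neg hj0, Module.End.mem_eigenspace_iff, LieModule.toEnd_apply_apply,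
      leibniz_lie, heightElt_lie_E, lie_of_mem_heightSpace h hw, smul_lie, lie_smul, ← add_smul,
      ← hj]
    congr 1
    push_cast
    ring
  · rw [lie_zero]; exact zero_mem _
  · intro a b ha hb; rw [lie_add]; exact add_mem ha hb

/-- If `φ` did not vanish on `N`, then `φ(N) = W` by simplicity, and some `x` in `N` has `φ x = φ
v`. The component of `x` in height zero lies in `N`, is a multiple `c v`, and satisfies `φ (c v) = φ
v`; hence `c = 1` and `v ∈ N`, which forces `N = ⊤`. -/
theorem le_ker_of_ne_top {W : Type*} [AddCommGroup W] [Module ℂ W] [LieRingModule (so n) W]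
    [LieModule ℂ (so n) W] [LieModule.IsIrreducible ℂ (so n) W] {ν : Weight n} {v : V}
    (h : IsHighestWeight ν v) (hgen : ∀ N : LieSubmodule ℂ (so n) V, v ∈ N → N = ⊤)
    (φ : V →ₗ⁅ℂ, so n⁆ W) (hφ : φ v ≠ 0) {N : LieSubmodule ℂ (so n) V} (hN : N ≠ ⊤) :
    ∀ w ∈ N, φ w = 0 := by
  classical
  by_contra! hc
  obtain ⟨w, hw, hw0⟩ := hc
  refine hN (hgen N ?_)
  have htop : N.map φ = ⊤ := by
    refine (eq_bot_or_eq_top (N.map φ)).resolve_left fun e => hw0 ?_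
    have := LieSubmodule.mem_map_of_mem (f := φ) hw
    rwa [e, LieSubmodule.mem_bot] at this
  obtain ⟨x, hx, hxv⟩ := (LieSubmodule.mem_map (φ v)).1 (htop ▸ LieSubmodule.mem_top _ : φ v ∈ N.map φ)
  have hxs : x ∈ ⨆ k, heightSpace ν v k := by rw [iSup_heightSpace h hgen]; trivial
  -- The index zero is put into the support by hand, with component zero if it was absent, so that
  -- the height-zero component can be named.
  obtain ⟨s, f, hf, hs⟩ : ∃ (s : Finset ℕ) (f : ℕ → V), (∀ k, f k ∈ heightSpace ν v k) ∧
      ∑ k ∈ insert 0 s, f k = x := by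
    obtain ⟨s, f, hf, hs⟩ := exists_finset_sum_of_mem_iSup _ hxs
    refine ⟨s, fun k => if k ∈ s then f k else 0, fun k => ?_, ?_⟩
    · dsimp only
      split_ifs
      · exact hf k
      · exact zero_mem _
    · rw [← Finset.sum_filter, ← hs]
      refine Finset.sum_congr ?_ fun _ _ => rfl
      ext k; simp
  have hχ : Function.Injective fun (k : ℕ) (_ : Unit) => ν (heightElt n) - (k : ℂ) := by
    intro k l e
    have := congrFun e ()
    simpa using this
  have hfN := mem_of_sum_eigenvectors_mem (fun (_ : Unit) (w : V) => ⁅(heightElt n : so n), w⁆) _ hχ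
    N.toSubmodule (fun _ => ⟨LieModule.toEnd ℂ (so n) V (heightElt n), fun _ => rfl⟩)
    (fun _ _ hw => N.lie_mem hw) _ f (fun k _ _ => lie_of_mem_heightSpace h (hf k))
    (hs.symm ▸ hx) 0 (Finset.mem_insert_self _ _)
  have hφD : ∀ k, ∀ u ∈ heightSpace ν v k,
      ⁅(heightElt n : so n), φ u⁆ = (ν (heightElt n) - k) • φ u := by
    intro k u hu
    rw [← LieModuleHom.map_lie, lie_of_mem_heightSpace h hu, map_smul]
  have hv0 : v ∈ heightSpace ν v 0 := by
    rw [heightSpace, if_pos rfl]; exact Submodule.mem_span_singleton_self v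
  -- Comparison of the height-zero components in `φ x - φ v = 0`.
  have h0 := mem_of_sum_eigenvectors_mem (fun (_ : Unit) (w : W) => ⁅(heightElt n : so n), w⁆) _ hχ
    ⊥ (fun _ => ⟨LieModule.toEnd ℂ (so n) W (heightElt n), fun _ => rfl⟩)
    (fun _ w hw => by rw [(Submodule.mem_bot ℂ).1 hw, lie_zero]; exact zero_mem _) (insert 0 s)
    (fun k => φ (f k) - if k = 0 then φ v else 0)
    (fun k _ _ => by
      rw [lie_sub, hφD k _ (hf k)]
      split_ifs with hk
      · subst hk; rw [hφD 0 v hv0, smul_sub]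
      · rw [lie_zero, sub_zero, sub_zero])
    (by
      rw [Finset.sum_sub_distrib, ← map_sum, hs, hxv, Finset.sum_ite_eq',
        if_pos (Finset.mem_insert_self _ _), sub_self]
      exact zero_mem _) 0 (Finset.mem_insert_self _ _)
  rw [Submodule.mem_bot, if_pos rfl, sub_eq_zero] at h0
  have hf0 := hf 0
  rw [heightSpace, if_pos rfl] at hf0
  obtain ⟨c, hc⟩ := Submodule.mem_span_singleton.1 hf0
  have hc1 : c = 1 := by
    rw [← hc, map_smul] at h0
    exact smul_left_injective ℂ hφ (h0.trans (one_smul ℂ _).symm)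
  rw [← hc, hc1, one_smul] at hfN
  exact hfN

end highestWeight

/-! ### Verma modules and their simple quotients -/

section verma
variable {n : ℕ}

/-- The universal property lifts `𝔤 → S` to the enveloping algebra; followed by the inclusion of
`S`, the lift is the identity. -/
theorem uea_subalgebra_eq_top (S : Subalgebra ℂ (UEA n))
    (hS : ∀ Y : so n, UniversalEnvelopingAlgebra.ι ℂ Y ∈ S) (z : UEA n) : z ∈ S := by
  let f : so n →ₗ⁅ℂ⁆ S :=
    { toFun := fun Y => ⟨UniversalEnvelopingAlgebra.ι ℂ Y, hS Y⟩
      map_add' := fun Y Z => Subtype.ext (map_add _ Y Z)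
      map_smul' := fun c Y => Subtype.ext (map_smul _ c Y)
      map_lie' := fun {Y Z} => Subtype.ext (LieHom.map_lie (UniversalEnvelopingAlgebra.ι ℂ) Y Z) }
  have h : S.val.comp (UniversalEnvelopingAlgebra.lift ℂ f) = AlgHom.id ℂ (UEA n) := by
    apply UniversalEnvelopingAlgebra.hom_ext
    ext Y
    simp [f]
  have := AlgHom.congr_fun h z
  rw [← show _ = z from this]
  exact (UniversalEnvelopingAlgebra.lift ℂ f z).2

instance (ν : Weight n) : LieRingModule (so n) (Verma ν) where
  bracket Y v := UniversalEnvelopingAlgebra.ι ℂ Y • v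
  add_lie Y Z v := by rw [map_add, add_smul]
  lie_add Y v w := smul_add _ _ _
  leibniz_lie Y Z v := by
    rw [LieHom.map_lie, Ring.lie_def, sub_smul, mul_smul, mul_smul, sub_add_cancel]

theorem verma_lie (ν : Weight n) (Y : so n) (v : Verma ν) :
    ⁅Y, v⁆ = UniversalEnvelopingAlgebra.ι ℂ Y • v := rfl

instance (ν : Weight n) : LieModule ℂ (so n) (Verma ν) where
  smul_lie c Y v := by rw [verma_lie, verma_lie, map_smul, smul_assoc]
  lie_smul c Y v := by
    rw [verma_lie, verma_lie, ← algebraMap_smul (UEA n) c v, ← algebraMap_smul (UEA n) c,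
      ← mul_smul, ← mul_smul, Algebra.commutes]

theorem isHighestWeight_verma (ν : Weight n) :
    IsHighestWeight ν (Submodule.Quotient.mk 1 : Verma ν) where
  mem_wt H := by
    rw [verma_lie, ← Submodule.Quotient.mk_smul, ← Submodule.Quotient.mk_smul,
      Submodule.Quotient.eq]
    refine Submodule.subset_span (Or.inr ⟨H, ?_⟩)
    rw [smul_eq_mul, mul_one, Algebra.algebraMap_eq_smul_one]
  pos_lie Y hY := by
    rw [verma_lie, ← Submodule.Quotient.mk_smul, Submodule.Quotient.mk_eq_zero]
    exact Submodule.subset_span (Or.inl ⟨Y, hY, by rw [smul_eq_mul, mul_one]⟩)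

theorem verma_generated (ν : Weight n) (N : LieSubmodule ℂ (so n) (Verma ν))
    (hN : (Submodule.Quotient.mk 1 : Verma ν) ∈ N) : N = ⊤ := by
  rw [eq_top_iff]
  intro w _
  obtain ⟨z, rfl⟩ := Submodule.Quotient.mk_surjective _ w
  let S : Subalgebra ℂ (UEA n) :=
    { carrier := {z | ∀ v ∈ N, z • v ∈ N}
      mul_mem' := fun {a b} ha hb v hv => by rw [mul_smul]; exact ha _ (hb _ hv)
      add_mem' := fun {a b} ha hb v hv => by rw [add_smul]; exact N.add_mem (ha _ hv) (hb _ hv)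
      algebraMap_mem' := fun c v hv => by rw [algebraMap_smul]; exact N.smul_mem c hv }
  have h := uea_subalgebra_eq_top S (fun Y v hv => N.lie_mem hv) z _ hN
  rwa [← Submodule.Quotient.mk_smul, smul_eq_mul, mul_one] at h

/-- A simple module with a highest weight vector of weight `ν` is isomorphic to `L(ν)`. -/
theorem IsHighestWeight.nonempty_equiv {W : Type*} [AddCommGroup W] [Module ℂ W]
    [LieRingModule (so n) W] [LieModule ℂ (so n) W] [LieModule.IsIrreducible ℂ (so n) W]
    {ν : Weight n} {v : W} (h : IsHighestWeight ν v) (hv : v ≠ 0) :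
    Nonempty (W ≃ₗ⁅ℂ, so n⁆ LMod ν) := by
  let ρ : UEA n →ₐ[ℂ] Module.End ℂ W :=
    UniversalEnvelopingAlgebra.lift ℂ (LieModule.toEnd ℂ (so n) W)
  let _ : Module (UEA n) W := Module.compHom W ρ.toRingHom
  have hsmul : ∀ (z : UEA n) (w : W), z • w = ρ z w := fun z w => rfl
  have hι : ∀ (Y : so n) (w : W), UniversalEnvelopingAlgebra.ι ℂ Y • w = ⁅Y, w⁆ := by
    intro Y w
    rw [hsmul, UniversalEnvelopingAlgebra.lift_ι_apply]; rfl
  have hC : ∀ (c : ℂ) (w : W), algebraMap ℂ (UEA n) c • w = c • w := by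
    intro c w
    rw [hsmul, AlgHom.commutes]; rfl
  let φ : Verma ν →ₗ[UEA n] W := Submodule.liftQ (vermaIdeal ν) (LinearMap.toSpanSingleton (UEA n) W v)
    (by
      rw [vermaIdeal, Submodule.span_le]
      rintro _ (⟨Y, hY, rfl⟩ | ⟨H, rfl⟩)
      · change UniversalEnvelopingAlgebra.ι ℂ Y • v = 0
        rw [hι, h.pos_lie Y hY]
      · change (UniversalEnvelopingAlgebra.ι ℂ (H : so n) - algebraMap ℂ (UEA n) (ν H)) • v = 0
        rw [sub_smul, hι, hC, h.mem_wt H, sub_self])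
  have hφ1 : φ (Submodule.Quotient.mk 1) = v := one_smul (UEA n) v
  let φL : Verma ν →ₗ⁅ℂ, so n⁆ W :=
    { toFun := φ
      map_add' := map_add φ
      map_smul' := fun c x => by
        rw [RingHom.id_apply, ← algebraMap_smul (UEA n) c x, map_smul, hC]
      map_lie' := fun {Y x} => by rw [verma_lie, map_smul, hι] }
  -- Proper submodules lie in the kernel by `le_ker_of_ne_top`, and the kernel is itself proper
  -- because `v ≠ 0`.
  have hJ : sSup {N : Submodule (UEA n) (Verma ν) | N ≠ ⊤} = LinearMap.ker φ := by
    apply le_antisymm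
    · refine sSup_le fun N hN x hx => ?_
      let N' : LieSubmodule ℂ (so n) (Verma ν) :=
        { toSubmodule := N.restrictScalars ℂ
          lie_mem := fun {Y x} hx => N.smul_mem _ hx }
      have hN' : N' ≠ ⊤ := by
        intro e
        refine hN (eq_top_iff.2 fun y _ => ?_)
        exact (e.symm ▸ LieSubmodule.mem_top y : y ∈ N')
      exact le_ker_of_ne_top (isHighestWeight_verma ν) (verma_generated ν) φL
        (show φ _ ≠ 0 by rwa [hφ1]) hN' x hx
    · refine le_sSup fun e => hv ?_
      rw [← hφ1]
      exact (e.symm ▸ Submodule.mem_top : Submodule.Quotient.mk 1 ∈ LinearMap.ker φ)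
  have hsurj : Function.Surjective φ := by
    have htop : φL.range = ⊤ := by
      refine (eq_bot_or_eq_top φL.range).resolve_left fun e => hv ?_
      have : v ∈ φL.range := (LieModuleHom.mem_range φL v).2 ⟨_, hφ1⟩
      rwa [e, LieSubmodule.mem_bot] at this
    intro w
    exact (LieModuleHom.mem_range φL w).1 (htop ▸ LieSubmodule.mem_top w)
  let Ψ : LMod ν →ₗ[UEA n] W := Submodule.liftQ _ φ hJ.le
  have hΨ : Function.Bijective Ψ := by
    constructor
    · rw [← LinearMap.ker_eq_bot]
      exact Submodule.ker_liftQ_eq_bot _ _ _ hJ.ge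
    · intro w
      obtain ⟨x, rfl⟩ := hsurj w
      exact ⟨Submodule.Quotient.mk x, rfl⟩
  let e := Equiv.ofBijective Ψ hΨ
  exact ⟨LieModuleEquiv.symm
    { toFun := Ψ
      map_add' := map_add Ψ
      map_smul' := fun c x => by
        rw [RingHom.id_apply, ← algebraMap_smul (UEA n) c x, map_smul, hC]
      map_lie' := fun {Y x} => (map_smul Ψ (UniversalEnvelopingAlgebra.ι ℂ Y) x).trans (hι Y _)
      invFun := e.symm
      left_inv := e.symm_apply_apply
      right_inv := e.apply_symm_apply }⟩

end verma

/-! ### Differential operators in the variables `U_p` -/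

section indices
variable {n : ℕ}

theorem sum_pos {M : Type*} [AddCommMonoid M] (g : Fin n → M) :
    ∑ i, g i = ∑ j, g (posA j) + (∑ j, g (posB j) + ∑ k, g (posC k)) := by
  let e : Inn n → Fin n := Sum.elim posA (Sum.elim posB posC)
  have he : Function.Bijective e := by
    rw [Fintype.bijective_iff_injective_and_card]
    refine ⟨?_, by simp only [Fintype.card_sum, Fintype.card_fin]; omega⟩
    rintro (i | i | i) (j | j | j) h <;> have hi := i.2 <;> have hj := j.2 <;>
      simp only [e, Sum.elim_inl, Sum.elim_inr, posA, posB, posC, Fin.mk.injEq] at h <;>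
      simp only [Sum.inl.injEq, Sum.inr.injEq, Fin.ext_iff, reduceCtorEq] <;> omega
  rw [← Function.Bijective.sum_comp he g]
  simp only [Fintype.sum_sum_type, e, Sum.elim_inl, Sum.elim_inr]

/-- With `sum_U_mul_U_opp` and `sum_DU_mul_DU_opp` this writes the Euler operator, `2F` and `Δ_1` as
contractions in the isotropic coordinates; afterwards only commutators of `U_p` and `∂_{U_p}`
matter. -/
theorem sum_U_mul_DU : ∑ p : Inn n, U p * DU p = eul n := by
  rw [eul, sum_pos]
  simp only [Fintype.sum_sum_type, ← add_assoc]
  congr 1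
  · rw [← Finset.sum_add_distrib, ← Finset.sum_add_distrib]
    refine Finset.sum_congr rfl fun j _ => ?_
    simp only [U, DU, sub_mul, add_mul, mul_add, mul_sub, smul_mul_assoc, mul_smul_comm, smul_smul,
      smul_add, smul_sub]
    have : 1 / 2 * Complex.I * Complex.I = -(1 / 2) := by
      linear_combination (1 / 2 : ℂ) * Complex.I_mul_I
    rw [this]
    module
  · refine Finset.sum_congr rfl fun j _ => ?_
    simp only [U, DU, smul_mul_smul_comm, mul_inv_cancel₀ sqrt2_ne, one_smul]

theorem sum_U_mul_U_opp : ∑ p : Inn n, U p * U (opp p) = (2 : ℂ) • quad n := by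
  rw [quad, sum_pos]
  simp only [Fintype.sum_sum_type, ← add_assoc, smul_add]
  congr 1
  · rw [← Finset.sum_add_distrib, Finset.smul_sum, Finset.smul_sum, ← Finset.sum_add_distrib]
    refine Finset.sum_congr rfl fun j _ => ?_
    simp only [U, opp, sub_mul, add_mul, mul_add, mul_sub, smul_mul_assoc, mul_smul_comm, smul_smul,
      smul_add, smul_sub, Complex.I_mul_I, x_mul_x (posB j) (posA j)]
    module
  · rw [Finset.smul_sum]
    refine Finset.sum_congr rfl fun j _ => ?_
    simp only [U, opp, smul_mul_smul_comm, sqrt2_mul]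

theorem sum_DU_mul_DU_opp : ∑ p : Inn n, DU p * DU (opp p) = lap n := by
  rw [lap, sum_pos]
  simp only [Fintype.sum_sum_type, ← add_assoc, smul_add]
  congr 1
  · rw [← Finset.sum_add_distrib, Finset.smul_sum, Finset.smul_sum, ← Finset.sum_add_distrib]
    refine Finset.sum_congr rfl fun j _ => ?_
    simp only [DU, opp, sub_mul, add_mul, mul_add, mul_sub, smul_mul_assoc, mul_smul_comm, smul_smul,
      smul_add, smul_sub, dx_mul_dx (posB j) (posA j)]
    have : 1 / 2 * (1 / 2 * (Complex.I * Complex.I)) = -(1 / 4 : ℂ) := by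
      rw [Complex.I_mul_I]; norm_num
    simp only [← mul_assoc] at this ⊢
    have h2 : 1 / 2 * Complex.I * (1 / 2) * Complex.I = -(1 / 4 : ℂ) := by
      linear_combination this
    simp only [this, h2]
    module
  · rw [Finset.smul_sum]
    refine Finset.sum_congr rfl fun j _ => ?_
    have : ((√2 : ℝ) : ℂ)⁻¹ * ((√2 : ℝ) : ℂ)⁻¹ = 1 / 2 := by rw [← mul_inv, sqrt2_mul]; norm_num
    simp only [DU, opp, smul_mul_smul_comm, this]

theorem x_mem_span_U (j : Fin n) : x j ∈ Submodule.span ℂ (Set.range (U (n := n))) := by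
  have h : ∀ p, U p ∈ Submodule.span ℂ (Set.range (U (n := n))) :=
    fun p => Submodule.subset_span ⟨p, rfl⟩
  by_cases h1 : (j : ℕ) < n / 2
  · have e : x j = (1 / 2 : ℂ) • (U (.inl ⟨j, h1⟩) + U (.inr (.inl ⟨j, h1⟩))) := by
      rw [U, U, show posA ⟨j, h1⟩ = j from rfl]; module
    rw [e]; exact Submodule.smul_mem _ _ (add_mem (h _) (h _))
  by_cases h2 : (j : ℕ) < n / 2 + n / 2
  · have h3 : (j : ℕ) - n / 2 < n / 2 := by omega
    have e : x j = (Complex.I / 2) • (U (.inl ⟨_, h3⟩) - U (.inr (.inl ⟨_, h3⟩))) := by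
      have : posB ⟨(j : ℕ) - n / 2, h3⟩ = j := by ext; simp only [posB]; omega
      rw [U, U, this, ← sub_eq_zero]
      have hI : Complex.I / 2 * Complex.I = -(1 / 2) := by
        linear_combination (1 / 2 : ℂ) * Complex.I_mul_I
      simp only [smul_sub, smul_add, smul_smul, hI]
      module
    rw [e]; exact Submodule.smul_mem _ _ (sub_mem (h _) (h _))
  · have h3 : 0 < n % 2 := by have := j.2; omega
    have e : x j = ((√2 : ℝ) : ℂ)⁻¹ • U (.inr (.inr ⟨0, h3⟩)) := by
      have : posC ⟨0, h3⟩ = j := by ext; simp only [posC]; have := j.2; omega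
      rw [U, this, smul_smul, inv_mul_cancel₀ sqrt2_ne, one_smul]
    rw [e]; exact Submodule.smul_mem _ _ (h _)

theorem weyl_subalgebra_eq_top (S : Subalgebra ℂ (Weyl n)) (hx : ∀ j, x j ∈ S)
    (hdx : ∀ j, dx j ∈ S) (a : Weyl n) : a ∈ S := by
  obtain ⟨a, rfl⟩ := RingQuot.mkAlgHom_surjective ℂ (WeylRel n) a
  change weylMk n a ∈ S
  induction a using FreeAlgebra.induction with
  | grade0 c => rw [AlgHom.commutes]; exact S.algebraMap_mem c
  | grade1 i =>
    rcases i with j | j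
    · exact hx j
    · exact hdx j
  | mul a b ha hb => rw [map_mul]; exact S.mul_mem ha hb
  | add a b ha hb => rw [map_add]; exact S.add_mem ha hb

end indices

section action
variable {n : ℕ}

theorem ev_mul (a b : Weyl n) (f : MvPolynomial (Fin n) ℂ) : ev (a * b) f = ev a (ev b f) := by
  rw [map_mul, Module.End.mul_apply]

theorem ev_add (a b : Weyl n) (f : MvPolynomial (Fin n) ℂ) : ev (a + b) f = ev a f + ev b f := by
  rw [map_add, LinearMap.add_apply]

theorem ev_sub (a b : Weyl n) (f : MvPolynomial (Fin n) ℂ) : ev (a - b) f = ev a f - ev b f := by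
  rw [map_sub, LinearMap.sub_apply]

theorem ev_neg (a : Weyl n) (f : MvPolynomial (Fin n) ℂ) : ev (-a) f = -ev a f := by
  rw [map_neg, LinearMap.neg_apply]

theorem ev_smul (c : ℂ) (a : Weyl n) (f : MvPolynomial (Fin n) ℂ) : ev (c • a) f = c • ev a f := by
  rw [map_smul, LinearMap.smul_apply]

theorem ev_sum {ι : Type*} (s : Finset ι) (a : ι → Weyl n) (f : MvPolynomial (Fin n) ℂ) :
    ev (∑ i ∈ s, a i) f = ∑ i ∈ s, ev (a i) f := by
  rw [map_sum, LinearMap.sum_apply]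

theorem ev_one (f : MvPolynomial (Fin n) ℂ) : ev (1 : Weyl n) f = f := by
  rw [map_one, Module.End.one_apply]

theorem ev_algebraMap (c : ℂ) (f : MvPolynomial (Fin n) ℂ) :
    ev (algebraMap ℂ (Weyl n) c) f = c • f := by
  rw [AlgHom.commutes]; rfl

theorem ev_x (j : Fin n) (f : MvPolynomial (Fin n) ℂ) : ev (x j) f = X j * f := by
  rw [ev, weylLift_x]; rfl

theorem ev_dx (j : Fin n) (f : MvPolynomial (Fin n) ℂ) : ev (dx j) f = pderiv j f := by
  rw [ev, weylLift_dx]; rfl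

/-- Turns each commutator in the Weyl algebra into a rewriting rule for its action on polynomials.
-/
theorem ev_comm {a b c : Weyl n} (h : ⁅a, b⁆ = c) (f : MvPolynomial (Fin n) ℂ) :
    ev a (ev b f) = ev b (ev a f) + ev c f := by
  rw [← ev_mul, ← ev_mul, ← ev_add, ← h, Ring.lie_def, add_sub_cancel]

theorem ev_Iop (d : ℂ) (f : MvPolynomial (Fin n) ℂ) : ev (Iop n d) f = ev (eul n) f + d • f := by
  rw [Iop, ev_add, ev_algebraMap]

/-- The variable `U_p` as a polynomial. -/
def UPoly (p : Inn n) : MvPolynomial (Fin n) ℂ := ev (U p) 1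

theorem ev_U (p : Inn n) (f : MvPolynomial (Fin n) ℂ) : ev (U p) f = UPoly p * f := by
  rcases p with j | j | j <;>
    simp only [UPoly, U, ev_add, ev_sub, ev_smul, ev_x, add_mul, sub_mul, smul_mul_assoc, mul_one]

theorem DU_one (p : Inn n) : ev (DU p) 1 = 0 := by
  rcases p with j | j | j <;>
    simp only [DU, ev_add, ev_sub, ev_smul, ev_dx, pderiv_one, smul_zero, add_zero, sub_zero]

theorem UPoly_ne_zero (p : Inn n) : UPoly p ≠ 0 := by
  intro h
  have := ev_comm (DU_lie_U p p) 1
  rw [DU_one, map_zero, zero_add, if_pos rfl, ev_one, ev_U, h, zero_mul, map_zero] at this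
  exact zero_ne_one this

theorem mem_of_U_stable {P : Submodule ℂ (MvPolynomial (Fin n) ℂ)} (h1 : 1 ∈ P)
    (hP : ∀ p, ∀ f ∈ P, ev (U p) f ∈ P) (f : MvPolynomial (Fin n) ℂ) : f ∈ P := by
  have hx : ∀ j, ∀ f ∈ P, X j * f ∈ P := by
    intro j f hf
    rw [← ev_x]
    have hle : Submodule.span ℂ (Set.range (U (n := n))) ≤
        Submodule.comap ((LinearMap.applyₗ f) ∘ₗ (ev (n := n)).toLinearMap) P := by
      rw [Submodule.span_le]
      rintro _ ⟨p, rfl⟩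
      exact hP p f hf
    exact hle (x_mem_span_U j)
  induction f using MvPolynomial.induction_on with
  | C a => rw [← mul_one (C a), ← smul_eq_C_mul]; exact P.smul_mem a h1
  | add f g hf hg => exact P.add_mem hf hg
  | mul_X f j hf => rw [mul_comm]; exact hx j f hf

end action

/-! ### Homogeneous polynomials -/

section degree
variable {n : ℕ}

theorem ev_eul_monomial (a : Fin n →₀ ℕ) (c : ℂ) :
    ev (eul n) (monomial a c) = (a.degree : ℂ) • monomial a c := by
  simp only [eul, ev_sum, ev_mul, ev_x, ev_dx, X_mul_pderiv_monomial]
  rw [← Finset.sum_smul, Nat.cast_smul_eq_nsmul, Finsupp.degree_eq_sum]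

theorem coeff_ev_eul (a : Fin n →₀ ℕ) (f : MvPolynomial (Fin n) ℂ) :
    coeff a (ev (eul n) f) = a.degree * coeff a f := by
  induction f using MvPolynomial.induction_on' with
  | monomial b c =>
    rw [ev_eul_monomial, coeff_smul, coeff_monomial, smul_eq_mul]
    split_ifs with h
    · rw [h]
    · rw [mul_zero, mul_zero]
  | add f g hf hg => rw [map_add, coeff_add, hf, hg, coeff_add, mul_add]

/-- The homogeneous polynomials of degree `c`, as an eigenspace of the Euler operator. -/
def Deg (n : ℕ) (c : ℂ) : Submodule ℂ (MvPolynomial (Fin n) ℂ) :=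
  Module.End.eigenspace (ev (eul n)) c

theorem mem_Deg {c : ℂ} {f : MvPolynomial (Fin n) ℂ} : f ∈ Deg n c ↔ ev (eul n) f = c • f :=
  Module.End.mem_eigenspace_iff

theorem coeff_eq_zero_of_mem_Deg {c : ℂ} {f : MvPolynomial (Fin n) ℂ} (hf : f ∈ Deg n c)
    {a : Fin n →₀ ℕ} (ha : (a.degree : ℂ) ≠ c) : coeff a f = 0 := by
  have h := congrArg (coeff a) (mem_Deg.1 hf)
  rw [coeff_ev_eul, coeff_smul, smul_eq_mul] at h
  have h2 : ((a.degree : ℂ) - c) * coeff a f = 0 := by linear_combination h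
  exact (mul_eq_zero.1 h2).resolve_left (sub_ne_zero.2 ha)

/-- Degrees are complex numbers, so that lowering operators need no truncated subtraction; this
lemma disposes of negative degrees. -/
theorem eq_zero_of_mem_Deg {c : ℂ} {f : MvPolynomial (Fin n) ℂ} (hf : f ∈ Deg n c)
    (hc : ∀ m : ℕ, c ≠ m) : f = 0 := by
  ext a
  rw [coeff_zero]
  exact coeff_eq_zero_of_mem_Deg hf (hc _).symm

theorem mem_Deg_of_lie {a : Weyl n} {k c : ℂ} (ha : ⁅eul n, a⁆ = k • a)
    {f : MvPolynomial (Fin n) ℂ} (hf : f ∈ Deg n c) : ev a f ∈ Deg n (c + k) := by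
  rw [mem_Deg] at hf ⊢
  rw [ev_comm ha, hf, map_smul, ev_smul, add_smul]

theorem ev_U_mem_Deg {c : ℂ} {f : MvPolynomial (Fin n) ℂ} (hf : f ∈ Deg n c) (p : Inn n) :
    ev (U p) f ∈ Deg n (c + 1) :=
  mem_Deg_of_lie (by rw [eul_lie_U, one_smul]) hf

theorem ev_DU_mem_Deg {c : ℂ} {f : MvPolynomial (Fin n) ℂ} (hf : f ∈ Deg n c) (p : Inn n) :
    ev (DU p) f ∈ Deg n (c - 1) := by
  rw [sub_eq_add_neg]
  exact mem_Deg_of_lie (by rw [eul_lie_DU, neg_smul, one_smul]) hf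

theorem ev_lap_mem_Deg {c : ℂ} {f : MvPolynomial (Fin n) ℂ} (hf : f ∈ Deg n c) :
    ev (lap n) f ∈ Deg n (c - 2) := by
  rw [sub_eq_add_neg]
  exact mem_Deg_of_lie eul_lie_lap hf

theorem ev_quad_mem_Deg {c : ℂ} {f : MvPolynomial (Fin n) ℂ} (hf : f ∈ Deg n c) :
    ev (quad n) f ∈ Deg n (c + 2) :=
  mem_Deg_of_lie eul_lie_quad hf

theorem ev_V_mem_Deg {c : ℂ} {f : MvPolynomial (Fin n) ℂ} (hf : f ∈ Deg n c) (d : ℂ) (p : Inn n) :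
    ev (V d p) f ∈ Deg n (c - 1) := by
  rw [sub_eq_add_neg]
  refine mem_Deg_of_lie ?_ hf
  have := Iop_lie_V (n := n) d p
  rwa [Iop, add_lie, algebraMap_lie, add_zero, ← neg_one_smul ℂ (V d p)] at this

theorem ev_lap_pow_mem_Deg {c : ℂ} {f : MvPolynomial (Fin n) ℂ} (hf : f ∈ Deg n c) (k : ℕ) :
    ev (lap n ^ k) f ∈ Deg n (c - 2 * k) := by
  induction k with
  | zero => simpa using hf
  | succ k ih =>
    rw [pow_succ', ev_mul]
    convert ev_lap_mem_Deg ih using 1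
    push_cast; ring_nf

theorem ev_lap_pow_eq_zero {m k : ℕ} (h : m < 2 * k) {f : MvPolynomial (Fin n) ℂ}
    (hf : f ∈ Deg n m) : ev (lap n ^ k) f = 0 := by
  refine eq_zero_of_mem_Deg (ev_lap_pow_mem_Deg hf k) fun j hj => ?_
  have : (m : ℂ) = ((j + 2 * k : ℕ) : ℂ) := by push_cast; linear_combination hj
  have := Nat.cast_injective this
  omega

theorem iSup_Deg : ⨆ m : ℕ, Deg n m = ⊤ := by
  rw [eq_top_iff]
  intro f _
  induction f using MvPolynomial.induction_on' with
  | monomial a c => exact Submodule.mem_iSup_of_mem a.degree (mem_Deg.2 (ev_eul_monomial a c))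
  | add f g hf hg => exact add_mem (hf trivial) (hg trivial)

theorem Deg_le_homogeneousSubmodule (m : ℕ) : Deg n m ≤ homogeneousSubmodule (Fin n) ℂ m := by
  intro f hf
  rw [mem_homogeneousSubmodule]
  intro a ha
  by_contra hne
  refine ha (coeff_eq_zero_of_mem_Deg hf fun h => hne ?_)
  change Finsupp.weight (fun _ => 1) a = m
  rw [← Finsupp.degree_eq_weight_one]
  exact Nat.cast_injective h

instance (m : ℕ) : FiniteDimensional ℂ (Deg n m) := by
  have : FiniteDimensional ℂ (homogeneousSubmodule (Fin n) ℂ m) :=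
    Module.Finite.iff_fg.2 (homogeneousSubmodule_fg (Fin n) ℂ m)
  exact Submodule.finiteDimensional_of_le (Deg_le_homogeneousSubmodule m)

theorem eq_C_of_mem_Deg_zero {f : MvPolynomial (Fin n) ℂ} (hf : f ∈ Deg n 0) :
    f = coeff 0 f • 1 := by
  ext a
  rw [coeff_smul, smul_eq_mul, coeff_one]
  split_ifs with h
  · rw [← h, mul_one]
  · rw [mul_zero]
    refine coeff_eq_zero_of_mem_Deg hf fun e => h ?_
    rw [Nat.cast_eq_zero, Finsupp.degree_eq_zero_iff] at e
    exact e.symm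

theorem one_mem_Deg : (1 : MvPolynomial (Fin n) ℂ) ∈ Deg n 0 := by
  rw [mem_Deg, zero_smul, ← sum_U_mul_DU, ev_sum]
  exact Finset.sum_eq_zero fun p _ => by rw [ev_mul, DU_one, map_zero]

theorem mem_of_sum_mem_of_eul_stable {P : Submodule ℂ (MvPolynomial (Fin n) ℂ)}
    (hP : ∀ f ∈ P, ev (eul n) f ∈ P) {s : Finset ℕ} {f : ℕ → MvPolynomial (Fin n) ℂ}
    (hf : ∀ m : ℕ, f m ∈ Deg n m) (h : ∑ m ∈ s, f m ∈ P) : ∀ m ∈ s, f m ∈ P := by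
  have hχ : Function.Injective fun (k : ℕ) (_ : Unit) => (k : ℂ) := by
    intro k l e
    have := congrFun e ()
    simpa using this
  exact mem_of_sum_eigenvectors_mem (fun (_ : Unit) f => ev (eul n) f) _ hχ P
    (fun _ => ⟨ev (eul n), fun _ => rfl⟩) (fun _ => hP) s f (fun m _ _ => mem_Deg.1 (hf m)) h

/-- A graded subspace that is not contained in `P₀` has a homogeneous element of minimal degree
outside `P₀`. -/
theorem exists_minimal_homogeneous {P P₀ : Submodule ℂ (MvPolynomial (Fin n) ℂ)}
    (hP : ∀ f ∈ P, ev (eul n) f ∈ P) (h : ¬ P ≤ P₀) :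
    ∃ m : ℕ, ∃ f ∈ P, f ∈ Deg n m ∧ f ∉ P₀ ∧ ∀ g ∈ P, g ∈ Deg n ((m : ℂ) - 1) → g ∈ P₀ := by
  classical
  obtain ⟨w, hw, hw0⟩ := SetLike.not_le_iff_exists.1 h
  obtain ⟨s, f, hf, rfl⟩ := exists_finset_sum_of_mem_iSup (fun m : ℕ => Deg n m)
    (iSup_Deg (n := n) ▸ Submodule.mem_top : w ∈ _)
  have hex : ∃ m : ℕ, ∃ f ∈ P, f ∈ Deg n m ∧ f ∉ P₀ := by
    by_contra! hc
    exact hw0 (sum_mem fun m hm => hc m _ (mem_of_sum_mem_of_eul_stable hP hf hw m hm) (hf m))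
  obtain ⟨g, hg, hg', hg0⟩ := Nat.find_spec hex
  refine ⟨Nat.find hex, g, hg, hg', hg0, fun k hk hk' => ?_⟩
  by_contra hk0
  -- For minimal degree zero the condition concerns degree `-1`, where only the zero polynomial
  -- lives.
  rcases Nat.eq_zero_or_pos (Nat.find hex) with h0 | h0
  · refine hk0 ?_
    rw [eq_zero_of_mem_Deg hk' fun m hm => ?_]
    · exact zero_mem _
    · rw [h0] at hm
      have : ((m + 1 : ℕ) : ℂ) = 0 := by push_cast; rw [← hm]; simp
      exact absurd (Nat.cast_eq_zero.1 this) (Nat.succ_ne_zero m)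
  · refine Nat.find_min hex (Nat.sub_lt h0 one_pos) ⟨k, hk, ?_, hk0⟩
    rwa [Nat.cast_pred h0]

/-- Euler's identity: for `c ≠ 0` it recovers a homogeneous polynomial from its derivatives. -/
theorem smul_eq_sum_of_mem_Deg {c : ℂ} {f : MvPolynomial (Fin n) ℂ} (hf : f ∈ Deg n c) :
    c • f = ∑ p, ev (U p) (ev (DU p) f) := by
  rw [← mem_Deg.1 hf, ← sum_U_mul_DU, ev_sum]
  simp only [ev_mul]

end degree

/-! ### The operators of root vectors -/

section rootOperators
variable {n : ℕ}

/-- The operator `U_p ∂_{U_q} - U_{-q} ∂_{U_{-p}}`. -/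
def K (p q : Inn n) : Weyl n := U p * DU q - U (opp q) * DU (opp p)

theorem inc_injective {m e : ℕ} : Function.Injective (inc (m := m) (e := e)) := by
  rintro (i | i | i) (j | j | j) h <;> simp_all [inc]

theorem inc_ne_idx1 {m e : ℕ} (p : Idx m e) : inc p ≠ idx1 := by
  rcases p with j | j | j <;> simp [inc, idx1, Fin.succ_ne_zero]

theorem inc_ne_opp_idx1 {m e : ℕ} (p : Idx m e) : inc p ≠ opp idx1 := by
  rcases p with j | j | j <;> simp [inc, idx1, opp, Fin.succ_ne_zero]

theorem idx1_ne_opp {m e : ℕ} : (idx1 : Idx (m + 1) e) ≠ opp idx1 := by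
  simp [idx1, opp]

theorem E_apply (p q a b : Out n) :
    (E p q).1 a b = (if p = a ∧ q = b then 1 else 0) - if opp q = a ∧ opp p = b then 1 else 0 := by
  simp only [E, Matrix.sub_apply, Matrix.single_apply]

theorem psi_apply (d : ℂ) (Y : so n) : psi d Y = psiLin d Y := rfl

theorem uPart_zero : uPart (fun _ : Inn n => (0 : ℂ)) = 0 := by simp [uPart]

theorem vPart_zero (d : ℂ) : vPart d (fun _ : Inn n => (0 : ℂ)) = 0 := by simp [vPart]

theorem kPart_zero : kPart (fun _ _ : Inn n => (0 : ℂ)) = 0 := by simp [kPart]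

theorem psi_E_inc_idx1 (d : ℂ) (p : Inn n) : psi d (E (inc p) idx1) = U p := by
  rw [psi_apply, psiLin_apply]
  simp only [E_apply, inc_ne_idx1, (inc_ne_idx1 _).symm, inc_ne_opp_idx1, (inc_ne_opp_idx1 _).symm,
    idx1_ne_opp, idx1_ne_opp.symm, opp_inc, false_and, and_false, if_false, sub_zero, zero_smul,
    neg_zero, vPart_zero, kPart_zero, add_zero, zero_add, inc_injective.eq_iff, and_true]
  simp [uPart]

theorem psi_E_idx1_inc (d : ℂ) (p : Inn n) : psi d (E idx1 (inc p)) = V d (opp p) := by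
  rw [psi_apply, psiLin_apply]
  simp only [E_apply, inc_ne_idx1, (inc_ne_idx1 _).symm, inc_ne_opp_idx1, (inc_ne_opp_idx1 _).symm,
    idx1_ne_opp, idx1_ne_opp.symm, opp_inc, false_and, and_false, if_false, sub_zero, zero_smul,
    neg_zero, uPart_zero, kPart_zero, add_zero, zero_add, inc_injective.eq_iff, true_and]
  simp [vPart]

theorem psi_E_inc_inc (d : ℂ) (p q : Inn n) : psi d (E (inc p) (inc q)) = K p q := by
  rw [psi_apply, psiLin_apply]
  simp only [E_apply, inc_ne_idx1, (inc_ne_idx1 _).symm, inc_ne_opp_idx1, (inc_ne_opp_idx1 _).symm,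
    idx1_ne_opp, idx1_ne_opp.symm, opp_inc, false_and, and_false, if_false, sub_zero, zero_smul,
    neg_zero, uPart_zero, vPart_zero, add_zero, zero_add, inc_injective.eq_iff]
  simp only [kPart, sub_smul, Finset.sum_sub_distrib, ite_and, ite_smul, zero_smul, one_smul,
    Finset.sum_ite_irrel, Finset.sum_ite_eq, Finset.mem_univ, if_true, Finset.sum_const_zero, K]

theorem psi_E_idx1_idx1 (d : ℂ) : psi d (E idx1 idx1 : so n) = -Iop n d := by
  rw [psi_apply, psiLin_apply]
  simp only [E_apply, inc_ne_idx1, (inc_ne_idx1 _).symm, inc_ne_opp_idx1, (inc_ne_opp_idx1 _).symm,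
    idx1_ne_opp, idx1_ne_opp.symm, opp_inc, false_and, and_false, if_false, sub_zero, one_smul,
    uPart_zero, vPart_zero, kPart_zero, add_zero, and_self, if_true]

theorem tau_apply (r : ℕ) (Y : so n) : tau n r Y = fourier (psi (dr n r) (theta Y)) := rfl

theorem tau_E_idx1_inc (r : ℕ) (p : Inn n) : tau n r (E idx1 (inc p)) = DU p := by
  rw [tau_apply, theta_E, psi_E_inc_idx1, fourier_U]

theorem fourier_K (p q : Inn n) : fourier (K p q) = K q p := by
  simp only [K, map_sub, fourier_mul, fourier_U, fourier_DU]

theorem tau_E_inc_inc (r : ℕ) (p q : Inn n) : tau n r (E (inc p) (inc q)) = K p q := by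
  rw [tau_apply, theta_E, psi_E_inc_inc, fourier_K]

theorem fourier_eul : fourier (eul n) = eul n := by
  simp only [eul, map_sum, fourier_mul, fourier_x, fourier_dx, smul_mul_smul_comm]
  refine Finset.sum_congr rfl fun i _ => ?_
  rw [show 2 * sgn i * (sgn i / 2) = (1 : ℂ) by linear_combination sgn_mul_sgn i, one_smul]

theorem fourier_algebraMap (c : ℂ) : fourier (algebraMap ℂ (Weyl n) c) = algebraMap ℂ (Weyl n) c := by
  rw [Algebra.algebraMap_eq_smul_one, map_smul, fourier_one]

theorem fourier_Iop (d : ℂ) : fourier (Iop n d) = Iop n d := by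
  rw [Iop, map_add, fourier_eul, fourier_algebraMap]

theorem tau_E_idx1_idx1 (r : ℕ) : tau n r (E idx1 idx1) = -Iop n (dr n r) := by
  rw [tau_apply, theta_E, psi_E_idx1_idx1, map_neg, fourier_Iop]

theorem psi_cartan (d : ℂ) (H : cartan n) : psi d (H : so n) =
    -((H : so n).1 idx1 idx1 • Iop n d) + ∑ p : Inn n, (H : so n).1 (inc p) (inc p) • (U p * DU p) := by
  rw [psi_apply, psiLin_apply]
  have h1 : ∀ p : Inn n, (H : so n).1 (inc p) idx1 = 0 := fun p => H.2 _ _ (inc_ne_idx1 p)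
  have h2 : ∀ p : Inn n, (H : so n).1 idx1 (inc p) = 0 := fun p => H.2 _ _ (inc_ne_idx1 p).symm
  simp only [h1, h2, uPart_zero, vPart_zero, add_zero, kPart]
  congr 1
  refine Finset.sum_congr rfl fun p _ => Finset.sum_eq_single p (fun q _ hq => ?_) (by simp)
  rw [H.2 _ _ fun e => hq (inc_injective e).symm, zero_smul]

/-- `ϑ` fixes the Cartan subalgebra and the Fourier transform fixes `E_1` and each `U_p ∂_{U_p}`;
hence both actions on polynomials have the same weight spaces. -/
theorem tau_cartan (r : ℕ) (H : cartan n) : tau n r (H : so n) = psi (dr n r) (H : so n) := by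
  rw [tau_apply, theta_cartan, psi_cartan]
  simp only [map_add, map_neg, map_smul, map_sum, fourier_Iop, fourier_mul, fourier_U, fourier_DU]

theorem one_mem_wt_PolyR (r : ℕ) : (1 : MvPolynomial (Fin n) ℂ) ∈ wt n (PolyR n r) (lam n r) := by
  intro H
  change ev (psi (dr n r) (H : so n)) 1 = lam n r H • (1 : MvPolynomial (Fin n) ℂ)
  rw [psi_cartan, ev_add, ev_neg, ev_smul, ev_Iop, ev_sum,
    Finset.sum_eq_zero fun p _ => by rw [ev_smul, ev_mul, DU_one, map_zero, smul_zero],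
    mem_Deg.1 one_mem_Deg, zero_smul, zero_add, add_zero, smul_smul, ← neg_smul]
  congr 1
  simp only [lam, LinearMap.smul_apply, LinearMap.neg_apply, eps_apply, smul_eq_mul]
  ring

/-- The sum of the weight spaces is a submodule and contains 1, and root vectors act as
multiplication by the `U_p`, which generate all polynomials from 1. -/
theorem iSup_wt_PolyR (r : ℕ) : ⨆ ν : Weight n, wt n (PolyR n r) ν = ⊤ := by
  rw [eq_top_iff]
  intro f _
  refine mem_of_U_stable (P := (weightPart n (PolyR n r)).toSubmodule) ?_ ?_ f
  · exact Submodule.mem_iSup_of_mem (p := fun ν => wt n (PolyR n r) ν) _ (one_mem_wt_PolyR r)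
  · intro p f hf
    rw [← psi_E_inc_idx1 (dr n r) p]
    exact (weightPart n (PolyR n r)).lie_mem hf

theorem mem_wt_PolyM_iff (r : ℕ) (ν : Weight n) (f : MvPolynomial (Fin n) ℂ) :
    f ∈ wt n (PolyM n r) ν ↔ f ∈ wt n (PolyR n r) ν := by
  refine forall_congr' fun H => ?_
  change ev (tau n r (H : so n)) f = ν H • f ↔ ev (psi (dr n r) (H : so n)) f = ν H • f
  rw [tau_cartan]

theorem iSup_wt_PolyM (r : ℕ) : ⨆ ν : Weight n, wt n (PolyM n r) ν = ⊤ := by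
  have : ∀ ν, wt n (PolyM n r) ν = wt n (PolyR n r) ν :=
    fun ν => Submodule.ext (mem_wt_PolyM_iff r ν)
  refine Eq.trans ?_ (iSup_wt_PolyR r)
  exact iSup_congr this

end rootOperators

/-! ### The contravariant pairing of polynomials -/

section pairing
variable {n : ℕ}

/-- The value of the contravariant form at a monomial. -/
def monomialNorm (a : Fin n →₀ ℕ) : ℂ := ∏ j, ((sgn j / 2) ^ a j * ((a j).factorial : ℂ))

theorem sgn_ne_zero (j : Fin n) : sgn j ≠ 0 := by
  intro h
  have := sgn_mul_sgn j
  rw [h, zero_mul] at this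
  exact zero_ne_one this

theorem monomialNorm_ne_zero (a : Fin n →₀ ℕ) : monomialNorm a ≠ 0 :=
  Finset.prod_ne_zero_iff.2 fun j _ => mul_ne_zero
    (pow_ne_zero _ (div_ne_zero (sgn_ne_zero j) two_ne_zero))
    (Nat.cast_ne_zero.2 (Nat.factorial_ne_zero _))

theorem monomialNorm_add_single (a : Fin n →₀ ℕ) (j : Fin n) :
    monomialNorm (a + Finsupp.single j 1) = monomialNorm a * (sgn j / 2 * (a j + 1)) := by
  have h : sgn j / 2 * ((a j : ℂ) + 1) = ∏ i, if i = j then sgn i / 2 * ((a i : ℂ) + 1) else 1 := by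
    rw [Finset.prod_ite_eq' Finset.univ j, if_pos (Finset.mem_univ j)]
  rw [h, monomialNorm, monomialNorm, ← Finset.prod_mul_distrib]
  refine Finset.prod_congr rfl fun i _ => ?_
  by_cases e : i = j
  · subst e
    rw [if_pos rfl, Finsupp.add_apply, Finsupp.single_eq_same, Nat.factorial_succ, pow_succ]
    push_cast; ring
  · rw [if_neg e, Finsupp.add_apply, Finsupp.single_eq_of_ne e, add_zero, mul_one]

/-- The contravariant form on polynomials, `⟨f, g⟩ = (𝓕(f) g)(0)`. -/
def polyForm (n : ℕ) : MvPolynomial (Fin n) ℂ →ₗ[ℂ] MvPolynomial (Fin n) ℂ →ₗ[ℂ] ℂ :=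
  (basisMonomials (Fin n) ℂ).constr ℂ fun a => monomialNorm a • lcoeff ℂ a

theorem polyForm_monomial (a : Fin n →₀ ℕ) (c : ℂ) (g : MvPolynomial (Fin n) ℂ) :
    polyForm n (monomial a c) g = c * (monomialNorm a * coeff a g) := by
  have h : monomial a c = c • basisMonomials (Fin n) ℂ a := by
    rw [coe_basisMonomials, smul_monomial, smul_eq_mul, mul_one]
  rw [h, polyForm, map_smul, Module.Basis.constr_basis]
  rfl

theorem polyForm_comm (f g : MvPolynomial (Fin n) ℂ) : polyForm n f g = polyForm n g f := by
  induction f using MvPolynomial.induction_on' with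
  | add f f' hf hf' => rw [map_add, LinearMap.add_apply, hf, hf', map_add]
  | monomial a c =>
    induction g using MvPolynomial.induction_on' with
    | add g g' hg hg' => rw [map_add, hg, hg', map_add, LinearMap.add_apply]
    | monomial b c' =>
      rw [polyForm_monomial, polyForm_monomial, coeff_monomial, coeff_monomial]
      by_cases h : a = b
      · subst h; simp only [if_true]; ring
      · rw [if_neg h, if_neg (Ne.symm h)]; ring

theorem polyForm_x (j : Fin n) (f g : MvPolynomial (Fin n) ℂ) :
    polyForm n (ev (x j) f) g = sgn j / 2 * polyForm n f (ev (dx j) g) := by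
  rw [ev_x, ev_dx]
  induction f using MvPolynomial.induction_on' with
  | add f f' hf hf' => rw [mul_add, map_add, LinearMap.add_apply, hf, hf', map_add,
      LinearMap.add_apply, mul_add]
  | monomial a c =>
    rw [X, monomial_mul, one_mul, polyForm_monomial, polyForm_monomial, coeff_pderiv, add_comm,
      monomialNorm_add_single]
    ring

/-- The operators with this adjunction form a subalgebra, so the generators suffice: `X_j` by the
recursion for the norms of monomials, and `∂_j` from `X_j` by symmetry of the form and `sgn² = 1`.
-/
theorem polyForm_ev (a : Weyl n) (f g : MvPolynomial (Fin n) ℂ) :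
    polyForm n (ev a f) g = polyForm n f (ev (fourier a) g) := by
  let S : Subalgebra ℂ (Weyl n) :=
    { carrier := {a | ∀ f g, polyForm n (ev a f) g = polyForm n f (ev (fourier a) g)}
      mul_mem' := fun {a b} ha hb f g => by rw [ev_mul, ha, hb, fourier_mul, ev_mul]
      add_mem' := fun {a b} ha hb f g => by
        rw [ev_add, map_add, LinearMap.add_apply, ha, hb, map_add, ev_add, map_add]
      algebraMap_mem' := fun c f g => by
        rw [fourier_algebraMap, ev_algebraMap, ev_algebraMap, map_smul, map_smul,
          LinearMap.smul_apply] }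
  refine weyl_subalgebra_eq_top S (fun j f g => ?_) (fun j f g => ?_) a f g
  · rw [polyForm_x, fourier_x, ev_smul, map_smul, smul_eq_mul]
  · rw [fourier_dx, ev_smul, map_smul, polyForm_comm f, polyForm_x, polyForm_comm g, smul_eq_mul]
    linear_combination (-polyForm n (ev (dx j) f) g) * sgn_mul_sgn j

/-- `φ` is supported in a single degree, hence on finitely many monomials; these are orthogonal with
nonzero norms, so `φ` divided by the norms gives the coefficients of a representative. -/
theorem exists_polyForm_eq (φ : MvPolynomial (Fin n) ℂ →ₗ[ℂ] ℂ) (c : ℂ)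
    (hφ : ∀ f, φ (ev (eul n) f) = c * φ f) : ∃ g, ∀ f, polyForm n f g = φ f := by
  classical
  have h0 : ∀ a : Fin n →₀ ℕ, (a.degree : ℂ) ≠ c → φ (monomial a 1) = 0 := by
    intro a ha
    have h := hφ (monomial a 1)
    rw [ev_eul_monomial, map_smul, smul_eq_mul] at h
    have h2 : ((a.degree : ℂ) - c) * φ (monomial a 1) = 0 := by linear_combination h
    exact (mul_eq_zero.1 h2).resolve_left (sub_ne_zero.2 ha)
  have hfin : {a : Fin n →₀ ℕ | (a.degree : ℂ) = c}.Finite := by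
    by_cases hc : ∃ m : ℕ, c = m
    · obtain ⟨m, rfl⟩ := hc
      refine (Finsupp.finite_of_degree_le m).subset fun a ha => ?_
      exact (Nat.cast_injective ha).le
    · refine Set.Finite.subset Set.finite_empty fun a ha => hc ⟨a.degree, ?_⟩
      exact (show (a.degree : ℂ) = c from ha).symm
  refine ⟨∑ a ∈ hfin.toFinset, monomial a (φ (monomial a 1) / monomialNorm a), fun f => ?_⟩
  induction f using MvPolynomial.induction_on' with
  | add f f' hf hf' => rw [map_add, LinearMap.add_apply, hf, hf', map_add]
  | monomial a t =>
    have e : monomial a t = t • monomial a (1 : ℂ) := by rw [smul_monomial, smul_eq_mul, mul_one]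
    rw [polyForm_monomial, coeff_sum]
    simp only [coeff_monomial, Finset.sum_ite_eq', Set.Finite.mem_toFinset, Set.mem_ofPred_eq]
    rw [e, map_smul, smul_eq_mul]
    split_ifs with h
    · rw [mul_div_cancel₀ _ (monomialNorm_ne_zero a)]
    · rw [h0 a h, mul_zero]

/-- `E_{11}` acts by `-(E_1 + d)`, so a weight determines a degree; this makes weight forms
representable. -/
theorem isWeightForm_eul {r : ℕ} {ν : Weight n} {φ : MvPolynomial (Fin n) ℂ →ₗ[ℂ] ℂ}
    (hφ : IsWeightForm (W := PolyR n r) ν φ) :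
    ∃ c, ∀ f, φ (ev (eul n) f) = c * φ f := by
  refine ⟨-ν ⟨E idx1 idx1, E_self_mem_cartan _⟩ - dr n r, fun f => ?_⟩
  have h : φ (ev (psi (dr n r) (E idx1 idx1 : so n)) f) = _ :=
    hφ ⟨E idx1 idx1, E_self_mem_cartan _⟩ f
  rw [psi_E_idx1_idx1] at h
  have h2 : ev (-Iop n (dr n r)) f = -(ev (eul n) f + dr n r • f) := by rw [ev_neg, ev_Iop]
  rw [h2, map_neg] at h
  have h3 : φ (ev (eul n) f + dr n r • f) = φ (ev (eul n) f) + dr n r * φ f := by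
    rw [map_add φ, map_smul φ, smul_eq_mul]
  rw [h3] at h
  linear_combination -h

/-- The contravariant pairing of the modules `PolyR n r` and `PolyM n r`. -/
def polyPairing (n r : ℕ) : PolyR n r →ₗ[ℂ] PolyM n r →ₗ[ℂ] ℂ := polyForm n

theorem isDualPair_polyPairing (r : ℕ) : IsDualPair (n := n) (polyPairing n r) where
  contra Y f g := polyForm_ev _ f g
  weightL := iSup_wt_PolyR r
  weightR := iSup_wt_PolyM r
  reprL ν φ hφ := by
    obtain ⟨c, hc⟩ := isWeightForm_eul hφ
    exact exists_polyForm_eq φ c hc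
  reprR ν φ hφ := by
    have hφ' : IsWeightForm (W := PolyR n r) ν φ := by
      intro H f
      have : φ (ev (tau n r (H : so n)) f) = ν H * φ f := hφ H f
      rw [tau_cartan] at this
      exact this
    obtain ⟨c, hc⟩ := isWeightForm_eul hφ'
    obtain ⟨g, hg⟩ := exists_polyForm_eq φ c hc
    exact ⟨g, fun f => (polyForm_comm _ _).trans (hg f)⟩

theorem mem_idealF {r : ℕ} {f : MvPolynomial (Fin n) ℂ} :
    f ∈ idealF n r ↔ ∃ g, ev (quad n ^ r) g = f := by
  change f ∈ Ideal.span {quadPoly n ^ r} ↔ _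
  rw [Ideal.mem_span_singleton']
  refine exists_congr fun g => ?_
  rw [ev_quad_pow, mul_comm]

theorem fourier_quad_pow (r : ℕ) : fourier (quad n ^ r) = (1 / 2 : ℂ) ^ r • lap n ^ r := by
  rw [fourier_pow, fourier_quad, smul_pow]

/-- Multiplication by `F^r` is adjoint to `2^{-r} Δ_1^r`, and the form is nondegenerate. -/
theorem perp_idealF (r : ℕ) : (isDualPair_polyPairing (n := n) r).perp (idealF n r) = MMod n r := by
  have h0 : (1 / 2 : ℂ) ^ r ≠ 0 := pow_ne_zero r (one_div_ne_zero two_ne_zero)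
  have hadj : ∀ f g, polyForm n (ev (quad n ^ r) f) g =
      (1 / 2 : ℂ) ^ r * polyForm n f ((laplacian n ^ r) g) := by
    intro f g
    rw [polyForm_ev, fourier_quad_pow, ev_smul, map_smul, map_pow, ev_lap, smul_eq_mul]
  ext g
  constructor
  · intro hg
    refine (isDualPair_polyPairing (n := n) r).eq_zero_of_forall_right fun f => ?_
    have h := hg _ (mem_idealF.2 ⟨f, rfl⟩)
    exact (mul_eq_zero.1 ((hadj f g).symm.trans h)).resolve_left h0
  · intro hg f hf
    obtain ⟨f, rfl⟩ := mem_idealF.1 hf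
    refine (hadj f g).trans ?_
    rw [show (laplacian n ^ r) g = 0 from hg, map_zero, mul_zero]

theorem exists_isDualPair_RMod (n r : ℕ) : ∃ B : RMod n r →ₗ[ℂ] MMod n r →ₗ[ℂ] ℂ,
    IsDualPair (n := n) B ∧
      ∀ f g, B (LieSubmodule.Quotient.mk' (idealF n r) f) g = polyForm n f g.1 := by
  rw [← perp_idealF]
  exact (isDualPair_polyPairing r).exists_quotient_perp (idealF n r)

end pairing

/-! ### Contractions and commutators -/

section contractions
variable {n : ℕ}

theorem ev_V_of_mem_Deg {c d : ℂ} {f : MvPolynomial (Fin n) ℂ} (hf : f ∈ Deg n c) (p : Inn n) :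
    ev (V d p) f = (1 / 2 : ℂ) • ev (U p) (ev (lap n) f) - (c - 1 + d) • ev (DU (opp p)) f := by
  rw [V, ev_sub, ev_smul, ev_mul, ev_mul, ev_Iop, mem_Deg.1 (ev_DU_mem_Deg hf (opp p)), ← add_smul]

/-- First of the two invariant contractions of the vector `(V_p f)_p`; it detects the degrees in
which singular vectors can occur. -/
theorem sum_ev_U_V {c d : ℂ} {f : MvPolynomial (Fin n) ℂ} (hf : f ∈ Deg n c) :
    ∑ p, ev (U (opp p)) (ev (V d p) f) =
      ev (quad n) (ev (lap n) f) - (c * (c - 1 + d)) • f := by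
  have h1 : ∑ p : Inn n, ev (U (opp p)) (ev (U p) (ev (lap n) f)) =
      (2 : ℂ) • ev (quad n) (ev (lap n) f) := by
    rw [← ev_smul, ← sum_U_mul_U_opp, ev_sum, ← sum_opp_index]
    simp only [opp_opp, ev_mul]
  have h2 : ∑ p : Inn n, ev (U (opp p)) (ev (DU (opp p)) f) = c • f := by
    rw [smul_eq_sum_of_mem_Deg hf]
    exact sum_opp_index fun p => ev (U p) (ev (DU p) f)
  simp only [ev_V_of_mem_Deg hf, map_sub, map_smul, Finset.sum_sub_distrib, ← Finset.smul_sum, h1,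
    h2]
  module

theorem sum_ev_DU_U (f : MvPolynomial (Fin n) ℂ) :
    ∑ p : Inn n, ev (DU p) (ev (U p) f) = ev (eul n) f + (n : ℂ) • f := by
  have h : ∀ p : Inn n, ev (DU p) (ev (U p) f) = ev (U p) (ev (DU p) f) + f := by
    intro p
    rw [ev_comm (DU_lie_U p p), if_pos rfl, ev_one]
  have hc : Fintype.card (Inn n) = n := by
    simp only [Fintype.card_sum, Fintype.card_fin]; omega
  simp only [h, Finset.sum_add_distrib, Finset.sum_const, Finset.card_univ, hc, ← sum_U_mul_DU,
    ev_sum, ev_mul, Nat.cast_smul_eq_nsmul]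

/-- Second contraction: for `d = n/2 - r` the terms in `n` cancel, and the factor vanishes only in
degree `2r`. -/
theorem sum_ev_DU_V {c : ℂ} {r : ℕ} {f : MvPolynomial (Fin n) ℂ} (hf : f ∈ Deg n c) :
    ∑ p, ev (DU p) (ev (V (dr n r) p) f) = (r - c / 2) • ev (lap n) f := by
  have h2 : ∑ p : Inn n, ev (DU p) (ev (DU (opp p)) f) = ev (lap n) f := by
    simp only [← sum_DU_mul_DU_opp, ev_sum, ev_mul]
  simp only [ev_V_of_mem_Deg hf, map_sub, map_smul, Finset.sum_sub_distrib, ← Finset.smul_sum, h2,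
    sum_ev_DU_U, mem_Deg.1 (ev_lap_mem_Deg hf), dr]
  module

theorem ev_lap_U (p : Inn n) (f : MvPolynomial (Fin n) ℂ) :
    ev (lap n) (ev (U p) f) = ev (U p) (ev (lap n) f) + (2 : ℂ) • ev (DU (opp p)) f := by
  rw [ev_comm (lap_lie_U p), ev_smul]

theorem ev_lap_DU (p : Inn n) (f : MvPolynomial (Fin n) ℂ) :
    ev (lap n) (ev (DU p) f) = ev (DU p) (ev (lap n) f) := by
  rw [ev_comm (lap_lie_DU p), map_zero, LinearMap.zero_apply, add_zero]

theorem ev_lap_pow_succ (k : ℕ) (f : MvPolynomial (Fin n) ℂ) :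
    ev (lap n ^ (k + 1)) f = ev (lap n) (ev (lap n ^ k) f) := by
  rw [pow_succ', ev_mul]

theorem ev_lap_pow_succ' (k : ℕ) (f : MvPolynomial (Fin n) ℂ) :
    ev (lap n ^ (k + 1)) f = ev (lap n ^ k) (ev (lap n) f) := by
  rw [pow_succ, ev_mul]

theorem ev_quad_pow_succ (k : ℕ) (f : MvPolynomial (Fin n) ℂ) :
    ev (quad n ^ (k + 1)) f = ev (quad n) (ev (quad n ^ k) f) := by
  rw [pow_succ', ev_mul]

theorem ev_lap_pow_DU (p : Inn n) (k : ℕ) (f : MvPolynomial (Fin n) ℂ) :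
    ev (lap n ^ k) (ev (DU p) f) = ev (DU p) (ev (lap n ^ k) f) := by
  induction k with
  | zero => simp only [pow_zero, ev_one]
  | succ k ih => rw [ev_lap_pow_succ, ih, ev_lap_DU, ev_lap_pow_succ]

theorem ev_lap_pow_U (p : Inn n) (k : ℕ) (f : MvPolynomial (Fin n) ℂ) :
    ev (lap n ^ (k + 1)) (ev (U p) f) = ev (U p) (ev (lap n ^ (k + 1)) f) +
      (2 * (k + 1) : ℂ) • ev (DU (opp p)) (ev (lap n ^ k) f) := by
  induction k with
  | zero => simp only [zero_add, pow_one, pow_zero, ev_one, ev_lap_U, Nat.cast_zero]; norm_num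
  | succ k ih =>
    rw [ev_lap_pow_succ (k + 1), ih, map_add, map_smul, ev_lap_U, ev_lap_DU, ← ev_lap_pow_succ,
      ← ev_lap_pow_succ]
    push_cast
    module

theorem ev_lap_quad {c : ℂ} {f : MvPolynomial (Fin n) ℂ} (hf : f ∈ Deg n c) :
    ev (lap n) (ev (quad n) f) = ev (quad n) (ev (lap n) f) + (2 * c + n) • f := by
  rw [ev_comm lap_lie_quad, ev_add, ev_smul, ev_algebraMap, mem_Deg.1 hf, smul_smul, ← add_smul]

theorem ev_quad_pow_mem_Deg {c : ℂ} {f : MvPolynomial (Fin n) ℂ} (hf : f ∈ Deg n c) (k : ℕ) :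
    ev (quad n ^ k) f ∈ Deg n (c + 2 * k) := by
  induction k with
  | zero => simpa using hf
  | succ k ih =>
    rw [ev_quad_pow_succ]
    convert ev_quad_mem_Deg ih using 1
    push_cast; ring_nf

/-- The additional factor `F` on the left avoids the power `F^{k-1}` that the commutator of `Δ_1`
and `F^k` would contain. -/
theorem ev_quad_lap_quad_pow {c : ℂ} {f : MvPolynomial (Fin n) ℂ} (hf : f ∈ Deg n c) (k : ℕ) :
    ev (quad n) (ev (lap n) (ev (quad n ^ k) f)) = ev (quad n ^ (k + 1)) (ev (lap n) f) +
      (k * (2 * c + 2 * k - 2 + n) : ℂ) • ev (quad n ^ k) f := by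
  induction k with
  | zero => simp only [zero_add, pow_one, pow_zero, ev_one, Nat.cast_zero, zero_mul, zero_smul,
      add_zero]
  | succ k ih =>
    rw [ev_quad_pow_succ, ev_lap_quad (ev_quad_pow_mem_Deg hf k), ih, map_add, map_add, map_smul,
      map_smul, ev_quad_pow_succ (k + 1)]
    push_cast
    module

theorem ev_lap_pow_quad {c : ℂ} {f : MvPolynomial (Fin n) ℂ} (hf : f ∈ Deg n c) (k : ℕ) :
    ev (lap n ^ (k + 1)) (ev (quad n) f) = ev (quad n) (ev (lap n ^ (k + 1)) f) +
      ((k + 1) * (2 * c - 2 * k + n) : ℂ) • ev (lap n ^ k) f := by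
  induction k with
  | zero => simp only [zero_add, pow_one, pow_zero, ev_one, ev_lap_quad hf, Nat.cast_zero]; norm_num
  | succ k ih =>
    rw [ev_lap_pow_succ (k + 1), ih, map_add, map_smul, ev_lap_quad (ev_lap_pow_mem_Deg hf (k + 1)),
      ← ev_lap_pow_succ, ← ev_lap_pow_succ]
    push_cast
    module

theorem ev_quad_pow_injective (hn : n ≠ 0) (k : ℕ) : Function.Injective (ev (quad n ^ k)) := by
  have h0 : quadPoly n ≠ 0 := by
    -- `F ≠ 0` because `Δ_1 F = n`.
    intro h
    have h1 := ev_lap_quad (one_mem_Deg (n := n))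
    have h2 : ev (lap n) 1 = 0 := by
      rw [← sum_DU_mul_DU_opp, ev_sum]
      exact Finset.sum_eq_zero fun p _ => by rw [ev_mul, DU_one, map_zero]
    rw [ev_quad, h, zero_mul, map_zero, h2, map_zero, zero_add, mul_zero, zero_add] at h1
    exact (smul_ne_zero (Nat.cast_ne_zero.2 hn) one_ne_zero) h1.symm
  intro f g h
  rw [ev_quad_pow, ev_quad_pow] at h
  exact mul_left_cancel₀ (pow_ne_zero k h0) h

end contractions

/-! ### Singular vectors modulo `F^r` -/

section singular
variable {n : ℕ}

/-- The multiples of `F^r`. -/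
def quadIdeal (n r : ℕ) : Submodule ℂ (MvPolynomial (Fin n) ℂ) := LinearMap.range (ev (quad n ^ r))

theorem mem_idealF_iff {r : ℕ} {f : MvPolynomial (Fin n) ℂ} :
    f ∈ idealF n r ↔ f ∈ quadIdeal n r := mem_idealF

theorem ev_U_mem_quadIdeal {r : ℕ} {f : MvPolynomial (Fin n) ℂ} (hf : f ∈ quadIdeal n r)
    (p : Inn n) : ev (U p) f ∈ quadIdeal n r := by
  obtain ⟨g, rfl⟩ := hf
  refine ⟨ev (U p) g, ?_⟩
  simp only [ev_quad_pow, ev_U]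
  ring

/-- A derivative costs one power of `F`, which the factor in front restores. -/
theorem ev_quad_DU_mem_quadIdeal {r : ℕ} {f : MvPolynomial (Fin n) ℂ} (hf : f ∈ quadIdeal n r)
    (p : Inn n) : ev (quad n) (ev (DU p) f) ∈ quadIdeal n r := by
  obtain ⟨g, rfl⟩ := hf
  have key : ∀ k : ℕ, ev (quad n) (ev (DU p) (ev (quad n ^ k) g)) =
      ev (quad n ^ k) (ev (quad n) (ev (DU p) g) + (k : ℂ) • ev (U (opp p)) g) := by
    intro k
    induction k with
    | zero => simp only [pow_zero, ev_one, Nat.cast_zero, zero_smul, add_zero]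
    | succ k ih =>
      rw [ev_quad_pow_succ, ev_comm (DU_lie_quad p), map_add, ih, ev_quad_pow_succ, ← map_add]
      congr 1
      simp only [map_add, map_smul, ev_quad_pow, ev_quad, ev_U, Nat.cast_succ, add_smul, one_smul,
        mul_add]
      simp only [mul_left_comm, add_assoc]
  exact ⟨_, (key r).symm⟩

theorem quadIdeal_antitone {k r : ℕ} (h : k ≤ r) : quadIdeal n r ≤ quadIdeal n k := by
  rintro _ ⟨g, rfl⟩
  obtain ⟨j, rfl⟩ := Nat.exists_eq_add_of_le h
  exact ⟨ev (quad n ^ j) g, by rw [pow_add, ev_mul]⟩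

theorem mem_Deg_of_ev_quad_pow (hn : n ≠ 0) {c : ℂ} {k : ℕ} {g : MvPolynomial (Fin n) ℂ}
    (h : ev (quad n ^ k) g ∈ Deg n c) : g ∈ Deg n (c - 2 * k) := by
  have key : ev (eul n) (ev (quad n ^ k) g) =
      ev (quad n ^ k) (ev (eul n) g + (2 * k : ℂ) • g) := by
    clear h
    induction k with
    | zero => simp only [pow_zero, ev_one, Nat.cast_zero, mul_zero, zero_smul, add_zero]
    | succ k ih =>
      rw [ev_quad_pow_succ, ev_comm eul_lie_quad, ih, ev_quad_pow_succ, ev_smul, ← map_smul,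
        ← map_add, ← map_smul, ← map_add]
      congr 2
      push_cast
      module
  rw [mem_Deg] at h ⊢
  rw [key, ← map_smul] at h
  have := ev_quad_pow_injective hn k h
  rw [sub_smul, ← this, add_sub_cancel_right]

theorem eq_zero_of_mem_quadIdeal (hn : n ≠ 0) {j r : ℕ} (hj : j < 2 * r)
    {f : MvPolynomial (Fin n) ℂ} (hf : f ∈ Deg n j) (hfr : f ∈ quadIdeal n r) : f = 0 := by
  obtain ⟨g, rfl⟩ := hfr
  rw [eq_zero_of_mem_Deg (mem_Deg_of_ev_quad_pow hn hf) fun m hm => ?_, map_zero]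
  have : (j : ℂ) = ((m + 2 * r : ℕ) : ℂ) := by push_cast; linear_combination hm
  have := Nat.cast_injective this
  omega

/-- Modulo `F^r` both contractions of `V_p f` vanish, the second after multiplication by `F`.
Outside degree `2r` the second puts `F Δ_1 f` into `F^r A`, and then the first makes `m (m - 1 + d)
f` a multiple of `F^r`. -/
theorem quad_lap_mem_of_singular (hn : 3 ≤ n) {m r : ℕ} {f : MvPolynomial (Fin n) ℂ}
    (hf : f ∈ Deg n m) (hV : ∀ p, ev (V (dr n r) p) f ∈ quadIdeal n r) (hfr : f ∉ quadIdeal n r) :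
    ev (quad n) (ev (lap n) f) ∈ quadIdeal n r ∧ (m : ℂ) * (m - 1 + dr n r) = 0 := by
  have h1 : ev (quad n) (ev (lap n) f) - ((m : ℂ) * (m - 1 + dr n r)) • f ∈ quadIdeal n r := by
    rw [← sum_ev_U_V hf]
    exact sum_mem fun p _ => ev_U_mem_quadIdeal (hV p) _
  have h2 : ((r : ℂ) - m / 2) • ev (quad n) (ev (lap n) f) ∈ quadIdeal n r := by
    rw [← map_smul, ← sum_ev_DU_V hf, map_sum]
    exact sum_mem fun p _ => ev_quad_DU_mem_quadIdeal (hV p) p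
  have hm : (r : ℂ) - m / 2 ≠ 0 := by
    intro h0
    have hmr : (m : ℂ) = 2 * r := by linear_combination -2 * h0
    refine hfr ?_
    -- In degree `2r` the second contraction is void. Writing `f = F^k g` in the first one gives `(r
    -- - k)(2 (r - k) + n - 2) f ∈ F^{k+1} A`, with nonzero factor for `k < r`, so `f` climbs up to
    -- `F^r A`.
    have key : ∀ k ≤ r, f ∈ quadIdeal n k := by
      intro k
      induction k with
      | zero => intro _; exact ⟨f, by rw [pow_zero, ev_one]⟩
      | succ k ih =>
        intro hk
        obtain ⟨g, rfl⟩ := ih (by omega)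
        have hg := mem_Deg_of_ev_quad_pow (by omega) hf
        rw [ev_quad_lap_quad_pow hg k] at h1
        have h3 := (quadIdeal n (k + 1)).sub_mem
          (show ev (quad n ^ (k + 1)) (ev (lap n) g) ∈ _ from ⟨_, rfl⟩) (quadIdeal_antitone hk h1)
        have h4 : ev (quad n ^ (k + 1)) (ev (lap n) g) - (ev (quad n ^ (k + 1)) (ev (lap n) g) +
            (k * (2 * ((m : ℂ) - 2 * k) + 2 * k - 2 + n) : ℂ) • ev (quad n ^ k) g -
            ((m : ℂ) * (m - 1 + dr n r)) • ev (quad n ^ k) g) =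
            (((r - k : ℕ) * (2 * (r - k : ℕ) + (n - 2 : ℕ)) : ℕ) : ℂ) • ev (quad n ^ k) g := by
          push_cast [Nat.cast_sub (show k ≤ r by omega), Nat.cast_sub (show 2 ≤ n by omega)]
          rw [hmr, dr]
          module
        rw [h4] at h3
        refine ((quadIdeal n (k + 1)).smul_mem_iff (Nat.cast_ne_zero.2 ?_)).1 h3
        exact Nat.mul_ne_zero (by omega) (by omega)
    exact key r le_rfl
  have h3 := ((quadIdeal n r).smul_mem_iff hm).1 h2
  refine ⟨h3, ?_⟩
  by_contra h4
  have h5 := (quadIdeal n r).sub_mem h3 h1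
  rw [sub_sub_cancel] at h5
  exact hfr (((quadIdeal n r).smul_mem_iff h4).1 h5)

end singular

/-! ### Harmonic polynomials as a module for the rotations -/

section harmonics
variable {n : ℕ}

theorem K_lie_DU (p q s : Inn n) : ⁅K p q, DU s⁆ =
    (if s = opp q then DU (opp p) else 0) - if s = p then DU q else 0 := by
  simp only [K, sub_lie, mul_lie', DU_lie_DU, U_lie_DU, mul_zero, zero_add, neg_mul, ite_mul,
    one_mul, zero_mul]
  abel

theorem K_lie_U (p q s : Inn n) : ⁅K p q, U s⁆ =
    (if q = s then U p else 0) - if opp p = s then U (opp q) else 0 := by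
  simp only [K, sub_lie, mul_lie', U_lie_U, DU_lie_U, zero_mul, add_zero, mul_ite, mul_one,
    mul_zero]

theorem K_lie_eul (p q : Inn n) : ⁅eul n, K p q⁆ = 0 := by
  simp only [K, lie_sub, lie_mul', eul_lie_U, eul_lie_DU, mul_neg, add_neg_cancel, sub_zero]

theorem lap_lie_K (p q : Inn n) : ⁅lap n, K p q⁆ = 0 := by
  have e : DU (opp p) * DU q = DU q * DU (opp p) := by
    have := DU_lie_DU (opp p) q
    rwa [Ring.lie_def, sub_eq_zero] at this
  simp only [K, lie_sub, lie_mul', lap_lie_U, lap_lie_DU, mul_zero, add_zero, opp_opp,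
    smul_mul_assoc, e, sub_self]

theorem ev_K_mem_Deg {c : ℂ} {f : MvPolynomial (Fin n) ℂ} (hf : f ∈ Deg n c) (p q : Inn n) :
    ev (K p q) f ∈ Deg n c := by
  have := mem_Deg_of_lie (k := 0) (by rw [K_lie_eul, zero_smul]) hf (a := K p q)
  rwa [add_zero] at this

theorem ev_lap_K (p q : Inn n) (f : MvPolynomial (Fin n) ℂ) :
    ev (lap n) (ev (K p q) f) = ev (K p q) (ev (lap n) f) := by
  rw [ev_comm (lap_lie_K p q), map_zero, LinearMap.zero_apply, add_zero]

/-- Lower bound for the weights of homogeneous polynomials. -/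
theorem exists_weight_eq_sub (a : Inn n) (j : ℕ) {f : MvPolynomial (Fin n) ℂ}
    (hf : f ∈ Deg n j) (h0 : f ≠ 0) {c : ℂ} (hc : ev (K a a) f = c • f) :
    ∃ k : ℕ, c = k - j := by
  induction j generalizing f c with
  | zero =>
    refine ⟨0, ?_⟩
    rw [Nat.cast_zero] at hf
    have h1 : ev (K a a) f = 0 := by
      rw [eq_C_of_mem_Deg_zero hf, map_smul, K, ev_sub, ev_mul, ev_mul, DU_one, DU_one, map_zero,
        map_zero, sub_zero, smul_zero]
    rw [h1] at hc
    rw [(smul_eq_zero.1 hc.symm).resolve_right h0]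
    simp
  | succ j ih =>
    have hp : ∃ p, ev (DU p) f ≠ 0 := by
      by_contra! hc
      have h1 : ((j + 1 : ℕ) : ℂ) • f ≠ 0 := smul_ne_zero (Nat.cast_ne_zero.2 (Nat.succ_ne_zero j)) h0
      refine h1 ?_
      rw [smul_eq_sum_of_mem_Deg hf]
      exact Finset.sum_eq_zero fun p _ => by rw [hc p, map_zero]
    obtain ⟨p, hp⟩ := hp
    have hd : ev (DU p) f ∈ Deg n j := by
      have := ev_DU_mem_Deg hf p
      rwa [Nat.cast_succ, add_sub_cancel_right] at this
    -- A derivative lowers the degree by one and the weight by at most one, so the bound passes from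
    -- the derivative to `f`.
    have hK : ev (K a a) (ev (DU p) f) =
        (c + (if p = opp a then 1 else 0) - if p = a then 1 else 0) • ev (DU p) f := by
      rw [ev_comm (K_lie_DU a a p), hc, map_smul, ev_sub, sub_smul, add_smul, ite_smul, ite_smul,
        one_smul, zero_smul, add_sub_assoc]
      congr 2
      · split_ifs with h
        · rw [h]
        · rw [map_zero, LinearMap.zero_apply]
      · split_ifs with h
        · rw [h]
        · rw [map_zero, LinearMap.zero_apply]
    obtain ⟨k, hk⟩ := ih hd hp hK
    split_ifs at hk
    · exact ⟨k + 1, by push_cast; linear_combination hk⟩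
    · exact ⟨k, by push_cast; linear_combination hk⟩
    · exact ⟨k + 2, by push_cast; linear_combination hk⟩
    · exact ⟨k + 1, by push_cast; linear_combination hk⟩

/-- For `q ≠ ±a` the operator `K a q` raises eigenvalues of `K a a` by one. If no eigenvector were
killed by all of them, `K a a` would have infinitely many eigenvalues on a finite-dimensional space.
-/
theorem exists_maximal_weight {a : Inn n} (ha : opp a ≠ a) {P : Submodule ℂ (MvPolynomial (Fin n) ℂ)}
    [FiniteDimensional ℂ P] (hP : P ≠ ⊥) (hK : ∀ p q, ∀ f ∈ P, ev (K p q) f ∈ P) :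
    ∃ f ∈ P, f ≠ 0 ∧ (∃ c : ℂ, ev (K a a) f = c • f) ∧
      ∀ q, q ≠ a → q ≠ opp a → ev (K a q) f = 0 := by
  let T : Module.End ℂ P := (ev (K a a)).restrict (hK a a)
  have hT : ∀ c : ℂ, T.HasEigenvalue c ↔ ∃ f ∈ P, f ≠ 0 ∧ ev (K a a) f = c • f := by
    intro c
    constructor
    · intro h
      obtain ⟨v, hv⟩ := h.exists_hasEigenvector
      exact ⟨v, v.2, fun e => hv.2 (Subtype.ext e), congrArg Subtype.val hv.apply_eq_smul⟩
    · rintro ⟨f, hf, h0, hc⟩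
      refine Module.End.hasEigenvalue_of_hasEigenvector (x := ⟨f, hf⟩) ⟨?_, ?_⟩
      · exact Module.End.mem_eigenspace_iff.2 (Subtype.ext hc)
      · exact fun e => h0 (congrArg Subtype.val e)
  have : Nontrivial P := Submodule.nontrivial_iff_ne_bot.2 hP
  obtain ⟨c₀, hc₀⟩ := Module.End.exists_eigenvalue T
  by_contra! hcon
  have hstep : ∀ c, T.HasEigenvalue c → T.HasEigenvalue (c + 1) := by
    intro c hc
    obtain ⟨f, hf, h0, hfc⟩ := (hT c).1 hc
    obtain ⟨q, hqa, hqa', hq⟩ := hcon f hf h0 ⟨c, hfc⟩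
    refine (hT _).2 ⟨_, hK a q f hf, hq, ?_⟩
    have hlie : ⁅K a a, K a q⁆ = K a q := by
      have h1 : opp q ≠ a := fun e => hqa' (by rw [← e, opp_opp])
      have h2 : opp q ≠ opp a := fun e => hqa ((opp_inj _ _).1 e)
      rw [show K a q = U a * DU q - U (opp q) * DU (opp a) from rfl, lie_sub, lie_mul', lie_mul',
        K_lie_U, K_lie_U, K_lie_DU, K_lie_DU]
      simp only [if_true, if_neg hqa, if_neg hqa', if_neg ha, if_neg (Ne.symm h1),
        if_neg (Ne.symm h2), sub_self, mul_zero, add_zero, zero_mul, sub_zero, zero_add]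
    rw [ev_comm hlie, hfc, map_smul, add_smul, one_smul]
  have hinf : {c | T.HasEigenvalue c}.Infinite := by
    refine Set.infinite_of_injective_forall_mem (f := fun k : ℕ => c₀ + k) ?_ ?_
    · intro k l h
      exact Nat.cast_injective (add_left_cancel h)
    · intro k
      induction k with
      | zero => simpa using hc₀
      | succ k ih =>
        have := hstep _ ih
        rw [add_assoc] at this
        simpa using this
  exact hinf T.finite_hasEigenvalue

/-- By induction `∂_{U_a} f` is a multiple of a power of `U_a`, and it contributes the only
surviving term of Euler's identity. -/
theorem eq_smul_pow_of_DU_eq_zero {a : Inn n} (j : ℕ) {f : MvPolynomial (Fin n) ℂ}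
    (hf : f ∈ Deg n j) (hD : ∀ q, q ≠ a → ev (DU q) f = 0) : ∃ c : ℂ, f = c • UPoly a ^ j := by
  induction j generalizing f with
  | zero =>
    rw [Nat.cast_zero] at hf
    exact ⟨_, by rw [pow_zero]; exact eq_C_of_mem_Deg_zero hf⟩
  | succ j ih =>
    have hd : ev (DU a) f ∈ Deg n j := by
      have := ev_DU_mem_Deg hf a
      rwa [Nat.cast_succ, add_sub_cancel_right] at this
    obtain ⟨c, hc⟩ := ih hd fun q hq => by
      have := ev_comm (DU_lie_DU q a) f
      rw [this, hD q hq, map_zero, map_zero, LinearMap.zero_apply, add_zero]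
    refine ⟨((j + 1 : ℕ) : ℂ)⁻¹ * c, ?_⟩
    have h1 := smul_eq_sum_of_mem_Deg hf
    rw [Finset.sum_eq_single a (fun q _ hq => by rw [hD q hq, map_zero]) (by simp), hc, map_smul,
      ev_U, ← pow_succ'] at h1
    rw [mul_smul, ← h1, smul_smul, inv_mul_cancel₀ (Nat.cast_ne_zero.2 (Nat.succ_ne_zero j)),
      one_smul]

/-- The harmonic polynomials of degree `m`. -/
def Harm (n m : ℕ) : Submodule ℂ (MvPolynomial (Fin n) ℂ) := Deg n m ⊓ LinearMap.ker (ev (lap n))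

instance (m : ℕ) : FiniteDimensional ℂ (Harm n m) :=
  Submodule.finiteDimensional_of_le (inf_le_left : Harm n m ≤ Deg n m)

theorem ev_K_mem_Harm {m : ℕ} {f : MvPolynomial (Fin n) ℂ} (hf : f ∈ Harm n m) (p q : Inn n) :
    ev (K p q) f ∈ Harm n m := by
  refine ⟨ev_K_mem_Deg hf.1 p q, ?_⟩
  have h : ev (lap n) f = 0 := hf.2
  change ev (lap n) _ = 0
  rw [ev_lap_K, h, map_zero]

/-- A nonzero space of harmonic polynomials that is stable under the rotations contains the highest
weight vector `U_a^m`. -/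
theorem UPoly_pow_mem (hn : 3 ≤ n) {a : Inn n} (ha : opp a ≠ a) {m : ℕ}
    {P : Submodule ℂ (MvPolynomial (Fin n) ℂ)} (hPH : P ≤ Harm n m) (hP : P ≠ ⊥)
    (hK : ∀ p q, ∀ f ∈ P, ev (K p q) f ∈ P) : UPoly a ^ m ∈ P := by
  have : FiniteDimensional ℂ P := Submodule.finiteDimensional_of_le hPH
  obtain ⟨f, hf, h0, ⟨c, hc⟩, hq⟩ := exists_maximal_weight ha hP hK
  have hfd : f ∈ Deg n m := (hPH hf).1
  have hfl : ev (lap n) f = 0 := (hPH hf).2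
  obtain ⟨k, hk⟩ := exists_weight_eq_sub a m hfd h0 hc
  have hgd := ev_DU_mem_Deg hfd (opp a)
  have hKopp : K a (opp a) = 0 := by rw [K, opp_opp, sub_self]
  -- The contraction `Σ ∂_{-q} K_{aq} f` is computed twice: through maximality of `f`, and by
  -- commuting derivatives past variables with `Δ_1 f = 0`.
  have e1 : ∑ q : Inn n, ev (DU (opp q)) (ev (K a q) f) = c • ev (DU (opp a)) f := by
    rw [Finset.sum_eq_single a (fun q _ hqa => ?_) (by simp), hc, map_smul]
    by_cases hqa' : q = opp a
    · rw [hqa', hKopp, map_zero, LinearMap.zero_apply, map_zero]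
    · rw [hq q hqa hqa', map_zero]
  have e2 : ∑ q : Inn n, ev (DU (opp q)) (ev (K a q) f) =
      (2 - (m : ℂ) - n) • ev (DU (opp a)) f := by
    have h1 : ∀ q : Inn n, ev (DU (opp q)) (ev (U a) (ev (DU q) f)) =
        ev (U a) (ev (DU (opp q)) (ev (DU q) f)) + if opp q = a then ev (DU q) f else 0 := by
      intro q
      rw [ev_comm (DU_lie_U (opp q) a)]
      split_ifs
      · rw [ev_one]
      · rw [map_zero, LinearMap.zero_apply]
    have h2 : ∑ q : Inn n, ev (DU (opp q)) (ev (DU q) f) = ev (lap n) f := by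
      rw [← sum_DU_mul_DU_opp, ev_sum, ← sum_opp_index]
      simp only [opp_opp, ev_mul]
    have h3 : ∑ q : Inn n, ev (DU (opp q)) (ev (U (opp q)) (ev (DU (opp a)) f)) =
        ((m : ℂ) - 1 + n) • ev (DU (opp a)) f := by
      rw [sum_opp_index fun q => ev (DU q) (ev (U q) (ev (DU (opp a)) f)), sum_ev_DU_U,
        mem_Deg.1 hgd, ← add_smul]
    have h4 : ∑ q : Inn n, ev (DU (opp q)) (ev (U a) (ev (DU q) f)) = ev (DU (opp a)) f := by
      rw [Finset.sum_congr rfl fun q _ => h1 q, Finset.sum_add_distrib, ← map_sum, h2, hfl,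
        map_zero, zero_add]
      simp only [opp_eq_iff, Finset.sum_ite_eq', Finset.mem_univ, if_true]
    have h5 : ∀ q : Inn n, ev (DU (opp q)) (ev (K a q) f) = ev (DU (opp q)) (ev (U a) (ev (DU q) f)) -
        ev (DU (opp q)) (ev (U (opp q)) (ev (DU (opp a)) f)) := fun q => by
      rw [K, ev_sub, ev_mul, ev_mul, map_sub]
    rw [Finset.sum_congr rfl fun q _ => h5 q, Finset.sum_sub_distrib, h3, h4]
    module
  have hg : ev (DU (opp a)) f = 0 := by
    -- With `c = k - m` the two values differ by the factor `k + n - 2`, positive because `n ≥ 3`.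
    -- The lower bound on the weight is what yields `k ≥ 0`.
    have h1 : ((k + (n - 2) : ℕ) : ℂ) • ev (DU (opp a)) f = 0 := by
      push_cast [Nat.cast_sub (show 2 ≤ n by omega)]
      have := e1.symm.trans e2
      rw [hk, ← sub_eq_zero, ← sub_smul] at this
      rw [← this]
      congr 1
      ring
    refine (smul_eq_zero.1 h1).resolve_left (Nat.cast_ne_zero.2 (by omega))
  have hD : ∀ q, q ≠ a → ev (DU q) f = 0 := by
    intro q hqa
    by_cases hqa' : q = opp a
    · rw [hqa', hg]
    -- Once `∂_{-a} f = 0`, `K a q f` is just `U_a ∂_q f`, and the polynomial ring is a domain.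
    · have h1 := hq q hqa hqa'
      rw [K, ev_sub, ev_mul, ev_mul, hg, map_zero, sub_zero, ev_U] at h1
      exact (mul_eq_zero.1 h1).resolve_left (UPoly_ne_zero a)
  obtain ⟨t, ht⟩ := eq_smul_pow_of_DU_eq_zero m hfd hD
  have ht0 : t ≠ 0 := by
    rintro rfl
    exact h0 (by rw [ht, zero_smul])
  rw [ht] at hf
  exact (P.smul_mem_iff ht0).1 hf

theorem ev_DU_UPoly_pow (a : Inn n) (k : ℕ) :
    ev (DU a) (UPoly a ^ (k + 1)) = ((k + 1 : ℕ) : ℂ) • UPoly a ^ k := by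
  induction k with
  | zero =>
    rw [zero_add, pow_one, UPoly, ev_comm (DU_lie_U a a), DU_one, map_zero, if_pos rfl, ev_one]
    simp
  | succ k ih =>
    rw [pow_succ', ← ev_U, ev_comm (DU_lie_U a a), ih, if_pos rfl, ev_one, map_smul, ev_U,
      ← pow_succ']
    push_cast
    module

theorem ev_DU_UPoly_pow_of_ne {a p : Inn n} (h : p ≠ a) (k : ℕ) :
    ev (DU p) (UPoly a ^ k) = 0 := by
  induction k with
  | zero => rw [pow_zero, DU_one]
  | succ k ih =>
    rw [pow_succ', ← ev_U, ev_comm (DU_lie_U p a), ih, if_neg h, map_zero, map_zero,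
      LinearMap.zero_apply, add_zero]

/-- Multiplication by `U_a` is adjoint to `∂_{U_a}`, so each factor peeled off contributes a nonzero
integer. -/
theorem polyForm_UPoly_pow_ne_zero (a : Inn n) (k : ℕ) :
    polyForm n (UPoly a ^ k) (UPoly a ^ k) ≠ 0 := by
  induction k with
  | zero =>
    rw [pow_zero, ← C_1, C_apply, polyForm_monomial, one_mul, coeff_monomial, if_pos rfl, mul_one]
    exact monomialNorm_ne_zero 0
  | succ k ih =>
    rw [show polyForm n (UPoly a ^ (k + 1)) = polyForm n (ev (U a) (UPoly a ^ k)) by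
        rw [ev_U, pow_succ'],
      polyForm_ev, fourier_U, ev_DU_UPoly_pow, map_smul]
    exact smul_ne_zero (Nat.cast_ne_zero.2 (Nat.succ_ne_zero k)) ih

theorem UPoly_pow_mem_Deg (a : Inn n) (k : ℕ) : UPoly a ^ k ∈ Deg n k := by
  induction k with
  | zero => rw [pow_zero, Nat.cast_zero]; exact one_mem_Deg
  | succ k ih =>
    rw [pow_succ', ← ev_U, Nat.cast_succ]
    exact ev_U_mem_Deg ih a

/-- `Δ_1 = Σ ∂_p ∂_{-p}`, and for `a ≠ -a` one of `p`, `-p` always differs from `a`. -/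
theorem UPoly_pow_mem_Harm {a : Inn n} (ha : opp a ≠ a) (m : ℕ) : UPoly a ^ m ∈ Harm n m := by
  refine ⟨UPoly_pow_mem_Deg a m, ?_⟩
  change ev (lap n) _ = 0
  rw [← sum_DU_mul_DU_opp, ev_sum]
  refine Finset.sum_eq_zero fun p _ => ?_
  rw [ev_mul]
  by_cases h : opp p = a
  · have hp : p ≠ a := by
      rintro rfl
      exact ha h
    have := ev_comm (DU_lie_DU p (opp p)) (UPoly a ^ m)
    rw [this, ev_DU_UPoly_pow_of_ne hp, map_zero, map_zero, LinearMap.zero_apply, add_zero]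
  · rw [ev_DU_UPoly_pow_of_ne h, map_zero]

/-- The harmonic polynomials of degree `m` form a simple module for the rotations. -/
theorem Harm_le_of_stable (hn : 3 ≤ n) {m : ℕ} {P : Submodule ℂ (MvPolynomial (Fin n) ℂ)}
    (hPH : P ≤ Harm n m) (hP : P ≠ ⊥) (hK : ∀ p q, ∀ f ∈ P, ev (K p q) f ∈ P) : Harm n m ≤ P := by
  let a : Inn n := .inl ⟨0, by omega⟩
  have ha : opp a ≠ a := by simp [a, opp]
  have heP := UPoly_pow_mem hn ha hPH hP hK
  let P' : Submodule ℂ (MvPolynomial (Fin n) ℂ) :=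
    { carrier := {h | h ∈ Harm n m ∧ ∀ f ∈ P, polyForm n f h = 0}
      zero_mem' := ⟨zero_mem _, fun f _ => map_zero _⟩
      add_mem' := fun hg hh => ⟨add_mem hg.1 hh.1, fun f hf => by
        rw [map_add, hg.2 f hf, hh.2 f hf, add_zero]⟩
      smul_mem' := fun c h hh => ⟨Submodule.smul_mem _ c hh.1, fun f hf => by
        rw [map_smul, hh.2 f hf, smul_zero]⟩ }
  -- `P'` is the orthogonal complement of `P` among the harmonics and is again stable under
  -- rotations. If it were nonzero, it would contain `U_a^m` as `P` does, but this vector is not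
  -- orthogonal to itself.
  have hP' : P' = ⊥ := by
    by_contra hne
    refine polyForm_UPoly_pow_ne_zero a m ((UPoly_pow_mem hn ha (P := P') (fun h hh => hh.1) hne
      fun p q h hh => ⟨ev_K_mem_Harm hh.1 p q, fun f hf => ?_⟩).2 _ heP)
    rw [← fourier_K, ← polyForm_ev]
    exact hh.2 _ (hK q p f hf)
  have : FiniteDimensional ℂ P := Submodule.finiteDimensional_of_le hPH
  -- As the complement is zero, the harmonics embed into the dual of `P`, and a dimension count
  -- gives equality.
  let Φ : Harm n m →ₗ[ℂ] Module.Dual ℂ P :=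
    (LinearMap.lcomp ℂ ℂ P.subtype) ∘ₗ (polyForm n).flip ∘ₗ (Harm n m).subtype
  have hΦ : Function.Injective Φ := by
    rw [injective_iff_map_eq_zero]
    intro h hh
    have : (h : MvPolynomial (Fin n) ℂ) ∈ P' :=
      ⟨h.2, fun f hf => LinearMap.congr_fun hh ⟨f, hf⟩⟩
    rw [hP', Submodule.mem_bot] at this
    exact Subtype.ext this
  have hle := LinearMap.finrank_le_finrank_of_injective hΦ
  rw [Subspace.dual_finrank_eq] at hle
  exact (Submodule.eq_of_le_of_finrank_le hPH hle).ge

end harmonics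

/-! ### Stability under the action -/

section stable
variable {n : ℕ}

theorem kPart_eq_sum_K (C : Inn n → Inn n → ℂ) (hC : ∀ p q, C (opp q) (opp p) = -C p q) :
    kPart C = (1 / 2 : ℂ) • ∑ p, ∑ q, C p q • K p q := by
  have h : ∑ p, ∑ q, C p q • (U (opp q) * DU (opp p)) = -kPart C := by
    rw [Finset.sum_comm, ← sum_opp_index, kPart, ← Finset.sum_neg_distrib]
    refine Finset.sum_congr rfl fun q _ => ?_
    rw [← sum_opp_index, ← Finset.sum_neg_distrib]
    exact Finset.sum_congr rfl fun p _ => by rw [hC, opp_opp, opp_opp, neg_smul]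
  simp only [K, smul_sub, Finset.sum_sub_distrib, h]
  rw [show ∑ p, ∑ q, C p q • (U p * DU q) = kPart C from rfl]
  module

theorem psi_mem (d : ℂ) (Y : so n) {S : Submodule ℂ (Weyl n)} (hI : Iop n d ∈ S)
    (hU : ∀ p, U p ∈ S) (hV : ∀ p, V d p ∈ S) (hK : ∀ p q, K p q ∈ S) : psi d Y ∈ S := by
  rw [psi_apply, psiLin_apply, kPart_eq_sum_K (fun p q => Y.1 (inc p) (inc q))]
  · refine add_mem (add_mem (add_mem (neg_mem (S.smul_mem _ hI)) ?_) ?_) ?_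
    · exact sum_mem fun p _ => S.smul_mem _ (hU p)
    · exact sum_mem fun p _ => S.smul_mem _ (hV _)
    · exact S.smul_mem _ (sum_mem fun p _ => sum_mem fun q _ => S.smul_mem _ (hK p q))
  · intro p q
    rw [← opp_inc, ← opp_inc]
    exact skew Y _ _

/-- The operators that map the subspace `P` to itself. -/
def stabilizer (P : Submodule ℂ (MvPolynomial (Fin n) ℂ)) : Submodule ℂ (Weyl n) where
  carrier := {a | ∀ f ∈ P, ev a f ∈ P}
  zero_mem' f _ := by rw [map_zero]; exact P.zero_mem
  add_mem' ha hb f hf := by rw [ev_add]; exact P.add_mem (ha f hf) (hb f hf)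
  smul_mem' c a ha f hf := by rw [ev_smul]; exact P.smul_mem c (ha f hf)

variable {r : ℕ}

theorem psi_mem_stabilizer (N : LieSubmodule ℂ (so n) (PolyR n r)) (Y : so n) :
    psi (dr n r) Y ∈ stabilizer (n := n) N.toSubmodule := fun _ hf => N.lie_mem (x := Y) hf

theorem tau_mem_stabilizer (N : LieSubmodule ℂ (so n) (PolyM n r)) (Y : so n) :
    tau n r Y ∈ stabilizer (n := n) N.toSubmodule := fun _ hf => N.lie_mem (x := Y) hf

theorem eul_mem_stabilizer {d : ℂ} {P : Submodule ℂ (MvPolynomial (Fin n) ℂ)}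
    (h : -Iop n d ∈ stabilizer P) : eul n ∈ stabilizer P := by
  intro f hf
  have h1 := h f hf
  rw [ev_neg, ev_Iop] at h1
  have h2 := P.add_mem (P.neg_mem h1) (P.smul_mem (-d) hf)
  rwa [neg_neg, neg_smul, add_neg_cancel_right] at h2

theorem PolyR_U (N : LieSubmodule ℂ (so n) (PolyR n r)) (p : Inn n) :
    U p ∈ stabilizer (n := n) N.toSubmodule := by
  rw [← psi_E_inc_idx1 (dr n r)]
  exact psi_mem_stabilizer N _

theorem PolyR_V (N : LieSubmodule ℂ (so n) (PolyR n r)) (p : Inn n) :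
    V (dr n r) p ∈ stabilizer (n := n) N.toSubmodule := by
  rw [← opp_opp p, ← psi_E_idx1_inc]
  exact psi_mem_stabilizer N _

theorem PolyR_K (N : LieSubmodule ℂ (so n) (PolyR n r)) (p q : Inn n) :
    K p q ∈ stabilizer (n := n) N.toSubmodule := by
  rw [← psi_E_inc_inc (dr n r)]
  exact psi_mem_stabilizer N _

theorem PolyR_eul (N : LieSubmodule ℂ (so n) (PolyR n r)) :
    eul n ∈ stabilizer (n := n) N.toSubmodule :=
  eul_mem_stabilizer (d := dr n r) (psi_E_idx1_idx1 (n := n) (dr n r) ▸ psi_mem_stabilizer N _)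

theorem PolyM_DU (N : LieSubmodule ℂ (so n) (PolyM n r)) (p : Inn n) :
    DU p ∈ stabilizer (n := n) N.toSubmodule := by
  rw [← tau_E_idx1_inc r]
  exact tau_mem_stabilizer N _

theorem PolyM_eul (N : LieSubmodule ℂ (so n) (PolyM n r)) :
    eul n ∈ stabilizer (n := n) N.toSubmodule :=
  eul_mem_stabilizer (d := dr n r) (tau_E_idx1_idx1 (n := n) r ▸ tau_mem_stabilizer N _)

theorem PolyR_eq_top {N : LieSubmodule ℂ (so n) (PolyR n r)}
    (h : (1 : MvPolynomial (Fin n) ℂ) ∈ N.toSubmodule) : N = ⊤ := by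
  rw [eq_top_iff]
  exact fun f _ => mem_of_U_stable h (PolyR_U N) f

theorem one_mem_of_mem_Deg_zero {P : Submodule ℂ (MvPolynomial (Fin n) ℂ)}
    {f : MvPolynomial (Fin n) ℂ} (hf : f ∈ Deg n 0) (h0 : f ≠ 0) (hP : f ∈ P) :
    (1 : MvPolynomial (Fin n) ℂ) ∈ P := by
  have e := eq_C_of_mem_Deg_zero hf
  rw [e] at hP
  refine (P.smul_mem_iff fun hc => h0 ?_).1 hP
  rw [e, hc, zero_smul]

/-- Every nonzero submodule of `PolyM n r` contains `1`. -/
theorem one_mem_of_ne_bot {N : LieSubmodule ℂ (so n) (PolyM n r)} (h : N ≠ ⊥) :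
    (1 : MvPolynomial (Fin n) ℂ) ∈ N.toSubmodule := by
  obtain ⟨m, f, hf, hfm, hf0, hmin⟩ := exists_minimal_homogeneous (P := N.toSubmodule) (P₀ := ⊥)
    (PolyM_eul N) fun hle => h ((LieSubmodule.eq_bot_iff N).2 fun f hf => hle hf)
  -- By minimality all derivatives of `f` vanish, so Euler's identity leaves only degree zero.
  have h1 : (m : ℂ) • f = 0 := by
    rw [smul_eq_sum_of_mem_Deg hfm]
    refine Finset.sum_eq_zero fun p _ => ?_
    rw [show ev (DU p) f = 0 from hmin _ (PolyM_DU N p f hf) (ev_DU_mem_Deg hfm p), map_zero]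
  have h2 : (m : ℂ) = 0 := (smul_eq_zero.1 h1).resolve_right hf0
  rw [h2] at hfm
  exact one_mem_of_mem_Deg_zero hfm hf0 hf

/-- A submodule of `PolyR n r` that contains `F^r` properly contains `1`, or a homogeneous
polynomial of degree `1 - d` that is singular modulo `F^r`. -/
theorem exists_singular (hn : 3 ≤ n) {N : LieSubmodule ℂ (so n) (PolyR n r)}
    (h : ¬ N ≤ idealF n r) : (1 : MvPolynomial (Fin n) ℂ) ∈ N.toSubmodule ∨
      ∃ m : ℕ, (m : ℂ) = 1 - dr n r ∧ ∃ f ∈ N.toSubmodule, f ∈ Deg n m ∧ f ≠ 0 ∧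
        ev (quad n) (ev (lap n) f) ∈ quadIdeal n r := by
  obtain ⟨m, f, hf, hfm, hf0, hmin⟩ := exists_minimal_homogeneous (P := N.toSubmodule)
    (P₀ := quadIdeal n r) (PolyR_eul N) fun hle => h fun f hf => mem_idealF_iff.2 (hle hf)
  have hf1 : f ≠ 0 := by
    rintro rfl
    exact hf0 (zero_mem _)
  -- Each `V_p` lowers the degree by one, so minimality makes `f` singular modulo `F^r`.
  obtain ⟨h1, h2⟩ := quad_lap_mem_of_singular hn hfm
    (fun p => hmin _ (PolyR_V N p f hf) (ev_V_mem_Deg hfm _ p)) hf0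
  rcases mul_eq_zero.1 h2 with h3 | h3
  · rw [h3] at hfm
    exact Or.inl (one_mem_of_mem_Deg_zero hfm hf1 hf)
  · exact Or.inr ⟨m, by linear_combination h3, f, hf, hfm, hf1, h1⟩

end stable

/-! ### The submodule generated by the harmonic polynomials of degree `m` -/

section generated
variable {n m : ℕ}

/-- The span of the homogeneous polynomials `f` of degree `j ≥ m` with `Δ_1^{j+1-m} f = 0`. -/
def genHarm (n m : ℕ) : Submodule ℂ (MvPolynomial (Fin n) ℂ) :=
  ⨆ j : ℕ, Deg n j ⊓ LinearMap.ker (ev (lap n ^ (j + 1 - m)))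

theorem mem_genHarm {j : ℕ} {f : MvPolynomial (Fin n) ℂ} (hf : f ∈ Deg n j)
    (h : ev (lap n ^ (j + 1 - m)) f = 0) : f ∈ genHarm n m :=
  Submodule.mem_iSup_of_mem j ⟨hf, h⟩

theorem genHarm_le {P : Submodule ℂ (MvPolynomial (Fin n) ℂ)}
    (h : ∀ j : ℕ, m ≤ j → ∀ f ∈ Deg n j, ev (lap n ^ (j + 1 - m)) f = 0 → f ∈ P) :
    genHarm n m ≤ P := by
  refine iSup_le fun j f hf => ?_
  have hf2 : ev (lap n ^ (j + 1 - m)) f = 0 := hf.2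
  by_cases hj : m ≤ j
  · exact h j hj f hf.1 hf2
  -- Below degree `m` the truncated exponent is zero and the kernel is that of the identity, so
  -- these degrees contribute nothing.
  · rw [show j + 1 - m = 0 by omega, pow_zero, ev_one] at hf2
    rw [hf2]
    exact zero_mem _

theorem ev_lap_pow_eq_zero_of_mem_genHarm {j : ℕ} {f : MvPolynomial (Fin n) ℂ} (hf : f ∈ Deg n j)
    (h : f ∈ genHarm n m) : ev (lap n ^ (j + 1 - m)) f = 0 := by
  classical
  obtain ⟨s, g, hg, e⟩ := exists_finset_sum_of_mem_iSup _ h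
  have hχ : Function.Injective fun (k : ℕ) (_ : Unit) => (k : ℂ) := by
    intro k l e
    simpa using congrFun e ()
  -- Uniqueness of homogeneous components: the decomposition of `f` inside the sum is compared with
  -- `f` alone in degree `j`.
  have hker : ∀ i ∈ insert j s, (if i ∈ s then g i else 0) - (if i = j then f else 0) ∈
      (⊥ : Submodule ℂ (MvPolynomial (Fin n) ℂ)) := by
    refine mem_of_sum_eigenvectors_mem (fun (_ : Unit) f => ev (eul n) f) _ hχ ⊥
      (fun _ => ⟨ev (eul n), fun _ => rfl⟩) (fun _ v hv => ?_) _ _ (fun i _ _ => ?_) ?_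
    · rw [(Submodule.mem_bot ℂ).1 hv, map_zero]
      exact zero_mem _
    · refine mem_Deg.1 (sub_mem ?_ ?_)
      · split_ifs
        · exact (hg i).1
        · exact zero_mem _
      · split_ifs with hi
        · rw [hi]; exact hf
        · exact zero_mem _
    · rw [Finset.sum_sub_distrib, Finset.sum_ite_eq', if_pos (Finset.mem_insert_self j s),
        Finset.sum_ite_mem,
        Finset.inter_eq_right.2 (Finset.subset_insert j s), e, sub_self]
      exact zero_mem _
  have h1 := hker j (Finset.mem_insert_self j s)
  rw [if_pos rfl, Submodule.mem_bot, sub_eq_zero] at h1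
  rw [← h1]
  split_ifs
  · exact (hg j).2
  · rw [map_zero]

theorem K_mem_stabilizer_genHarm (p q : Inn n) : K p q ∈ stabilizer (genHarm n m) := by
  refine genHarm_le (P := (genHarm n m).comap (ev (K p q))) fun j _ f hf h => ?_
  refine mem_genHarm (ev_K_mem_Deg hf p q) ?_
  have : ∀ k : ℕ, ev (lap n ^ k) (ev (K p q) f) = ev (K p q) (ev (lap n ^ k) f) := by
    intro k
    induction k with
    | zero => simp only [pow_zero, ev_one]
    | succ k ih => rw [ev_lap_pow_succ, ih, ev_lap_K, ev_lap_pow_succ]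
  rw [this, h, map_zero]

theorem Iop_mem_stabilizer_genHarm (d : ℂ) : Iop n d ∈ stabilizer (genHarm n m) := by
  refine genHarm_le (P := (genHarm n m).comap (ev (Iop n d))) fun j _ f hf h => ?_
  change ev (Iop n d) f ∈ genHarm n m
  rw [ev_Iop, mem_Deg.1 hf, ← add_smul]
  exact Submodule.smul_mem _ _ (mem_genHarm hf h)

theorem U_mem_stabilizer_genHarm (p : Inn n) : U p ∈ stabilizer (genHarm n m) := by
  refine genHarm_le (P := (genHarm n m).comap (ev (U p))) fun j hj f hf h => ?_
  have hd : ev (U p) f ∈ Deg n ((j + 1 : ℕ) : ℂ) := by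
    rw [Nat.cast_succ]; exact ev_U_mem_Deg hf p
  refine mem_genHarm hd ?_
  rw [show j + 1 + 1 - m = j + 1 - m + 1 by omega, ev_lap_pow_U, ev_lap_pow_succ, h, map_zero,
    map_zero, map_zero, smul_zero, add_zero]

/-- In degree `m + k` and for `d = 1 - m`, `V_p f = ½ U_p Δ_1 f - k ∂_{-p} f`. Commuting `Δ_1^k`
past `U_p` produces exactly the term that cancels the second, leaving `½ U_p Δ_1^{k+1} f = 0`. -/
theorem V_mem_stabilizer_genHarm (hm : 1 ≤ m) (p : Inn n) :
    V (1 - m : ℂ) p ∈ stabilizer (genHarm n m) := by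
  refine genHarm_le (P := (genHarm n m).comap (ev (V (1 - m : ℂ) p))) fun j hj f hf h => ?_
  obtain ⟨k, rfl⟩ := Nat.exists_eq_add_of_le hj
  have hd : ev (V (1 - m : ℂ) p) f ∈ Deg n ((m + k - 1 : ℕ) : ℂ) := by
    rw [Nat.cast_sub (by omega), Nat.cast_one]
    exact ev_V_mem_Deg hf _ p
  refine mem_genHarm hd ?_
  rw [show m + k + 1 - m = k + 1 by omega] at h
  rw [show m + k - 1 + 1 - m = k by omega, ev_V_of_mem_Deg hf, map_sub, map_smul, map_smul,
    ev_lap_pow_DU]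
  cases k with
  | zero =>
    rw [zero_add, pow_one] at h
    rw [h]
    simp
  | succ k =>
    rw [ev_lap_pow_U, ← ev_lap_pow_succ', ← ev_lap_pow_succ', h]
    push_cast
    rw [map_zero]
    module

/-- Here the required power of `Δ_1` lowers the degree below zero; hence finite codimension. -/
theorem mem_genHarm_of_le {j : ℕ} (hj : 2 * m ≤ j + 1) {f : MvPolynomial (Fin n) ℂ}
    (hf : f ∈ Deg n j) : f ∈ genHarm n m :=
  mem_genHarm hf (ev_lap_pow_eq_zero (by omega) hf)

theorem one_notMem_genHarm (hm : 1 ≤ m) : (1 : MvPolynomial (Fin n) ℂ) ∉ genHarm n m := by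
  intro h
  have := ev_lap_pow_eq_zero_of_mem_genHarm (j := 0) (by rw [Nat.cast_zero]; exact one_mem_Deg) h
  rw [show 0 + 1 - m = 0 by omega, pow_zero, ev_one] at this
  exact one_ne_zero this

theorem Harm_le_genHarm : Harm n m ≤ genHarm n m := fun f hf => by
  refine mem_genHarm hf.1 ?_
  rw [show m + 1 - m = 1 by omega, pow_one]
  exact hf.2

theorem ev_lap_pow_quad_pow_eq_zero {c : ℂ} {a : ℕ} {f : MvPolynomial (Fin n) ℂ}
    (hf : f ∈ Deg n c) (h : ev (lap n ^ a) f = 0) (k : ℕ) :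
    ev (lap n ^ (a + k)) (ev (quad n ^ k) f) = 0 := by
  induction k with
  | zero => rwa [pow_zero, ev_one]
  | succ k ih =>
    rw [ev_quad_pow_succ, ← add_assoc, ev_lap_pow_quad (ev_quad_pow_mem_Deg hf k), ih,
      ev_lap_pow_succ, ih, map_zero, map_zero, smul_zero, add_zero]

/-- On degree `c` already `Δ_1^{c+1}` vanishes, and each factor `F` raises the order of nilpotency
by at most one, so `Δ_1^{c+1+r}` kills `F^r f`. For `m ≤ r` the required exponent is at least as
large. -/
theorem quadIdeal_le_genHarm {r : ℕ} (h : m ≤ r) : quadIdeal n r ≤ genHarm n m := by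
  rintro _ ⟨g, rfl⟩
  obtain ⟨s, f, hf, rfl⟩ := exists_finset_sum_of_mem_iSup (fun c : ℕ => Deg n c)
    (iSup_Deg (n := n) ▸ Submodule.mem_top : g ∈ _)
  rw [map_sum]
  refine sum_mem fun c _ => ?_
  have hd : ev (quad n ^ r) (f c) ∈ Deg n ((c + 2 * r : ℕ) : ℂ) := by
    have := ev_quad_pow_mem_Deg (hf c) r
    push_cast
    exact this
  refine mem_genHarm hd ?_
  obtain ⟨t, ht⟩ := Nat.exists_eq_add_of_le h
  rw [show c + 2 * r + 1 - m = t + (c + 1 + r) by omega, pow_add, ev_mul,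
    ev_lap_pow_quad_pow_eq_zero (hf c) (ev_lap_pow_eq_zero (by omega) (hf c)), map_zero]

/-- `genHarm n m` is generated by the harmonic polynomials of degree `m`. -/
theorem genHarm_le_of_Harm_le (hn : 3 ≤ n) {P : Submodule ℂ (MvPolynomial (Fin n) ℂ)}
    (hU : ∀ p, U p ∈ stabilizer P) (h : Harm n m ≤ P) : genHarm n m ≤ P := by
  have key : ∀ q : ℕ, ∀ f ∈ Deg n ((m + q : ℕ) : ℂ), ev (lap n ^ (q + 1)) f = 0 → f ∈ P := by
    intro q
    induction q with
    | zero =>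
      intro f hf h0
      rw [zero_add, pow_one] at h0
      exact h ⟨hf, h0⟩
    | succ q ih =>
      have hd : ∀ f ∈ Deg n ((m + (q + 1) : ℕ) : ℂ), ∀ p, ev (DU p) f ∈ Deg n ((m + q : ℕ) : ℂ) := by
        intro f hf p
        have := ev_DU_mem_Deg hf p
        rwa [← add_assoc, Nat.cast_succ, add_sub_cancel_right] at this
      -- If a lower power of `Δ_1` already kills `f`, its derivatives are covered by the induction
      -- hypothesis, and Euler's identity recovers `f`.
      have h1 : ∀ f ∈ Deg n ((m + (q + 1) : ℕ) : ℂ), ev (lap n ^ (q + 1)) f = 0 → f ∈ P := by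
        intro f hf h0
        have h2 := smul_eq_sum_of_mem_Deg hf
        have h3 : ((m + (q + 1) : ℕ) : ℂ) ≠ 0 := Nat.cast_ne_zero.2 (by omega)
        refine (P.smul_mem_iff h3).1 ?_
        rw [h2]
        refine sum_mem fun p _ => hU p _ (ih _ (hd f hf p) ?_)
        rw [ev_lap_pow_DU, h0, map_zero]
      intro f hf h0
      by_cases hq : m < q + 1
      · refine h1 f hf (eq_zero_of_mem_Deg (ev_lap_pow_mem_Deg hf _) fun j hj => ?_)
        have : ((m + (q + 1) : ℕ) : ℂ) = ((j + 2 * (q + 1) : ℕ) : ℂ) := by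
          push_cast at hj ⊢; linear_combination hj
        have := Nat.cast_injective this
        omega
      · have hl := ev_lap_mem_Deg hf
        -- The coefficient is the one for which `Δ_1^{q+1}` kills this combination, so the induction
        -- hypothesis applies; contraction with `U_p` then relates `f` to `F Δ_1 f` modulo `P`.
        have h2 : ∀ p : Inn n, (2 * (q + 1) : ℂ) • ev (DU p) f - ev (U (opp p)) (ev (lap n) f) ∈ P := by
          intro p
          refine ih _ (sub_mem (Submodule.smul_mem _ _ (hd f hf p)) ?_) ?_
          · have := ev_U_mem_Deg hl (opp p)
            convert this using 1
            push_cast; ring_nf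
          · rw [map_sub, map_smul, ev_lap_pow_DU, ev_lap_pow_U, ← ev_lap_pow_succ',
              ← ev_lap_pow_succ', h0, map_zero, zero_add, opp_opp, sub_self]
        have h3 : (2 * (q + 1) * (m + q + 1) : ℂ) • f - (2 : ℂ) • ev (quad n) (ev (lap n) f) ∈ P := by
          have h4 : ∑ p, ev (U p) ((2 * (q + 1) : ℂ) • ev (DU p) f -
              ev (U (opp p)) (ev (lap n) f)) ∈ P := sum_mem fun p _ => hU p _ (h2 p)
          simp only [map_sub, map_smul, Finset.sum_sub_distrib, ← Finset.smul_sum] at h4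
          rw [← smul_eq_sum_of_mem_Deg hf] at h4
          have h6 : ∑ p : Inn n, ev (U p) (ev (U (opp p)) (ev (lap n) f)) =
              (2 : ℂ) • ev (quad n) (ev (lap n) f) := by
            rw [← ev_smul, ← sum_U_mul_U_opp, ev_sum]
            simp only [ev_mul]
          rw [h6, smul_smul] at h4
          convert h4 using 3
          push_cast; ring
        have h5 : ev (lap n ^ (q + 1)) ((2 * (q + 1) * (m + q + 1) : ℂ) • f -
            (2 : ℂ) • ev (quad n) (ev (lap n) f)) =
            -((2 * (q + 1) * (m - (q + 1) + n - 2 : ℂ)) • ev (lap n ^ (q + 1)) f) := by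
          rw [map_sub, map_smul, map_smul, ev_lap_pow_quad hl, ← ev_lap_pow_succ', h0,
            ← ev_lap_pow_succ', map_zero, zero_add]
          push_cast
          module
        have h6 : (2 * (q + 1) * (m - (q + 1) + n - 2) : ℂ) ≠ 0 := by
          have : ((2 * (q + 1) * (m - (q + 1) + (n - 2)) : ℕ) : ℂ) ≠ 0 := Nat.cast_ne_zero.2
            (Nat.mul_ne_zero (by omega) (by omega))
          push_cast [Nat.cast_sub (show q + 1 ≤ m by omega), Nat.cast_sub (show 2 ≤ n by omega)] at this
          rwa [← add_sub_assoc] at this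
        -- Adding this multiple of `f` cancels the image under `Δ_1^{q+1}`, so `h1` puts the sum
        -- into `P`; its second summand is there by `h3`. The factor is nonzero since `q + 1 ≤ m`
        -- and `n ≥ 3`.
        have h7 : (2 * (q + 1) * (m - (q + 1) + n - 2) : ℂ) • f +
            ((2 * (q + 1) * (m + q + 1) : ℂ) • f - (2 : ℂ) • ev (quad n) (ev (lap n) f)) ∈ P := by
          refine h1 _ (add_mem (Submodule.smul_mem _ _ hf) (sub_mem (Submodule.smul_mem _ _ hf)
            (Submodule.smul_mem _ _ ?_))) ?_
          · have := ev_quad_mem_Deg hl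
            rwa [sub_add_cancel] at this
          · rw [map_add, h5, map_smul, add_neg_cancel]
        exact (P.smul_mem_iff h6).1 ((P.add_mem_iff_left h3).1 h7)
  refine genHarm_le fun j hj f hf h0 => ?_
  obtain ⟨q, rfl⟩ := Nat.exists_eq_add_of_le hj
  rw [show m + q + 1 - m = q + 1 by omega] at h0
  exact key q f hf h0

end generated

/-! ### Submodules of quotients -/

section quotient
variable {n : ℕ} {W : Type*} [AddCommGroup W] [Module ℂ W] [LieRingModule (so n) W]
  [LieModule ℂ (so n) W] {I S : LieSubmodule ℂ (so n) W}

theorem map_comap_mk' (I : LieSubmodule ℂ (so n) W) (N : LieSubmodule ℂ (so n) (W ⧸ I)) :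
    (N.comap (LieSubmodule.Quotient.mk' I)).map (LieSubmodule.Quotient.mk' I) = N := by
  ext w
  rw [LieSubmodule.mem_map]
  constructor
  · rintro ⟨v, hv, rfl⟩
    exact hv
  · intro hw
    obtain ⟨v, rfl⟩ := LieSubmodule.Quotient.surjective_mk' I w
    exact ⟨v, hw, rfl⟩

theorem map_mk'_self (I : LieSubmodule ℂ (so n) W) : I.map (LieSubmodule.Quotient.mk' I) = ⊥ := by
  rw [eq_bot_iff]
  intro w hw
  obtain ⟨v, hv, rfl⟩ := (LieSubmodule.mem_map w).1 hw
  exact (LieSubmodule.mem_bot _).2 ((LieSubmodule.Quotient.mk_eq_zero _).2 hv)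

theorem map_mk'_top (I : LieSubmodule ℂ (so n) W) :
    (⊤ : LieSubmodule ℂ (so n) W).map (LieSubmodule.Quotient.mk' I) = ⊤ := by
  rw [eq_top_iff]
  intro w _
  obtain ⟨v, rfl⟩ := LieSubmodule.Quotient.surjective_mk' I w
  exact LieSubmodule.mem_map_of_mem trivial

theorem le_comap_mk' (I : LieSubmodule ℂ (so n) W) (N : LieSubmodule ℂ (so n) (W ⧸ I)) :
    I ≤ N.comap (LieSubmodule.Quotient.mk' I) := by
  intro w hw
  rw [LieSubmodule.mem_comap, (LieSubmodule.Quotient.mk_eq_zero I).2 hw]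
  exact N.zero_mem

theorem mem_of_mk'_mem_map (h : I ≤ S) {w : W}
    (hw : LieSubmodule.Quotient.mk' I w ∈ S.map (LieSubmodule.Quotient.mk' I)) : w ∈ S := by
  obtain ⟨v, hv, e⟩ := (LieSubmodule.mem_map _).1 hw
  rw [← sub_eq_zero, ← map_sub, LieSubmodule.Quotient.mk_eq_zero] at e
  exact (S.sub_mem_iff_right hv).1 (h e)

theorem isIrreducible_quotient_of_forall (hI : I ≠ ⊤)
    (h : ∀ N : LieSubmodule ℂ (so n) W, I ≤ N → N = I ∨ N = ⊤) :
    LieModule.IsIrreducible ℂ (so n) (W ⧸ I) := by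
  have hnt : ∃ w, w ∉ I := by
    by_contra! hc
    exact hI (eq_top_iff.2 fun w _ => hc w)
  obtain ⟨w, hw⟩ := hnt
  have : Nontrivial (W ⧸ I) :=
    ⟨LieSubmodule.Quotient.mk' I w, 0, fun e => hw ((LieSubmodule.Quotient.mk_eq_zero _).1 e)⟩
  refine LieModule.IsIrreducible.mk fun N hN => ?_
  rcases h _ (le_comap_mk' I N) with e | e
  · exact absurd (by rw [← map_comap_mk' I N, e, map_mk'_self]) hN
  · rw [← map_comap_mk' I N, e, map_mk'_top]

theorem isUniqueProper_map (hIS : I ≤ S) (h1 : S ≠ I) (h2 : S ≠ ⊤)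
    (h : ∀ N : LieSubmodule ℂ (so n) W, I ≤ N → N = I ∨ N = S ∨ N = ⊤) :
    IsUniqueProper (S.map (LieSubmodule.Quotient.mk' I)) where
  ne_bot e := by
    refine h1 (le_antisymm (fun w hw => ?_) hIS)
    have := LieSubmodule.mem_map_of_mem (f := LieSubmodule.Quotient.mk' I) hw
    rw [e, LieSubmodule.mem_bot] at this
    exact (LieSubmodule.Quotient.mk_eq_zero _).1 this
  ne_top e := h2 (eq_top_iff.2 fun w _ => mem_of_mk'_mem_map hIS (e ▸ trivial))
  eq N := by
    rcases h _ (le_comap_mk' I N) with e | e | e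
    · exact Or.inl (by rw [← map_comap_mk' I N, e, map_mk'_self])
    · exact Or.inr (Or.inl (by rw [← map_comap_mk' I N, e]))
    · exact Or.inr (Or.inr (by rw [← map_comap_mk' I N, e, map_mk'_top]))

theorem IsHighestWeight.mk' {ν : Weight n} {w : W} (h : IsHighestWeight ν w) :
    IsHighestWeight ν (LieSubmodule.Quotient.mk' I w) where
  mem_wt H := by rw [← LieModuleHom.map_lie, h.mem_wt H, map_smul]
  pos_lie Y hY := by rw [← LieModuleHom.map_lie, h.pos_lie Y hY, map_zero]

theorem IsHighestWeight.of_coe {ν : Weight n} {w : S} (h : IsHighestWeight ν (w : W)) :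
    IsHighestWeight ν w where
  mem_wt H := Subtype.ext (h.mem_wt H)
  pos_lie Y hY := Subtype.ext (h.pos_lie Y hY)

theorem IsUniqueProper.exists_lieSpan_eq_top (h : IsUniqueProper S) :
    ∃ s : Finset W, LieSubmodule.lieSpan ℂ (so n) (s : Set W) = ⊤ := by
  have hnt : ∃ w, w ∉ S := by
    by_contra! hc
    exact h.ne_top (eq_top_iff.2 fun w _ => hc w)
  obtain ⟨w, hw⟩ := hnt
  refine ⟨{w}, ?_⟩
  have hm : w ∈ LieSubmodule.lieSpan ℂ (so n) (({w} : Finset W) : Set W) :=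
    LieSubmodule.subset_lieSpan (by simp)
  rcases h.eq (LieSubmodule.lieSpan ℂ (so n) (({w} : Finset W) : Set W)) with e | e | e
  · rw [e, LieSubmodule.mem_bot] at hm
    exact absurd (hm ▸ S.zero_mem) hw
  · exact absurd (e ▸ hm) hw
  · exact e

theorem exists_lieSpan_eq_top_of_isIrreducible [LieModule.IsIrreducible ℂ (so n) W] :
    ∃ s : Finset W, LieSubmodule.lieSpan ℂ (so n) (s : Set W) = ⊤ := by
  have := LieModule.nontrivial_of_isIrreducible ℂ (so n) W
  obtain ⟨w, hw⟩ := exists_ne (0 : W)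
  refine ⟨{w}, (eq_bot_or_eq_top _).resolve_left fun e => hw ?_⟩
  have hm : w ∈ LieSubmodule.lieSpan ℂ (so n) (({w} : Finset W) : Set W) :=
    LieSubmodule.subset_lieSpan (by simp)
  rwa [e, LieSubmodule.mem_bot] at hm

/-- The socle of the dual is the annihilator of `Soc W`, which pairs with `W ⧸ Soc W`, while its
quotient pairs with `Soc W`. -/
theorem IsUniqueProper.socle_dual (h : IsUniqueProper S) {W' : Type*} [AddCommGroup W']
    [Module ℂ W'] [LieRingModule (so n) W'] [LieModule ℂ (so n) W']
    (hB : ∃ B : W →ₗ[ℂ] W' →ₗ[ℂ] ℂ, IsDualPair (n := n) B) :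
    socle n W' ≠ ⊥ ∧ LieModule.IsIrreducible ℂ (so n) (socle n W') ∧
      Nonempty (socle n W' ≃ₗ⁅ℂ, so n⁆ ODual n (W ⧸ socle n W)) ∧
      LieModule.IsIrreducible ℂ (so n) (W' ⧸ socle n W') ∧
      Nonempty ((W' ⧸ socle n W') ≃ₗ⁅ℂ, so n⁆ ODual n (socle n W)) := by
  obtain ⟨B, hB⟩ := hB
  have hT := hB.isUniqueProper_perp h
  rw [hT.socle_eq, h.socle_eq]
  obtain ⟨B₁, hB₁, -⟩ := hB.exists_quotient_perp S
  obtain ⟨B₂, hB₂⟩ := hB.exists_coe_quotient_perp S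
  exact ⟨hT.ne_bot, hT.isIrreducible_coe, hB₁.nonempty_oDual_equiv.map fun e => e.symm,
    hT.isIrreducible_quotient, hB₂.nonempty_oDual_equiv.map fun e => e.symm⟩

end quotient

/-! ### Positive root vectors and local finiteness -/

section positive
variable {n : ℕ}

/-- The index `2`, as an index for the variables `U_p`. -/
def inn2 (hn : 3 ≤ n) : Inn n := .inl ⟨0, by omega⟩

theorem opp_inn2_ne (hn : 3 ≤ n) : opp (inn2 hn) ≠ inn2 hn := by simp [inn2, opp]

theorem inc_inn2 (hn : 3 ≤ n) : inc (inn2 hn) = idx2 hn := rfl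

/-- What matters about a positive root vector that is a rotation `K p q` is that `q ≠ 2` and `p ≠
-2`: it then involves no derivative along `U_2` and kills the powers of `U_2`. -/
theorem IsPos.cases (hn : 3 ≤ n) {Y : so n} (hY : IsPos Y) :
    (∃ p : Inn n, Y = E idx1 (inc p) ∨ Y = -E idx1 (inc p)) ∨
      ∃ p q : Inn n, q ≠ inn2 hn ∧ p ≠ opp (inn2 hn) ∧ Y = E (inc p) (inc q) := by
  rcases hY with ⟨i, j, h⟩ | ⟨i, j, h⟩ | ⟨k, j⟩
  · obtain ⟨j, rfl⟩ := Fin.exists_succ_eq.2 (Fin.ne_zero_of_lt h)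
    rcases Fin.eq_zero_or_eq_succ i with rfl | ⟨i, rfl⟩
    · exact Or.inl ⟨.inl j, Or.inl rfl⟩
    · refine Or.inr ⟨.inl i, .inl j, ?_, by simp [inn2, opp], rfl⟩
      intro e
      have hj := Fin.ext_iff.1 (Sum.inl_injective e)
      have := Fin.lt_def.1 (Fin.succ_lt_succ_iff.1 h)
      simp only at hj
      omega
  · obtain ⟨j, rfl⟩ := Fin.exists_succ_eq.2 (Fin.ne_zero_of_lt h)
    rcases Fin.eq_zero_or_eq_succ i with rfl | ⟨i, rfl⟩
    · exact Or.inl ⟨.inr (.inl j), Or.inl rfl⟩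
    · exact Or.inr ⟨.inl i, .inr (.inl j), by simp [inn2], by simp [inn2, opp], rfl⟩
  · rcases Fin.eq_zero_or_eq_succ j with rfl | ⟨j, rfl⟩
    · refine Or.inl ⟨.inr (.inr k), Or.inr ?_⟩
      exact E_opp_opp idx1 (.inr (.inr k))
    · exact Or.inr ⟨.inr (.inr k), .inr (.inl j), by simp [inn2], by simp [inn2, opp], rfl⟩

theorem isHighestWeight_of_forall (hn : 3 ≤ n) {W : Type*} [AddCommGroup W] [Module ℂ W]
    [LieRingModule (so n) W] [LieModule ℂ (so n) W] {ν : Weight n} {w : W} (hw : w ∈ wt n W ν)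
    (h1 : ∀ p : Inn n, ⁅E idx1 (inc p), w⁆ = 0)
    (h2 : ∀ p q : Inn n, q ≠ inn2 hn → p ≠ opp (inn2 hn) → ⁅E (inc p) (inc q), w⁆ = 0) :
    IsHighestWeight ν w where
  mem_wt := hw
  pos_lie Y hY := by
    rcases hY.cases hn with ⟨p, rfl | rfl⟩ | ⟨p, q, hq, hp, rfl⟩
    · exact h1 p
    · rw [neg_lie, h1, neg_zero]
    · exact h2 p q hq hp

theorem K_one (p q : Inn n) : ev (K p q) 1 = 0 := by
  rw [K, ev_sub, ev_mul, ev_mul, DU_one, DU_one, map_zero, map_zero, sub_zero]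

theorem isHighestWeight_one_PolyR (hn : 3 ≤ n) (r : ℕ) :
    IsHighestWeight (V := PolyR n r) (lam n r) (1 : MvPolynomial (Fin n) ℂ) := by
  refine isHighestWeight_of_forall hn (one_mem_wt_PolyR r) (fun p => ?_) fun p q _ _ => ?_
  · change ev (psi (dr n r) (E idx1 (inc p))) 1 = 0
    rw [psi_E_idx1_inc, ev_V_of_mem_Deg one_mem_Deg, DU_one, ← sum_DU_mul_DU_opp, ev_sum,
      Finset.sum_eq_zero fun p _ => by rw [ev_mul, DU_one, map_zero]]
    simp
  · change ev (psi (dr n r) (E (inc p) (inc q))) 1 = 0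
    rw [psi_E_inc_inc, K_one]

theorem isHighestWeight_one_PolyM (hn : 3 ≤ n) (r : ℕ) :
    IsHighestWeight (V := PolyM n r) (lam n r) (1 : MvPolynomial (Fin n) ℂ) := by
  refine isHighestWeight_of_forall hn ((mem_wt_PolyM_iff r _ _).2 (one_mem_wt_PolyR r))
    (fun p => ?_) fun p q _ _ => ?_
  · change ev (tau n r (E idx1 (inc p))) 1 = 0
    rw [tau_E_idx1_inc, DU_one]
  · change ev (tau n r (E (inc p) (inc q))) 1 = 0
    rw [tau_E_inc_inc, K_one]

/-- `E_{11}` acts on degree `m` by `-(m + d) = -1` and `E_{22}` acts on `U_2^m` by `m = 1 - d`. -/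
theorem UPoly_pow_mem_wt (hn : 3 ≤ n) {r m : ℕ} (hd : dr n r = 1 - m) :
    UPoly (inn2 hn) ^ m ∈ wt n (PolyM n r) (mu hn r) := by
  refine (mem_wt_PolyM_iff r _ _).2 fun H => ?_
  change ev (psi (dr n r) (H : so n)) _ = mu hn r H • UPoly (inn2 hn) ^ m
  have hs : ∑ p : Inn n, ev (H.1.1 (inc p) (inc p) • (U p * DU p)) (UPoly (inn2 hn) ^ m) =
      (H.1.1 (idx2 hn) (idx2 hn) * m) • UPoly (inn2 hn) ^ m := by
    rw [Finset.sum_eq_single (inn2 hn)]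
    · have h1 := smul_eq_sum_of_mem_Deg (UPoly_pow_mem_Deg (inn2 hn) m)
      rw [Finset.sum_eq_single (inn2 hn) (fun p _ hp => by
        rw [ev_DU_UPoly_pow_of_ne hp, map_zero]) (by simp)] at h1
      rw [ev_smul, ev_mul, ← h1, smul_smul, inc_inn2]
    · intro p _ hp
      rw [ev_smul, ev_mul, ev_DU_UPoly_pow_of_ne hp, map_zero, smul_zero]
    · simp
  rw [psi_cartan, ev_add, ev_neg, ev_smul, ev_Iop, ev_sum, hs, mem_Deg.1 (UPoly_pow_mem_Deg _ m),
    ← add_smul, smul_smul, ← neg_smul, ← add_smul]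
  congr 1
  simp only [mu, lam, LinearMap.smul_apply, LinearMap.neg_apply, LinearMap.add_apply,
    LinearMap.sub_apply, eps_apply, smul_eq_mul, hd]
  ring

theorem K_UPoly_pow (hn : 3 ≤ n) {p q : Inn n} (hq : q ≠ inn2 hn) (hp : p ≠ opp (inn2 hn))
    (m : ℕ) : ev (K p q) (UPoly (inn2 hn) ^ m) = 0 := by
  have hp' : opp p ≠ inn2 hn := fun e => hp (by rw [← e, opp_opp])
  rw [K, ev_sub, ev_mul, ev_mul, ev_DU_UPoly_pow_of_ne hq, ev_DU_UPoly_pow_of_ne hp', map_zero,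
    map_zero, sub_zero]

/-- The polynomials of degree less than `N`. -/
def LowDeg (n N : ℕ) : Submodule ℂ (MvPolynomial (Fin n) ℂ) := ⨆ j : Fin N, Deg n (j : ℕ)

instance (N : ℕ) : FiniteDimensional ℂ (LowDeg n N) := Submodule.finiteDimensional_iSup _

theorem Deg_le_LowDeg {j N : ℕ} (h : j < N) : Deg n j ≤ LowDeg n N :=
  le_iSup (fun j : Fin N => Deg n (j : ℕ)) ⟨j, h⟩

theorem exists_mem_LowDeg (f : MvPolynomial (Fin n) ℂ) : ∃ N, f ∈ LowDeg n N := by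
  obtain ⟨s, g, hg, rfl⟩ := exists_finset_sum_of_mem_iSup (fun c : ℕ => Deg n c)
    (iSup_Deg (n := n) ▸ Submodule.mem_top : f ∈ _)
  exact ⟨s.sup id + 1, sum_mem fun c hc =>
    Deg_le_LowDeg (Nat.lt_succ_of_le (Finset.le_sup (f := id) hc)) (hg c)⟩

theorem mem_stabilizer_LowDeg {a : Weyl n} (N : ℕ)
    (h : ∀ j : ℕ, ∀ f ∈ Deg n j, ev a f ∈ Deg n j ∨ ev a f ∈ Deg n (j - 1 : ℂ)) :
    a ∈ stabilizer (LowDeg n N) := by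
  have hle : LowDeg n N ≤ (LowDeg n N).comap (ev a) := by
    refine iSup_le fun j f hf => ?_
    rcases h j f hf with h1 | h1
    · exact Deg_le_LowDeg j.2 h1
    · rcases Nat.eq_zero_or_pos (j : ℕ) with h0 | h0
      · have h2 : ev a f = 0 := by
          refine eq_zero_of_mem_Deg h1 fun m hm => ?_
          rw [h0] at hm
          have : ((m + 1 : ℕ) : ℂ) = 0 := by push_cast; rw [← hm]; simp
          exact absurd (Nat.cast_eq_zero.1 this) (Nat.succ_ne_zero m)
        change ev a f ∈ LowDeg n N
        rw [h2]
        exact zero_mem _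
      · refine Deg_le_LowDeg (j := j - 1) (by omega) ?_
        rwa [Nat.cast_pred h0]
  exact fun f hf => hle hf

/-- Positive root vectors never raise the degree, so polynomials of bounded degree give the
finite-dimensional spaces required in category `𝒪`. -/
theorem psi_mem_stabilizer_LowDeg (hn : 3 ≤ n) (d : ℂ) (N : ℕ) {Y : so n} (hY : IsPos Y) :
    psi d Y ∈ stabilizer (LowDeg n N) := by
  have hV : ∀ p, psi d (E idx1 (inc p)) ∈ stabilizer (LowDeg n N) := fun p => by
    rw [psi_E_idx1_inc]
    exact mem_stabilizer_LowDeg N fun j f hf => Or.inr (ev_V_mem_Deg hf d _)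
  rcases hY.cases hn with ⟨p, rfl | rfl⟩ | ⟨p, q, -, -, rfl⟩
  · exact hV p
  · rw [map_neg]
    exact neg_mem (hV p)
  · rw [psi_E_inc_inc]
    exact mem_stabilizer_LowDeg N fun j f hf => Or.inl (ev_K_mem_Deg hf p q)

theorem tau_mem_stabilizer_LowDeg (hn : 3 ≤ n) (r N : ℕ) {Y : so n} (hY : IsPos Y) :
    tau n r Y ∈ stabilizer (LowDeg n N) := by
  have hD : ∀ p, tau n r (E idx1 (inc p)) ∈ stabilizer (LowDeg n N) := fun p => by
    rw [tau_E_idx1_inc]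
    exact mem_stabilizer_LowDeg N fun j f hf => Or.inr (ev_DU_mem_Deg hf p)
  rcases hY.cases hn with ⟨p, rfl | rfl⟩ | ⟨p, q, -, -, rfl⟩
  · exact hD p
  · rw [map_neg]
    exact neg_mem (hD p)
  · rw [tau_E_inc_inc]
    exact mem_stabilizer_LowDeg N fun j f hf => Or.inl (ev_K_mem_Deg hf p q)

theorem isCategoryO_RMod (hn : 3 ≤ n) (r : ℕ) : IsCategoryO n (RMod n r) where
  weight := iSup_wt_quotient_eq_top (iSup_wt_PolyR r) _
  finite w := by
    obtain ⟨f, rfl⟩ := LieSubmodule.Quotient.surjective_mk' (idealF n r) w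
    obtain ⟨N, hN⟩ := exists_mem_LowDeg (n := n) f
    let π : MvPolynomial (Fin n) ℂ →ₗ[ℂ] RMod n r :=
      (LieSubmodule.Quotient.mk' (idealF n r) : PolyR n r →ₗ[ℂ] RMod n r)
    refine ⟨(LowDeg n N).map π, ⟨f, hN, rfl⟩, inferInstance, ?_⟩
    rintro Y hY _ ⟨g, hg, rfl⟩
    exact ⟨ev (psi (dr n r) Y) g, psi_mem_stabilizer_LowDeg hn _ N hY g hg,
      LieModuleHom.map_lie (LieSubmodule.Quotient.mk' (idealF n r)) Y g⟩
  fg := by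
    refine ⟨{LieSubmodule.Quotient.mk' (idealF n r) (1 : MvPolynomial (Fin n) ℂ)}, ?_⟩
    refine (map_comap_mk' (idealF n r) _).symm.trans ?_
    rw [PolyR_eq_top (N := LieSubmodule.comap _ _), map_mk'_top]
    exact LieSubmodule.subset_lieSpan (Finset.mem_coe.2 (Finset.mem_singleton_self _))

/-- Finite generation is left as a hypothesis because 1 need not generate `M_r`; it is read off from
the submodule structure in `finitelyGenerated_MMod`. -/
theorem isCategoryO_MMod (hn : 3 ≤ n) (r : ℕ)
    (h : ∃ s : Finset (MMod n r), LieSubmodule.lieSpan ℂ (so n) (s : Set (MMod n r)) = ⊤) :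
    IsCategoryO n (MMod n r) where
  weight := iSup_wt_coe_eq_top (iSup_wt_PolyM r) _
  finite w := by
    obtain ⟨N, hN⟩ := exists_mem_LowDeg (n := n) w.1
    let ι : MMod n r →ₗ[ℂ] MvPolynomial (Fin n) ℂ := (MMod n r).toSubmodule.subtype
    refine ⟨(LowDeg n N).comap ι, hN, ?_, fun Y hY g hg => ?_⟩
    · exact Module.Finite.of_injective (ι.restrict (p := (LowDeg n N).comap ι) (q := LowDeg n N)
        fun _ h => h) fun a b e =>
        Subtype.ext (Subtype.ext (congrArg (fun x : LowDeg n N => x.1) e))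
    · exact tau_mem_stabilizer_LowDeg hn r N hY g.1 hg
  fg := h

end positive

/-! ### The structure of `R_r` and `M_r` -/

section structureTheorems
variable {n r m : ℕ}

theorem one_notMem_idealF (hn : 3 ≤ n) (hr : 1 ≤ r) :
    (1 : MvPolynomial (Fin n) ℂ) ∉ quadIdeal n r := fun h =>
  one_ne_zero (eq_zero_of_mem_quadIdeal (j := 0) (by omega) (by omega)
    (by rw [Nat.cast_zero]; exact one_mem_Deg) h)

theorem idealF_ne_top (hn : 3 ≤ n) (hr : 1 ≤ r) : idealF n r ≠ ⊤ := fun e =>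
  one_notMem_idealF hn hr (mem_idealF_iff.1 (e ▸ LieSubmodule.mem_top (R := ℂ) (L := so n)
    (show PolyR n r from (1 : MvPolynomial (Fin n) ℂ))))

theorem mem_MMod_of_mem_Harm (hr : 1 ≤ r) {f : MvPolynomial (Fin n) ℂ} (hf : ev (lap n) f = 0) :
    f ∈ (MMod n r).toSubmodule := by
  obtain ⟨k, rfl⟩ := Nat.exists_eq_add_of_le' hr
  change (laplacian n ^ (k + 1)) f = 0
  rw [← ev_lap, ← map_pow, ev_lap_pow_succ', hf, map_zero]

theorem ev_lap_one : ev (lap n) 1 = 0 := by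
  rw [← sum_DU_mul_DU_opp, ev_sum]
  exact Finset.sum_eq_zero fun p _ => by rw [ev_mul, DU_one, map_zero]

/-- The constant polynomial `1` in `M_r`. -/
def oneM (n : ℕ) (hr : 1 ≤ r) : MMod n r := ⟨_, mem_MMod_of_mem_Harm hr ev_lap_one⟩

theorem oneM_ne_zero (hr : 1 ≤ r) : oneM n hr ≠ 0 := fun e =>
  one_ne_zero (α := MvPolynomial (Fin n) ℂ) (congrArg (fun x : MMod n r => x.1) e)

theorem isHighestWeight_oneM (hn : 3 ≤ n) (hr : 1 ≤ r) : IsHighestWeight (lam n r) (oneM n hr) :=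
  IsHighestWeight.of_coe (isHighestWeight_one_PolyM hn r)

theorem oneM_mem (hr : 1 ≤ r) {T : LieSubmodule ℂ (so n) (MMod n r)} (hT : T ≠ ⊥) :
    oneM n hr ∈ T := by
  have h : T.map (MMod n r).incl ≠ ⊥ := by
    intro e
    refine hT ((LieSubmodule.eq_bot_iff T).2 fun f hf => ?_)
    have := LieSubmodule.mem_map_of_mem (f := (MMod n r).incl) hf
    rw [e, LieSubmodule.mem_bot] at this
    exact Subtype.ext this
  obtain ⟨f, hf, e⟩ := (LieSubmodule.mem_map _).1 (one_mem_of_ne_bot h)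
  rwa [show oneM n hr = f from Subtype.ext e.symm]

theorem isIrreducible_RMod (hn : 3 ≤ n) (hr : 1 ≤ r) (h : Odd n ∨ (Even n ∧ 2 * r < n)) :
    LieModule.IsIrreducible ℂ (so n) (RMod n r) := by
  refine isIrreducible_quotient_of_forall (idealF_ne_top hn hr) fun N hN => ?_
  by_cases hle : N ≤ idealF n r
  · exact Or.inl (le_antisymm hle hN)
  · rcases exists_singular hn hle with h1 | ⟨m, hm, f, hf, hfm, hf0, -⟩
    · exact Or.inr (PolyR_eq_top h1)
    · have h2 : ((2 * m + n : ℕ) : ℂ) = ((2 * r + 2 : ℕ) : ℂ) := by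
        rw [dr] at hm
        push_cast
        linear_combination 2 * hm
      have h3 := Nat.cast_injective h2
      obtain rfl : m = 0 := by
        rcases h with ⟨k, hk⟩ | ⟨-, h⟩ <;> omega
      rw [Nat.cast_zero] at hfm
      exact Or.inr (PolyR_eq_top (one_mem_of_mem_Deg_zero hfm hf0 hf))

/-- The submodule `genHarm n m`, for `d = 1 - m`. -/
def genHarmLie (hm : 1 ≤ m) (hd : dr n r = 1 - m) : LieSubmodule ℂ (so n) (PolyR n r) where
  toSubmodule := genHarm n m
  lie_mem {Y f} hf := by
    refine psi_mem (dr n r) Y (S := stabilizer (genHarm n m)) (Iop_mem_stabilizer_genHarm _)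
      U_mem_stabilizer_genHarm ?_ K_mem_stabilizer_genHarm f hf
    rw [hd]
    exact V_mem_stabilizer_genHarm hm

/-- The contraction argument, now modulo `genHarm`: applying `Δ_1^{j-m}` to the second contraction
gives `Δ_1^{j-m+1} f = 0`. For `j ≥ m` this is membership in `genHarm`; for `j < m` the first
contraction leaves only `j = 0`. -/
theorem eq_zero_of_singular (hm : 1 ≤ m) (hmr : m ≤ r) (hd : dr n r = 1 - m) {j : ℕ}
    {f : MvPolynomial (Fin n) ℂ} (hf : f ∈ Deg n j) (hV : ∀ p, ev (V (dr n r) p) f ∈ genHarm n m)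
    (h0 : f ∉ genHarm n m) : j = 0 := by
  by_contra hj
  have hk : ∀ p, ev (lap n ^ (j - m)) (ev (V (dr n r) p) f) = 0 := by
    intro p
    have hd' : ev (V (dr n r) p) f ∈ Deg n ((j - 1 : ℕ) : ℂ) := by
      rw [Nat.cast_pred (by omega)]
      exact ev_V_mem_Deg hf _ p
    have := ev_lap_pow_eq_zero_of_mem_genHarm hd' (hV p)
    rwa [show j - 1 + 1 - m = j - m by omega] at this
  have h1 : ((r : ℂ) - j / 2) • ev (lap n ^ (j - m + 1)) f = 0 := by
    rw [ev_lap_pow_succ', ← map_smul, ← sum_ev_DU_V hf, map_sum]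
    exact Finset.sum_eq_zero fun p _ => by rw [ev_lap_pow_DU, hk, map_zero]
  -- The exceptional degree `2r` lies entirely in `genHarm` because `m ≤ r`.
  have hjr : j ≠ 2 * r := fun e => h0 (mem_genHarm_of_le (by omega) hf)
  have h2 : (r : ℂ) - j / 2 ≠ 0 := by
    intro e
    refine hjr (Nat.cast_injective (R := ℂ) ?_)
    push_cast
    linear_combination -2 * e
  have h3 := (smul_eq_zero.1 h1).resolve_left h2
  by_cases hjm : m ≤ j
  · exact h0 (mem_genHarm hf (by rwa [show j + 1 - m = j - m + 1 by omega]))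
  -- Now the truncated exponent is zero, so `V_p f = 0` and `Δ_1 f = 0` hold exactly, and the first
  -- contraction reads `j (j - m) f = 0`.
  · rw [show j - m = 0 by omega, zero_add, pow_one] at h3
    have h4 := sum_ev_U_V (d := dr n r) hf
    have h5 : ∀ p, ev (V (dr n r) p) f = 0 := fun p => by
      have := hk p
      rwa [show j - m = 0 by omega, pow_zero, ev_one] at this
    simp only [h5, map_zero, Finset.sum_const_zero, h3, zero_sub] at h4
    have hf0 : f ≠ 0 := by
      rintro rfl
      exact h0 (zero_mem _)
    have h6 := (smul_eq_zero.1 (neg_eq_zero.1 h4.symm)).resolve_right hf0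
    rcases mul_eq_zero.1 h6 with h7 | h7
    · exact hj (Nat.cast_eq_zero.1 h7)
    · refine hjm (le_of_eq (Nat.cast_injective (R := ℂ) ?_))
      rw [hd] at h7
      linear_combination -h7

theorem idealF_le_genHarmLie (hm : 1 ≤ m) (hmr : m ≤ r) (hd : dr n r = 1 - m) :
    idealF n r ≤ genHarmLie hm hd := fun _ hf => quadIdeal_le_genHarm hmr (mem_idealF_iff.1 hf)

theorem eq_or_eq_genHarmLie (hn : 3 ≤ n) (hm : 1 ≤ m) (hmr : m ≤ r) (hd : dr n r = 1 - m)
    (N : LieSubmodule ℂ (so n) (PolyR n r)) (hN : idealF n r ≤ N) :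
    N = idealF n r ∨ N = genHarmLie hm hd ∨ N = ⊤ := by
  by_cases hle : N ≤ idealF n r
  · exact Or.inl (le_antisymm hle hN)
  refine Or.inr ?_
  rcases exists_singular hn hle with h1 | ⟨k, hk, f, hf, hfk, hf0, hq⟩
  · exact Or.inr (PolyR_eq_top h1)
  obtain rfl : k = m := Nat.cast_injective (R := ℂ) (by rw [hk, hd]; ring)
  -- `F Δ_1 f` has degree `m < 2r`, too small for a nonzero multiple of `F^r`, and multiplication by
  -- `F` is injective.
  have hl : ev (lap n) f = 0 := by
    have h1 : ev (quad n) (ev (lap n) f) ∈ Deg n k := by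
      have := ev_quad_mem_Deg (ev_lap_mem_Deg hfk)
      rwa [sub_add_cancel] at this
    have h2 := eq_zero_of_mem_quadIdeal (by omega) (by omega) h1 hq
    refine ev_quad_pow_injective (n := n) (by omega) 1 ?_
    rw [pow_one, h2, map_zero]
  have hH : Harm n k ≤ N.toSubmodule := by
    refine (Harm_le_of_stable hn (P := N.toSubmodule ⊓ Harm n k) inf_le_right ?_ ?_).trans
      inf_le_left
    · intro e
      have : f ∈ (⊥ : Submodule ℂ (MvPolynomial (Fin n) ℂ)) := e ▸ ⟨hf, hfk, hl⟩
      exact hf0 ((Submodule.mem_bot ℂ).1 this)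
    · exact fun p q g hg => ⟨PolyR_K N p q g hg.1, ev_K_mem_Harm hg.2 p q⟩
  have hgen : genHarm n k ≤ N.toSubmodule := genHarm_le_of_Harm_le hn (PolyR_U N) hH
  by_cases hle' : N.toSubmodule ≤ genHarm n k
  · exact Or.inl (le_antisymm hle' hgen)
  · obtain ⟨j, g, hg, hgj, hg0, hmin⟩ := exists_minimal_homogeneous (PolyR_eul N) hle'
    have hj : j = 0 := eq_zero_of_singular hm hmr hd hgj
      (fun p => hmin _ (PolyR_V N p g hg) (ev_V_mem_Deg hgj _ p)) hg0
    rw [hj, Nat.cast_zero] at hgj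
    refine Or.inr (PolyR_eq_top (one_mem_of_mem_Deg_zero hgj ?_ hg))
    rintro rfl
    exact hg0 (zero_mem _)

/-- The image of `genHarm n m` in `R_r`. -/
def socR (hm : 1 ≤ m) (hd : dr n r = 1 - m) : LieSubmodule ℂ (so n) (RMod n r) :=
  (genHarmLie hm hd).map (LieSubmodule.Quotient.mk' (idealF n r))

theorem UPoly_pow_ne_zero (a : Inn n) (k : ℕ) : UPoly a ^ k ≠ 0 := pow_ne_zero k (UPoly_ne_zero a)

theorem isUniqueProper_socR (hn : 3 ≤ n) (hm : 1 ≤ m) (hmr : m ≤ r) (hd : dr n r = 1 - m) :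
    IsUniqueProper (socR hm hd) := by
  have hH := UPoly_pow_mem_Harm (opp_inn2_ne hn) m
  refine isUniqueProper_map (idealF_le_genHarmLie hm hmr hd) (fun e => ?_) (fun e => ?_)
    (eq_or_eq_genHarmLie hn hm hmr hd)
  -- `U_2^m` witnesses that `genHarm` exceeds `F^r A`: its degree is below `2r`.
  · have h1 : UPoly (inn2 hn) ^ m ∈ genHarmLie (n := n) (r := r) hm hd := Harm_le_genHarm hH
    rw [e] at h1
    exact UPoly_pow_ne_zero _ _
      (eq_zero_of_mem_quadIdeal (by omega) (by omega) hH.1 (mem_idealF_iff.1 h1))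
  · exact one_notMem_genHarm hm (show (1 : MvPolynomial (Fin n) ℂ) ∈ genHarmLie (r := r) hm hd from
      e ▸ LieSubmodule.mem_top (R := ℂ) (L := so n) (show PolyR n r from
        (1 : MvPolynomial (Fin n) ℂ)))

theorem finiteDimensional_quotient_socR (hm : 1 ≤ m) (hd : dr n r = 1 - m) :
    FiniteDimensional ℂ (RMod n r ⧸ socR hm hd) := by
  let φ : PolyR n r →ₗ⁅ℂ, so n⁆ (RMod n r ⧸ socR hm hd) :=
    (LieSubmodule.Quotient.mk' (socR hm hd)).comp (LieSubmodule.Quotient.mk' (idealF n r))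
  let π : MvPolynomial (Fin n) ℂ →ₗ[ℂ] (RMod n r ⧸ socR (n := n) (r := r) hm hd) :=
    (φ : PolyR n r →ₗ[ℂ] (RMod n r ⧸ socR hm hd))
  have hπ : ∀ f ∈ genHarm n m, π f = 0 := by
    intro f hf
    have h1 : LieSubmodule.Quotient.mk' (idealF n r) f ∈ socR (n := n) (r := r) hm hd :=
      LieSubmodule.mem_map_of_mem (N := genHarmLie (n := n) (r := r) hm hd) hf
    exact (LieSubmodule.Quotient.mk_eq_zero _).2 h1
  have key : ∀ f : MvPolynomial (Fin n) ℂ, ∃ a : LowDeg n (2 * m), π a = π f := by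
    intro f
    have hf : f ∈ ⨆ c : ℕ, Deg n c := iSup_Deg (n := n) ▸ Submodule.mem_top
    induction hf using Submodule.iSup_induction' with
    | mem c f hf =>
      by_cases hc : c < 2 * m
      · exact ⟨⟨f, Deg_le_LowDeg hc hf⟩, rfl⟩
      · exact ⟨0, by rw [hπ f (mem_genHarm_of_le (by omega) hf)]; exact π.map_zero⟩
    | zero => exact ⟨0, rfl⟩
    | add f g _ _ hf hg =>
      obtain ⟨a, ha⟩ := hf
      obtain ⟨b, hb⟩ := hg
      exact ⟨a + b, by rw [π.map_add f g, ← ha, ← hb]; exact π.map_add _ _⟩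
  refine Module.Finite.of_surjective (π ∘ₗ (LowDeg n (2 * m)).subtype) fun w => ?_
  obtain ⟨w, rfl⟩ := LieSubmodule.Quotient.surjective_mk' _ w
  obtain ⟨f, rfl⟩ := LieSubmodule.Quotient.surjective_mk' _ w
  exact key f

theorem finiteDimensional_of_isDualPair {W W' : Type*} [AddCommGroup W] [Module ℂ W]
    [LieRingModule (so n) W] [LieModule ℂ (so n) W] [AddCommGroup W'] [Module ℂ W']
    [LieRingModule (so n) W'] [LieModule ℂ (so n) W'] {B : W →ₗ[ℂ] W' →ₗ[ℂ] ℂ}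
    (hB : IsDualPair (n := n) B) [FiniteDimensional ℂ W] : FiniteDimensional ℂ W' :=
  Module.Finite.of_injective B.flip ((injective_iff_map_eq_zero _).2 fun _ hg =>
    hB.eq_zero_of_forall_right (LinearMap.congr_fun hg))

/-- The polynomial `U_2^m` in `M_r`. -/
def powM (hn : 3 ≤ n) (hr : 1 ≤ r) (m : ℕ) : MMod n r :=
  ⟨_, mem_MMod_of_mem_Harm hr (UPoly_pow_mem_Harm (opp_inn2_ne hn) m).2⟩

/-- `genHarm` lives in degrees at least `m`, and different degrees are orthogonal because the Euler
operator is self-adjoint. -/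
theorem polyForm_eq_zero_of_mem_genHarm {j : ℕ} (hj : j < m) {f g : MvPolynomial (Fin n) ℂ}
    (hf : f ∈ genHarm n m) (hg : g ∈ Deg n j) : polyForm n f g = 0 := by
  have hle : genHarm n m ≤ LinearMap.ker ((polyForm n).flip g) := by
    refine genHarm_le fun i hi f hf _ => ?_
    change polyForm n f g = 0
    have h1 := polyForm_ev (eul n) f g
    rw [fourier_eul, mem_Deg.1 hf, mem_Deg.1 hg, map_smul, map_smul, LinearMap.smul_apply,
      smul_eq_mul, smul_eq_mul, ← sub_eq_zero, ← sub_mul] at h1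
    refine (mul_eq_zero.1 h1).resolve_left (sub_ne_zero.2 fun e => ?_)
    have := Nat.cast_injective e
    omega
  exact hle hf

/-- In `M_r` itself the derivative of `U_2^m` along `U_2` does not vanish. It has degree `m - 1`,
hence is orthogonal to `genHarm` and dies in the quotient by `T`. -/
theorem isHighestWeight_mk'_powM (hn : 3 ≤ n) (hr : 1 ≤ r) (hm : 1 ≤ m) (hd : dr n r = 1 - m)
    {T : LieSubmodule ℂ (so n) (MMod n r)}
    (hT : ∀ g : MMod n r, (∀ f ∈ genHarm n m, polyForm n f g.1 = 0) → g ∈ T) :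
    IsHighestWeight (mu hn r) (LieSubmodule.Quotient.mk' T (powM hn hr m)) := by
  refine isHighestWeight_of_forall hn ?_ (fun p => ?_) fun p q hq hp => ?_
  · intro H
    have h : ⁅(H : so n), powM hn hr m⁆ = mu hn r H • powM hn hr m :=
      Subtype.ext (UPoly_pow_mem_wt hn hd H)
    rw [← LieModuleHom.map_lie, h, map_smul]
  · rw [← LieModuleHom.map_lie, LieSubmodule.Quotient.mk_eq_zero]
    refine hT _ fun f hf => ?_
    change polyForm n f (ev (tau n r (E idx1 (inc p))) (UPoly (inn2 hn) ^ m)) = 0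
    refine polyForm_eq_zero_of_mem_genHarm (j := m - 1) (by omega) hf ?_
    rw [tau_E_idx1_inc, Nat.cast_pred (by omega)]
    exact ev_DU_mem_Deg (UPoly_pow_mem_Deg _ m) p
  · have h : ⁅E (inc p) (inc q), powM hn hr m⁆ = 0 := by
      refine Subtype.ext ?_
      change ev (tau n r (E (inc p) (inc q))) (UPoly (inn2 hn) ^ m) = 0
      rw [tau_E_inc_inc, K_UPoly_pow hn hq hp]
    rw [← LieModuleHom.map_lie, h, map_zero]

theorem exists_degree (hn : 3 ≤ n) (h : Even n ∧ n ≤ 2 * r) :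
    ∃ m : ℕ, 1 ≤ m ∧ m ≤ r ∧ dr n r = 1 - m := by
  obtain ⟨⟨k, hk⟩, hr⟩ := h
  -- This is `1 - d` for `n = 2k`; it is positive since `k ≤ r` and at most `r` since `k ≥ 1`.
  refine ⟨r + 1 - k, by omega, by omega, ?_⟩
  rw [dr, Nat.cast_sub (by omega), hk]
  push_cast
  ring

theorem finitelyGenerated_MMod (hn : 3 ≤ n) (hr : 1 ≤ r) :
    ∃ s : Finset (MMod n r), LieSubmodule.lieSpan ℂ (so n) (s : Set (MMod n r)) = ⊤ := by
  obtain ⟨B, hB, -⟩ := exists_isDualPair_RMod n r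
  by_cases h : Even n ∧ n ≤ 2 * r
  · obtain ⟨m, hm, hmr, hd⟩ := exists_degree hn h
    exact (hB.isUniqueProper_perp (isUniqueProper_socR hn hm hmr hd)).exists_lieSpan_eq_top
  · have hR : LieModule.IsIrreducible ℂ (so n) (RMod n r) := by
      refine isIrreducible_RMod hn hr ?_
      rcases Nat.even_or_odd n with he | ho
      · exact Or.inr ⟨he, not_le.1 fun hc => h ⟨he, hc⟩⟩
      · exact Or.inl ho
    have hM := hB.isIrreducible
    exact exists_lieSpan_eq_top_of_isIrreducible

/-- The class of the constant polynomial `1` in `R_r`. -/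
def oneR (n r : ℕ) : RMod n r :=
  LieSubmodule.Quotient.mk' (idealF n r) (show PolyR n r from (1 : MvPolynomial (Fin n) ℂ))

theorem oneR_ne_zero (hn : 3 ≤ n) (hr : 1 ≤ r) : oneR n r ≠ 0 := fun e => by
  have h : (show PolyR n r from (1 : MvPolynomial (Fin n) ℂ)) ∈ idealF n r :=
    (LieSubmodule.Quotient.mk_eq_zero (idealF n r)).1 e
  exact one_notMem_idealF hn hr (mem_idealF_iff.1 h)

theorem isHighestWeight_oneR (hn : 3 ≤ n) (r : ℕ) : IsHighestWeight (lam n r) (oneR n r) :=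
  IsHighestWeight.mk' (W := PolyR n r) (isHighestWeight_one_PolyR hn r)

theorem nonempty_equiv_RMod (hn : 3 ≤ n) (hr : 1 ≤ r)
    [LieModule.IsIrreducible ℂ (so n) (RMod n r)] :
    Nonempty (RMod n r ≃ₗ⁅ℂ, so n⁆ LMod (lam n r)) :=
  (isHighestWeight_oneR hn r).nonempty_equiv (oneR_ne_zero hn hr)

theorem nonempty_equiv_MMod (hn : 3 ≤ n) (hr : 1 ≤ r)
    [LieModule.IsIrreducible ℂ (so n) (MMod n r)] :
    Nonempty (MMod n r ≃ₗ⁅ℂ, so n⁆ LMod (lam n r)) :=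
  (isHighestWeight_oneM hn hr).nonempty_equiv (oneM_ne_zero hr)

theorem nonempty_equiv_submodule (hn : 3 ≤ n) (hr : 1 ≤ r) {T : LieSubmodule ℂ (so n) (MMod n r)}
    (hT : T ≠ ⊥) [LieModule.IsIrreducible ℂ (so n) T] :
    Nonempty (T ≃ₗ⁅ℂ, so n⁆ LMod (lam n r)) := by
  have h : IsHighestWeight (lam n r) (⟨oneM n hr, oneM_mem hr hT⟩ : T) :=
    IsHighestWeight.of_coe (isHighestWeight_oneM hn hr)
  exact h.nonempty_equiv fun e => oneM_ne_zero hr (congrArg Subtype.val e)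

theorem nonempty_equiv_quotient (hn : 3 ≤ n) (hr : 1 ≤ r) (hm : 1 ≤ m) (hd : dr n r = 1 - m)
    {T : LieSubmodule ℂ (so n) (MMod n r)}
    (hT : ∀ g : MMod n r, g ∈ T ↔ ∀ f ∈ genHarm n m, polyForm n f g.1 = 0)
    [LieModule.IsIrreducible ℂ (so n) (MMod n r ⧸ T)] :
    Nonempty ((MMod n r ⧸ T) ≃ₗ⁅ℂ, so n⁆ LMod (mu hn r)) := by
  refine (isHighestWeight_mk'_powM hn hr hm hd fun g hg => (hT g).2 hg).nonempty_equiv fun e => ?_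
  -- The class is nonzero: `U_2^m` is harmonic, hence in `genHarm`, but not orthogonal to itself.
  exact polyForm_UPoly_pow_ne_zero (inn2 hn) m ((hT _).1 ((LieSubmodule.Quotient.mk_eq_zero _).1 e) _
    (Harm_le_genHarm (UPoly_pow_mem_Harm (opp_inn2_ne hn) m)))

theorem mem_perp_socR (hm : 1 ≤ m) (hd : dr n r = 1 - m) {B : RMod n r →ₗ[ℂ] MMod n r →ₗ[ℂ] ℂ}
    (hB : IsDualPair (n := n) B)
    (hBf : ∀ f g, B (LieSubmodule.Quotient.mk' (idealF n r) f) g = polyForm n f g.1) (g : MMod n r) :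
    g ∈ hB.perp (socR hm hd) ↔ ∀ f ∈ genHarm n m, polyForm n f g.1 = 0 := by
  constructor
  · intro hg f hf
    refine (hBf f g).symm.trans ?_
    exact hg _ (LieSubmodule.mem_map_of_mem (N := genHarmLie (n := n) (r := r) hm hd) hf)
  · intro hg w hw
    obtain ⟨f, hf, rfl⟩ := (LieSubmodule.mem_map _).1 hw
    exact (hBf f g).trans (hg f hf)

theorem nonempty_oDual_RMod_equiv (n r : ℕ) :
    Nonempty (ODual n (RMod n r) ≃ₗ⁅ℂ, so n⁆ MMod n r) := by
  obtain ⟨B, hB, -⟩ := exists_isDualPair_RMod n r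
  exact hB.nonempty_oDual_equiv

/-- The simple case: `n` is odd, or `n` is even and `r < n / 2`. -/
theorem MMod_simple (hn : 3 ≤ n) (hr : 1 ≤ r) (h : Odd n ∨ (Even n ∧ 2 * r < n)) :
    LieModule.IsIrreducible ℂ (so n) (MMod n r) ∧
      Nonempty (MMod n r ≃ₗ⁅ℂ, so n⁆ RMod n r) ∧
      Nonempty (MMod n r ≃ₗ⁅ℂ, so n⁆ LMod (lam n r)) := by
  obtain ⟨B, hB, -⟩ := exists_isDualPair_RMod n r
  have hR := isIrreducible_RMod hn hr h
  have hM := hB.isIrreducible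
  obtain ⟨e₁⟩ := nonempty_equiv_MMod hn hr
  obtain ⟨e₂⟩ := nonempty_equiv_RMod hn hr
  exact ⟨hM, ⟨e₁.trans e₂.symm⟩, ⟨e₁⟩⟩

theorem mem_socle_MMod (hn : 3 ≤ n) (hm : 1 ≤ m) (hmr : m ≤ r) (hd : dr n r = 1 - m)
    (g : MMod n r) :
    g ∈ socle n (MMod n r) ↔ ∀ f ∈ genHarm n m, polyForm n f g.1 = 0 := by
  obtain ⟨B, hB, hBf⟩ := exists_isDualPair_RMod n r
  rw [(hB.isUniqueProper_perp (isUniqueProper_socR hn hm hmr hd)).socle_eq]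
  exact mem_perp_socR hm hd hB hBf g

theorem finiteDimensional_socle_MMod (hn : 3 ≤ n) (hm : 1 ≤ m) (hmr : m ≤ r)
    (hd : dr n r = 1 - m) : FiniteDimensional ℂ (socle n (MMod n r)) := by
  obtain ⟨B, hB, -⟩ := exists_isDualPair_RMod n r
  rw [(hB.isUniqueProper_perp (isUniqueProper_socR hn hm hmr hd)).socle_eq]
  obtain ⟨B₁, hB₁, -⟩ := hB.exists_quotient_perp (socR hm hd)
  have hfin := finiteDimensional_quotient_socR (n := n) hm hd
  exact finiteDimensional_of_isDualPair hB₁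

/-- The non-simple case: `n` is even and `r ≥ n / 2`. -/
theorem MMod_nonsimple (hn : 3 ≤ n) (hr : 1 ≤ r) (hm : 1 ≤ m) (hmr : m ≤ r)
    (hd : dr n r = 1 - m) :
    LieModule.IsIrreducible ℂ (so n) (socle n (MMod n r)) ∧
      FiniteDimensional ℂ (socle n (MMod n r)) ∧
      Nonempty (socle n (MMod n r) ≃ₗ⁅ℂ, so n⁆ ODual n (RMod n r ⧸ socle n (RMod n r))) ∧
      Nonempty (socle n (MMod n r) ≃ₗ⁅ℂ, so n⁆ LMod (lam n r)) ∧
      LieModule.IsIrreducible ℂ (so n) (MMod n r ⧸ socle n (MMod n r)) ∧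
      Nonempty ((MMod n r ⧸ socle n (MMod n r)) ≃ₗ⁅ℂ, so n⁆ ODual n (socle n (RMod n r))) ∧
      Nonempty ((MMod n r ⧸ socle n (MMod n r)) ≃ₗ⁅ℂ, so n⁆ LMod (mu hn r)) := by
  have hdual := (exists_isDualPair_RMod n r).imp fun _ h => h.1
  have hS := isUniqueProper_socR hn hm hmr hd
  have h1 := hS.socle_dual hdual
  have hsoc := h1.2.1
  have hquot := h1.2.2.2.1
  exact ⟨hsoc, finiteDimensional_socle_MMod hn hm hmr hd, h1.2.2.1,
    nonempty_equiv_submodule hn hr h1.1, hquot, h1.2.2.2.2,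
    nonempty_equiv_quotient hn hr hm hd (mem_socle_MMod hn hm hmr hd)⟩

end structureTheorems

end HigherHarmonics

end

theorem corollary9p7 (n r : ℕ) (hn : 3 ≤ n) (hr : 1 ≤ r) :
    IsCategoryO n (RMod n r) ∧ IsCategoryO n (MMod n r) ∧
    Nonempty (ODual n (RMod n r) ≃ₗ⁅ℂ, so n⁆ MMod n r) ∧
    (Odd n ∨ (Even n ∧ 2 * r < n) →
      LieModule.IsIrreducible ℂ (so n) (MMod n r) ∧
      Nonempty (MMod n r ≃ₗ⁅ℂ, so n⁆ RMod n r) ∧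
      Nonempty (MMod n r ≃ₗ⁅ℂ, so n⁆ LMod (lam n r))) ∧
    (Even n ∧ n ≤ 2 * r →
      LieModule.IsIrreducible ℂ (so n) (socle n (MMod n r)) ∧
      FiniteDimensional ℂ (socle n (MMod n r)) ∧
      Nonempty (socle n (MMod n r) ≃ₗ⁅ℂ, so n⁆ ODual n (RMod n r ⧸ socle n (RMod n r))) ∧
      Nonempty (socle n (MMod n r) ≃ₗ⁅ℂ, so n⁆ LMod (lam n r)) ∧
      LieModule.IsIrreducible ℂ (so n) (MMod n r ⧸ socle n (MMod n r)) ∧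
      Nonempty ((MMod n r ⧸ socle n (MMod n r)) ≃ₗ⁅ℂ, so n⁆ ODual n (socle n (RMod n r))) ∧
      Nonempty ((MMod n r ⧸ socle n (MMod n r)) ≃ₗ⁅ℂ, so n⁆ LMod (mu hn r))) :=
  ⟨isCategoryO_RMod hn r, isCategoryO_MMod hn r (finitelyGenerated_MMod hn hr),
    nonempty_oDual_RMod_equiv n r, MMod_simple hn hr, fun h =>
      (exists_degree hn h).elim fun _ hm => MMod_nonsimple hn hr hm.1 hm.2.1 hm.2.2⟩
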